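/- Let $\mathcal{F}^\omega[\mathbb{P}]$ be the following classical system. It is weakly extensional Peano arithmetic $\mathsf{WE}\mbox{-}\mathsf{PA}^\omega$ (many-sorted classical logic with equality at type $0$ as the only relation symbol; zero, successor, induction; the combinators $\Pi,\Sigma$ and simultaneous primitive recursors in all types; the quantifier-free extensionality rule, which from $\varphi_0\to s=_\rho t$ with $\varphi_0$ quantifier-free derives $\varphi_0\to r[s]=_\tau r[t]$) over all finite types built from the ground types $0$, $\Omega$ (sample points) and $S$ (events), where $\tau(\sigma)$ is the type of functionals from $\sigma$ to $\tau$ and $1:=0(0)$. It also has quantifier-free choice $\mathsf{QF}\mbox{-}\mathsf{AC}$ and dependent choice $\mathsf{DC}$ for tuples of variables of all types; constants for equality on $\Omega$, $\in$, $\cup$, $(\cdot)^c$, $\emptyset$, an element of $\Omega$, and $\mathbb{P}$ of type $1(S)$; and axioms saying that equality on $\Omega$ is an equivalence relation, that $\in$ obeys the set-theoretic laws for $\cup$, $(\cdot)^c$, $\emptyset$, and that $\mathbb{P}$ is a probability content: $0\le\mathbb{P}(A)\le 1$, $\mathbb{P}(\emptyset)=0$, $\mathbb{P}(\emptyset^c)=1$,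 $A\subseteq B\to\mathbb{P}(A)\le\mathbb{P}(B)$ and $\mathbb{P}(A\cup B)=\mathbb{P}(A)+\mathbb{P}(B)-\mathbb{P}(A\cap B)$. Real numbers are represented by objects of type $1$, as sequences of coded rationals with Cauchy modulus $2^{-n}$. Equality of events $A=_SB$ means $\forall\varpi^\Omega(\varpi\in A\leftrightarrow\varpi\in B)$, and equality at function types is pointwise. Let $\mathsf{UB}^\Omega_0$ be the uniform boundedness principle, i.e. the schema $$\forall y^{\alpha(0)}\Big(\forall k^0,x^\alpha,\underline z^{\underline\beta}\,\exists w^0\,\varphi_\exists(y,k,\min\nolimits_\alpha(x,yk),\underline z,w)\to\exists\chi^{1}\,\forall k^0,x^\alpha,\underline z^{\underline\beta}\,\exists w\le_0\chi k\;\varphi_\exists(y,k,\min\nolimits_\alpha(x,yk),\underline z,w)\Big),$$ where $\alpha=0(\sigma_k)\dots(\sigma_1)$, each type in $\underline\beta$ has the form $\Omega(\tau_m)\dots(\tau_1)$, $\min_\alpha$ is the pointwise minimum, and $\varphi_\exists$ (possibly with parameters) is a block of existential quantifiers of admissible types in front of a quantifier-free formula. A type is small if it is $\rho(0)\dots(0)$,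 and admissible if it is $\rho(\sigma_j)\dots(\sigma_1)$ with all $\sigma_i$ small, where $\rho\in\{0,\Omega,S\}$. For a formula $\varphi(\varpi^\Omega)$ and a real $\lambda$, write $\mathbb{P}[\varphi]\ge\lambda$ for the formula $\forall A^S(\mathbb{P}(A)<\lambda\to\exists\varpi^\Omega(\varpi\in A^c\wedge\varphi(\varpi)))$, and $\mathbb{P}[\varphi]\le\lambda$ for $\mathbb{P}[\overline\varphi]\ge 1-\lambda$, where $\overline\varphi$ is the De Morgan dual of $\varphi$. For $A^{S(0)}$ let $(A{\uparrow})_0:=A_0$ and $(A{\uparrow})_{n+1}:=A_{n+1}\cap\big(\bigcup_{i=0}^nA_i\big)^c$. **Proposition.** The system $\mathcal{F}^\omega[\mathbb{P}]+\mathsf{UB}^\Omega_0$ proves ($\sigma$-additivity), i.e. the conjunction of $$\forall A^{S(0)}\,\forall l^0\Big(\mathbb{P}[\exists n^0(\varpi\in A_n)]\ge\sum_{n=0}^l\mathbb{P}((A{\uparrow})_n)\Big)$$ and $$\forall A^{S(0)}\,\forall k^0\,\exists l^0\Big(\mathbb{P}[\exists n^0(\varpi\in A_n)]\le\sum_{n=0}^l\mathbb{P}((A{\uparrow})_n)+2^{-k}\Big).$$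 -/

import Mathlib

/-! The classical system of finite type arithmetic for probability contents: its types, terms,
formulas and derivations, the coding of real numbers in it, the outer content of a formula, the
uniform boundedness principle, and the statement of sigma-additivity. -/

namespace ProbContent

/-! ### Types -/

/-- Finite types over the ground types `0` (`nat`), `Ω` (`sample`) and `S` (`event`). The type
`τ(σ)` of functionals mapping type `σ` to type `τ` is `arr σ τ`, written `σ ⇒ₜ τ`. -/
inductive Ty : Type
  | nat : Ty
  | sample : Ty
  | event : Ty
  | arr : Ty → Ty → Ty

infixr:60 " ⇒ₜ " => Ty.arr

namespace Ty

/-- The type `1 = 0(0)`, whose objects represent real numbers. -/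
abbrev real : Ty := nat ⇒ₜ nat

/-- `arrows [σ₁, …, σₖ] τ` is `τ(σₖ)…(σ₁)`: arguments of types `σ₁, …, σₖ`, in this order. -/
def arrows : List Ty → Ty → Ty
  | [], τ => τ
  | σ :: σs, τ => σ ⇒ₜ arrows σs τ

/-- Small types: `ρ(0)…(0)` with `ρ` a ground type. -/
def Small : Ty → Prop
  | nat => True
  | sample => True
  | event => True
  | arr σ τ => σ = nat ∧ Small τ

/-- Admissible types: `ρ(σₖ)…(σ₁)` with `ρ` a ground type and all `σᵢ` small. -/
def Admissible : Ty → Prop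
  | nat => True
  | sample => True
  | event => True
  | arr σ τ => Small σ ∧ Admissible τ

/-- Types of the form `Ω(τₘ)…(τ₁)`. -/
def EndsInSample : Ty → Prop
  | nat => False
  | sample => True
  | event => False
  | arr _ τ => EndsInSample τ

/-- The type of the step functional for the component of type `ρ` in a simultaneous recursion
with component types `ρs`: it takes the tuple of previous values and the recursion index. -/
abbrev step (ρs : List Ty) (ρ : Ty) : Ty := arrows ρs (nat ⇒ₜ ρ)

end Ty

open Ty

/-! ### Variables and terms -/

/-- A context: the list of the types of the free variables, the most recently bound first. -/
abbrev Ctx : Type := List Ty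

/-- The variables of type `τ` in a context (de Bruijn indices, typed). -/
inductive Var : Ctx → Ty → Type
  | zero {Γ : Ctx} {τ : Ty} : Var (τ :: Γ) τ
  | succ {Γ : Ctx} {σ τ : Ty} (v : Var Γ τ) : Var (σ :: Γ) τ

namespace Var

/-- A variable of the first part of a concatenated context. -/
def inl {Δ Γ : Ctx} {τ : Ty} : Var Δ τ → Var (Δ ++ Γ) τ
  | zero => zero
  | succ v => succ (inl v)

/-- A variable of the second part of a concatenated context. -/
def inr {Γ : Ctx} {τ : Ty} : (Δ : Ctx) → Var Γ τ → Var (Δ ++ Γ) τ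
  | [], v => v
  | _ :: Δ, v => succ (inr Δ v)

/-- The corresponding entry of a list of types to which an operation has been applied. -/
def map (f : Ty → Ty) {Γ : Ctx} {τ : Ty} : Var Γ τ → Var (Γ.map f) (f τ)
  | zero => zero
  | succ v => succ (map f v)

end Var

/-- The constants of the language. -/
inductive Const : Ty → Type
  | zero : Const nat
  | succ : Const (nat ⇒ₜ nat)
  /-- The combinator `Π`. -/
  | combK (ρ τ : Ty) : Const (ρ ⇒ₜ τ ⇒ₜ ρ)
  /-- The combinator `Σ`. -/
  | combS (δ ρ τ : Ty) : Const ((δ ⇒ₜ ρ ⇒ₜ τ) ⇒ₜ (δ ⇒ₜ ρ) ⇒ₜ δ ⇒ₜ τ)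
  /-- The component `i` of the simultaneous recursor for the tuple of types `ρs`; arguments are
  the recursion index, the tuple of initial values and the tuple of step functionals. -/
  | recur (ρs : List Ty) (ρ : Ty) (i : Var ρs ρ) :
      Const (nat ⇒ₜ arrows ρs (arrows (ρs.map (step ρs)) ρ))
  /-- Equality on `Ω`. -/
  | eqΩ : Const (sample ⇒ₜ sample ⇒ₜ nat)
  /-- The element relation. -/
  | mem : Const (sample ⇒ₜ event ⇒ₜ nat)
  | union : Const (event ⇒ₜ event ⇒ₜ event)
  | compl : Const (event ⇒ₜ event)
  | empty : Const event
  /-- The probability content. -/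
  | prob : Const (event ⇒ₜ real)
  /-- A witness that `Ω` is not empty. -/
  | point : Const sample

/-- Terms in a context. -/
inductive Tm (Γ : Ctx) : Ty → Type
  | var {τ : Ty} (v : Var Γ τ) : Tm Γ τ
  | const {τ : Ty} (c : Const τ) : Tm Γ τ
  | app {σ τ : Ty} (f : Tm Γ (σ ⇒ₜ τ)) (a : Tm Γ σ) : Tm Γ τ

infixl:90 " ⊙ " => Tm.app

/-- Renamings of variables. -/
abbrev Ren (Γ Δ : Ctx) : Type := (τ : Ty) → Var Γ τ → Var Δ τ

/-- Substitutions of terms for variables; equivalently, tuples of terms over `Δ` of the types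
listed in `Γ`. -/
abbrev Sub (Γ Δ : Ctx) : Type := (τ : Ty) → Var Γ τ → Tm Δ τ

/-- Extend a renaming under a binder. -/
def Ren.up {Γ Δ : Ctx} (r : Ren Γ Δ) {σ : Ty} : Ren (σ :: Γ) (σ :: Δ)
  | _, .zero => .zero
  | _, .succ v => .succ (r _ v)

/-- Extend a renaming under a block of binders. -/
def Ren.upL {Γ Δ : Ctx} (r : Ren Γ Δ) : (Θ : Ctx) → Ren (Θ ++ Γ) (Θ ++ Δ)
  | [] => r
  | _ :: Θ => (Ren.upL r Θ).up

/-- The renaming that makes room for one new variable. -/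
def Ren.wk {Γ : Ctx} {σ : Ty} : Ren Γ (σ :: Γ) := fun _ v => .succ v

/-- The renaming from the empty context. -/
def Ren.nil {Γ : Ctx} : Ren [] Γ := fun _ v => by cases v

namespace Tm

/-- Apply a renaming to a term. -/
def ren {Γ Δ : Ctx} (r : Ren Γ Δ) {τ : Ty} : Tm Γ τ → Tm Δ τ
  | var v => var (r _ v)
  | const c => const c
  | app f a => app (ren r f) (ren r a)

/-- Apply a substitution to a term. -/
def subst {Γ Δ : Ctx} (s : Sub Γ Δ) {τ : Ty} : Tm Γ τ → Tm Δ τ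
  | var v => s _ v
  | const c => const c
  | app f a => app (subst s f) (subst s a)

/-- Weakening by one variable. -/
abbrev wk {Γ : Ctx} {σ τ : Ty} (t : Tm Γ τ) : Tm (σ :: Γ) τ := t.ren Ren.wk

/-- A closed term, seen in an arbitrary context. -/
def cl {Γ : Ctx} {τ : Ty} (t : Tm [] τ) : Tm Γ τ := t.ren Ren.nil

/-- Application to a tuple of arguments. -/
def appL {Γ : Ctx} {τ : Ty} : {σs : List Ty} → Tm Γ (arrows σs τ) → Sub σs Γ → Tm Γ τ
  | [], f, _ => f
  | _ :: _, f, a => appL (app f (a _ .zero)) (fun _ v => a _ (.succ v))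

/-- Lambda abstraction of the most recent variable, defined from the combinators. -/
def lam {Γ : Ctx} {σ τ : Ty} : Tm (σ :: Γ) τ → Tm Γ (σ ⇒ₜ τ)
  | var .zero => const (.combS σ (σ ⇒ₜ σ) σ) ⊙ const (.combK σ (σ ⇒ₜ σ)) ⊙ const (.combK σ σ)
  | var (.succ v) => const (.combK _ σ) ⊙ var v
  | const c => const (.combK _ σ) ⊙ const c
  | app f a => const (.combS σ _ _) ⊙ lam f ⊙ lam a

/-- The variable bound by the innermost binder. -/
abbrev v0 {Γ : Ctx} {a : Ty} : Tm (a :: Γ) a := var .zero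
/-- The variable bound one binder further out. -/
abbrev v1 {Γ : Ctx} {a b : Ty} : Tm (b :: a :: Γ) a := var (.succ .zero)
/-- The variable bound two binders further out. -/
abbrev v2 {Γ : Ctx} {a b c : Ty} : Tm (c :: b :: a :: Γ) a := var (.succ (.succ .zero))
/-- The variable bound three binders further out. -/
abbrev v3 {Γ : Ctx} {a b c d : Ty} : Tm (d :: c :: b :: a :: Γ) a :=
  var (.succ (.succ (.succ .zero)))

end Tm

/-- Extend a substitution under a binder. -/
def Sub.up {Γ Δ : Ctx} (s : Sub Γ Δ) {σ : Ty} : Sub (σ :: Γ) (σ :: Δ)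
  | _, .zero => .var .zero
  | _, .succ v => (s _ v).wk

/-- Extend a substitution under a block of binders. -/
def Sub.upL {Γ Δ : Ctx} (s : Sub Γ Δ) : (Θ : Ctx) → Sub (Θ ++ Γ) (Θ ++ Δ)
  | [] => s
  | _ :: Θ => (Sub.upL s Θ).up

/-- The substitution that prescribes a term for the first variable. -/
def Sub.cons {Γ Δ : Ctx} {σ : Ty} (t : Tm Δ σ) (s : Sub Γ Δ) : Sub (σ :: Γ) Δ
  | _, .zero => t
  | _, .succ v => s _ v

/-- Two substitutions, put together. -/
def Sub.append {Γ Θ : Ctx} : {Δ : Ctx} → Sub Δ Θ → Sub Γ Θ → Sub (Δ ++ Γ) Θ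
  | [], _, s => s
  | _ :: _, r, s => Sub.cons (r _ .zero) (Sub.append (fun _ v => r _ (.succ v)) s)

/-- The substitution of `t` for the first variable, leaving the others. -/
def Sub.one {Γ : Ctx} {σ : Ty} (t : Tm Γ σ) : Sub (σ :: Γ) Γ := Sub.cons t (fun _ v => .var v)

/-! ### Formulas -/

/-- Formulas in a context. Equality at type `0` is the only relation symbol. -/
inductive Fm : Ctx → Type
  | eq0 {Γ : Ctx} (s t : Tm Γ nat) : Fm Γ
  | bot {Γ : Ctx} : Fm Γ
  | imp {Γ : Ctx} (φ ψ : Fm Γ) : Fm Γ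
  | and {Γ : Ctx} (φ ψ : Fm Γ) : Fm Γ
  | or {Γ : Ctx} (φ ψ : Fm Γ) : Fm Γ
  | all {Γ : Ctx} (τ : Ty) (φ : Fm (τ :: Γ)) : Fm Γ
  | ex {Γ : Ctx} (τ : Ty) (φ : Fm (τ :: Γ)) : Fm Γ

infix:50 " ≐ " => Fm.eq0
infixr:25 " ⟹' " => Fm.imp
infixr:35 " ⋏' " => Fm.and
infixr:30 " ⋎' " => Fm.or

namespace Fm

/-- Negation. -/
abbrev not {Γ : Ctx} (φ : Fm Γ) : Fm Γ := φ ⟹' bot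

/-- Equivalence. -/
abbrev iff {Γ : Ctx} (φ ψ : Fm Γ) : Fm Γ := (φ ⟹' ψ) ⋏' (ψ ⟹' φ)

/-- Apply a renaming to a formula. -/
def ren {Γ Δ : Ctx} (r : Ren Γ Δ) : Fm Γ → Fm Δ
  | eq0 s t => s.ren r ≐ t.ren r
  | bot => bot
  | imp φ ψ => imp (φ.ren r) (ψ.ren r)
  | and φ ψ => and (φ.ren r) (ψ.ren r)
  | or φ ψ => or (φ.ren r) (ψ.ren r)
  | all τ φ => all τ (φ.ren r.up)
  | ex τ φ => ex τ (φ.ren r.up)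

/-- Apply a substitution to a formula. -/
def subst {Γ Δ : Ctx} (s : Sub Γ Δ) : Fm Γ → Fm Δ
  | eq0 t u => t.subst s ≐ u.subst s
  | bot => bot
  | imp φ ψ => imp (φ.subst s) (ψ.subst s)
  | and φ ψ => and (φ.subst s) (ψ.subst s)
  | or φ ψ => or (φ.subst s) (ψ.subst s)
  | all τ φ => all τ (φ.subst s.up)
  | ex τ φ => ex τ (φ.subst s.up)

/-- Weakening by one variable. -/
abbrev wk {Γ : Ctx} {σ : Ty} (φ : Fm Γ) : Fm (σ :: Γ) := φ.ren Ren.wk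

/-- Universal quantification over a block of variables. -/
def allL {Γ : Ctx} : (Δ : Ctx) → Fm (Δ ++ Γ) → Fm Γ
  | [], φ => φ
  | τ :: Δ, φ => allL Δ (all τ φ)

/-- Existential quantification over a block of variables. -/
def exL {Γ : Ctx} : (Δ : Ctx) → Fm (Δ ++ Γ) → Fm Γ
  | [], φ => φ
  | τ :: Δ, φ => exL Δ (ex τ φ)

/-- Quantifier-free formulas. -/
def QF {Γ : Ctx} : Fm Γ → Prop
  | eq0 _ _ => True
  | bot => True
  | imp φ ψ => φ.QF ∧ ψ.QF
  | and φ ψ => φ.QF ∧ ψ.QF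
  | or φ ψ => φ.QF ∧ ψ.QF
  | all _ _ => False
  | ex _ _ => False

/-- Existential formulas (a block of existential quantifiers in front of a quantifier-free
formula) all of whose quantifiers have admissible types. -/
inductive ExAdmissible : {Γ : Ctx} → Fm Γ → Prop
  | qf {Γ : Ctx} {φ : Fm Γ} (h : φ.QF) : ExAdmissible φ
  | ex {Γ : Ctx} {τ : Ty} {φ : Fm (τ :: Γ)} (hτ : τ.Admissible) (h : ExAdmissible φ) :
      ExAdmissible (Fm.ex τ φ)

/-- The De Morgan dual. -/
def dual {Γ : Ctx} : Fm Γ → Fm Γ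
  | eq0 s t => not (s ≐ t)
  | bot => not bot
  | imp φ ψ => and φ ψ.dual
  | and φ ψ => or φ.dual ψ.dual
  | or φ ψ => and φ.dual ψ.dual
  | all τ φ => ex τ φ.dual
  | ex τ φ => all τ φ.dual

end Fm

open Tm Fm

/-! ### Arithmetic on natural numbers, as terms -/

/-- The numeral `0`. -/
abbrev zero {Γ : Ctx} : Tm Γ nat := const .zero

/-- Successor. -/
abbrev suc {Γ : Ctx} (t : Tm Γ nat) : Tm Γ nat := const .succ ⊙ t

/-- Recursion for a single type: `recT 0 b f = b` and `recT (n + 1) b f = f (recT n b f) n`. -/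
abbrev recT {Γ : Ctx} {ρ : Ty} (n : Tm Γ nat) (b : Tm Γ ρ) (f : Tm Γ (ρ ⇒ₜ nat ⇒ₜ ρ)) : Tm Γ ρ :=
  const (.recur [ρ] ρ .zero) ⊙ n ⊙ b ⊙ f

/-- Addition. -/
def addC : Tm [] (nat ⇒ₜ nat ⇒ₜ nat) := lam (lam (recT v0 v1 (lam (lam (suc v1)))))
/-- Addition of terms. -/
abbrev add {Γ : Ctx} (s t : Tm Γ nat) : Tm Γ nat := cl addC ⊙ s ⊙ t

/-- Predecessor. -/
def predC : Tm [] (nat ⇒ₜ nat) := lam (recT v0 zero (lam (lam v0)))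

/-- Cut-off subtraction. -/
def subC : Tm [] (nat ⇒ₜ nat ⇒ₜ nat) := lam (lam (recT v0 v1 (lam (lam (cl predC ⊙ v1)))))
/-- Cut-off subtraction of terms. -/
abbrev sub {Γ : Ctx} (s t : Tm Γ nat) : Tm Γ nat := cl subC ⊙ s ⊙ t

/-- Multiplication. -/
def mulC : Tm [] (nat ⇒ₜ nat ⇒ₜ nat) := lam (lam (recT v0 zero (lam (lam (add v1 v3)))))
/-- Multiplication of terms. -/
abbrev mul {Γ : Ctx} (s t : Tm Γ nat) : Tm Γ nat := cl mulC ⊙ s ⊙ t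

/-- Case distinction: `cond c a b` is `a` if `c = 0` and `b` otherwise. -/
abbrev cond {Γ : Ctx} (c a b : Tm Γ nat) : Tm Γ nat := recT c a (lam (lam b.wk.wk))

/-- The formula `s ≤ t` at type `0`. -/
abbrev le0 {Γ : Ctx} (s t : Tm Γ nat) : Fm Γ := sub s t ≐ zero

/-- The remainder modulo `2`. -/
def parC : Tm [] (nat ⇒ₜ nat) := lam (recT v0 zero (lam (lam (sub (suc zero) v1))))

/-- Half, rounded down. -/
def halfC : Tm [] (nat ⇒ₜ nat) := lam (recT v0 zero (lam (lam (add v1 (cl parC ⊙ v0)))))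

/-- `2 ^ k`. -/
def powC : Tm [] (nat ⇒ₜ nat) := lam (recT v0 (suc zero) (lam (lam (add v1 v1))))

/-- The triangular number `0 + 1 + … + n`. -/
def triC : Tm [] (nat ⇒ₜ nat) := lam (recT v0 zero (lam (lam (add v1 (suc v0)))))

/-- The Cantor pairing `j(x, y) = (x + y)(x + y + 1) / 2 + x`. -/
def pairC : Tm [] (nat ⇒ₜ nat ⇒ₜ nat) := lam (lam (add (cl triC ⊙ add v1 v0) v1))
/-- Pairing of terms. -/
abbrev pair {Γ : Ctx} (s t : Tm Γ nat) : Tm Γ nat := cl pairC ⊙ s ⊙ t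

/-- The largest `s` whose triangular number is at most `z`. -/
def rootC : Tm [] (nat ⇒ₜ nat) :=
  lam (recT v0 zero (lam (lam (cond (sub (cl triC ⊙ suc v1) (suc v0)) (suc v1) v1))))

/-- The first projection of the Cantor pairing. -/
def fstC : Tm [] (nat ⇒ₜ nat) := lam (sub v0 (cl triC ⊙ (cl rootC ⊙ v0)))
/-- The second projection of the Cantor pairing. -/
def sndC : Tm [] (nat ⇒ₜ nat) := lam (sub (cl rootC ⊙ v0) (cl fstC ⊙ v0))

/-! ### Rational numbers

The natural number `j(n, m)` codes the rational `(n / 2) / (m + 1)` if `n` is even and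
`-((n + 1) / 2) / (m + 1)` if `n` is odd. -/

/-- The numerator, if it is positive, and `0` otherwise. -/
def posC : Tm [] (nat ⇒ₜ nat) :=
  lam (mul (cl halfC ⊙ (cl fstC ⊙ v0)) (sub (suc zero) (cl parC ⊙ (cl fstC ⊙ v0))))
/-- The absolute value of the numerator, if the latter is negative, and `0` otherwise. -/
def negC : Tm [] (nat ⇒ₜ nat) :=
  lam (mul (cl halfC ⊙ suc (cl fstC ⊙ v0)) (cl parC ⊙ (cl fstC ⊙ v0)))
/-- The denominator. -/
def denC : Tm [] (nat ⇒ₜ nat) := lam (suc (cl sndC ⊙ v0))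

/-- Positive part of the numerator of a coded rational. -/
abbrev qpos {Γ : Ctx} (a : Tm Γ nat) : Tm Γ nat := cl posC ⊙ a
/-- Negative part of the numerator of a coded rational. -/
abbrev qneg {Γ : Ctx} (a : Tm Γ nat) : Tm Γ nat := cl negC ⊙ a
/-- Denominator of a coded rational. -/
abbrev qden {Γ : Ctx} (a : Tm Γ nat) : Tm Γ nat := cl denC ⊙ a

/-- The code of `(p - m) / d`, for arguments `p`, `m` and `d > 0`. -/
def mkQC : Tm [] (nat ⇒ₜ nat ⇒ₜ nat ⇒ₜ nat) :=
  lam (lam (lam (pair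
    (add (mul (suc (suc zero)) (sub v2 v1)) (cl predC ⊙ mul (suc (suc zero)) (sub v1 v2)))
    (cl predC ⊙ v0))))
/-- The code of `(p - m) / d`. -/
abbrev mkQ {Γ : Ctx} (p m d : Tm Γ nat) : Tm Γ nat := cl mkQC ⊙ p ⊙ m ⊙ d

/-- Addition of rationals. -/
def qaddC : Tm [] (nat ⇒ₜ nat ⇒ₜ nat) :=
  lam (lam (mkQ
    (add (mul (qpos v1) (qden v0)) (mul (qpos v0) (qden v1)))
    (add (mul (qneg v1) (qden v0)) (mul (qneg v0) (qden v1)))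
    (mul (qden v1) (qden v0))))
/-- Addition of rationals. -/
abbrev qadd {Γ : Ctx} (a b : Tm Γ nat) : Tm Γ nat := cl qaddC ⊙ a ⊙ b

/-- Subtraction of rationals. -/
def qsubC : Tm [] (nat ⇒ₜ nat ⇒ₜ nat) :=
  lam (lam (qadd v1 (mkQ (qneg v0) (qpos v0) (qden v0))))
/-- Subtraction of rationals. -/
abbrev qsub {Γ : Ctx} (a b : Tm Γ nat) : Tm Γ nat := cl qsubC ⊙ a ⊙ b

/-- Absolute value of rationals. -/
def qabsC : Tm [] (nat ⇒ₜ nat) := lam (mkQ (add (qpos v0) (qneg v0)) zero (qden v0))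
/-- Absolute value of rationals. -/
abbrev qabs {Γ : Ctx} (a : Tm Γ nat) : Tm Γ nat := cl qabsC ⊙ a

/-- The order of rationals: the value is `0` if and only if `a ≤ b`. -/
def qleC : Tm [] (nat ⇒ₜ nat ⇒ₜ nat) :=
  lam (lam (sub
    (add (mul (qpos v1) (qden v0)) (mul (qneg v0) (qden v1)))
    (add (mul (qpos v0) (qden v1)) (mul (qneg v1) (qden v0)))))

/-- The strict order of rationals: the value is `0` if and only if `a < b`. -/
def qltC : Tm [] (nat ⇒ₜ nat ⇒ₜ nat) := lam (lam (sub (suc zero) (cl qleC ⊙ v0 ⊙ v1)))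

/-- The formula `a ≤ b` for coded rationals. -/
abbrev leQ {Γ : Ctx} (a b : Tm Γ nat) : Fm Γ := cl qleC ⊙ a ⊙ b ≐ zero
/-- The formula `a < b` for coded rationals. -/
abbrev ltQ {Γ : Ctx} (a b : Tm Γ nat) : Fm Γ := cl qltC ⊙ a ⊙ b ≐ zero

/-- The rational `2 ^ (-k)`. -/
def qpowC : Tm [] (nat ⇒ₜ nat) := lam (mkQ (suc zero) zero (cl powC ⊙ v0))
/-- The rational `2 ^ (-k)`. -/
abbrev qpow {Γ : Ctx} (k : Tm Γ nat) : Tm Γ nat := cl qpowC ⊙ k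

/-! ### Real numbers

Real numbers are represented by sequences of coded rationals with Cauchy modulus `2 ^ (-n)`.
Every object `f` of type `1` represents a real number, through the sequence `hat f`. -/

/-- The index `n` if `|f(k) - f(k+1)| < 2 ^ (-k-1)` for all `k < n`, and the least `k < n` for
which this fails otherwise. -/
def hatIdxC : Tm [] (real ⇒ₜ nat ⇒ₜ nat) :=
  lam (lam (recT v0 zero (lam (lam
    (cond (add (sub v0 v1) (cl qltC ⊙ qabs (qsub (v3 ⊙ v0) (v3 ⊙ suc v0)) ⊙ qpow (suc v0)))
      (suc v0) v1)))))

/-- The regularization of a sequence of rationals: the sequence is frozen at the first index at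
which the condition on consecutive terms fails. -/
def hatC : Tm [] (real ⇒ₜ real) := lam (lam (v1 ⊙ (cl hatIdxC ⊙ v1 ⊙ v0)))
/-- The `n`-th rational approximation of the real represented by `f`. -/
abbrev hat {Γ : Ctx} (f : Tm Γ real) (n : Tm Γ nat) : Tm Γ nat := cl hatC ⊙ f ⊙ n

/-- `f < g` for reals: some `n` has `g(n+1) - f(n+1) ≥ 2 ^ (-n)`. -/
def ltR {Γ : Ctx} (f g : Tm Γ real) : Fm Γ :=
  ex nat (leQ (qpow v0) (qsub (hat g.wk (suc v0)) (hat f.wk (suc v0))))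
/-- `f ≤ g` for reals. -/
def leR {Γ : Ctx} (f g : Tm Γ real) : Fm Γ := not (ltR g f)
/-- `f = g` for reals: all `n` have `|f(n+1) - g(n+1)| < 2 ^ (-n)`. -/
def eqR {Γ : Ctx} (f g : Tm Γ real) : Fm Γ :=
  all nat (ltQ (qabs (qsub (hat f.wk (suc v0)) (hat g.wk (suc v0)))) (qpow v0))

/-- Addition of reals. -/
def raddC : Tm [] (real ⇒ₜ real ⇒ₜ real) :=
  lam (lam (lam (qadd (hat v2 (suc v0)) (hat v1 (suc v0)))))
/-- Addition of reals. -/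
abbrev radd {Γ : Ctx} (f g : Tm Γ real) : Tm Γ real := cl raddC ⊙ f ⊙ g

/-- Subtraction of reals. -/
def rsubC : Tm [] (real ⇒ₜ real ⇒ₜ real) :=
  lam (lam (lam (qsub (hat v2 (suc v0)) (hat v1 (suc v0)))))
/-- Subtraction of reals. -/
abbrev rsub {Γ : Ctx} (f g : Tm Γ real) : Tm Γ real := cl rsubC ⊙ f ⊙ g

/-- The real `0`. -/
def rzeroC : Tm [] real := lam (mkQ zero zero (suc zero))
/-- The real `1`. -/
def roneC : Tm [] real := lam (mkQ (suc zero) zero (suc zero))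
/-- The real `2 ^ (-k)`. -/
def rpowC : Tm [] (nat ⇒ₜ real) := lam (lam (qpow v1))

/-- The finite sum `f(0) + … + f(l)` of reals. -/
def rsumC : Tm [] ((nat ⇒ₜ real) ⇒ₜ nat ⇒ₜ real) :=
  lam (lam (recT v0 (v1 ⊙ zero) (lam (lam (radd v1 (v3 ⊙ suc v0))))))

/-! ### Events -/

/-- The formula `x ∈ A`. -/
abbrev memF {Γ : Ctx} (x : Tm Γ sample) (A : Tm Γ event) : Fm Γ := const .mem ⊙ x ⊙ A ≐ zero
/-- Union of events. -/
abbrev cup {Γ : Ctx} (A B : Tm Γ event) : Tm Γ event := const .union ⊙ A ⊙ B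
/-- Complement of an event. -/
abbrev cpl {Γ : Ctx} (A : Tm Γ event) : Tm Γ event := const .compl ⊙ A
/-- Intersection of events. -/
abbrev cap {Γ : Ctx} (A B : Tm Γ event) : Tm Γ event := cpl (cup (cpl A) (cpl B))
/-- The sure event. -/
abbrev sure {Γ : Ctx} : Tm Γ event := cpl (const .empty)
/-- The content of an event. -/
abbrev pr {Γ : Ctx} (A : Tm Γ event) : Tm Γ real := const .prob ⊙ A
/-- Inclusion of events. -/
def subS {Γ : Ctx} (A B : Tm Γ event) : Fm Γ :=
  all sample (memF v0 A.wk ⟹' memF v0 B.wk)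

/-- The finite union `A(0) ∪ … ∪ A(n)`. -/
def cupLC : Tm [] ((nat ⇒ₜ event) ⇒ₜ nat ⇒ₜ event) :=
  lam (lam (recT v0 (v1 ⊙ zero) (lam (lam (cup v1 (v3 ⊙ suc v0))))))

/-- The disjointification of a sequence of events: `A(0)` at `0`, and
`A(n+1) ∩ (A(0) ∪ … ∪ A(n))ᶜ` at `n + 1`. -/
def disjC : Tm [] ((nat ⇒ₜ event) ⇒ₜ nat ⇒ₜ event) :=
  lam (lam (recT v0 (v1 ⊙ zero) (lam (lam (cap (v3 ⊙ suc v0) (cpl (cupLC.cl ⊙ v3 ⊙ v0)))))))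

/-! ### The system -/

/-- Equality at an arbitrary type. -/
def eqF {Γ : Ctx} : (τ : Ty) → Tm Γ τ → Tm Γ τ → Fm Γ
  | .nat, s, t => s ≐ t
  | .sample, s, t => const .eqΩ ⊙ s ⊙ t ≐ zero
  | .event, s, t => all sample (iff (memF v0 s.wk) (memF v0 t.wk))
  | .arr σ τ, s, t => all σ (eqF τ (s.wk ⊙ v0) (t.wk ⊙ v0))

/-- Component `i` of the simultaneous recursion with initial values `y` and steps `z`, at `n`. -/
abbrev recL {Γ : Ctx} {ρs : List Ty} (n : Tm Γ nat) (y : Sub ρs Γ) (z : Sub (ρs.map (step ρs)) Γ) :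
    Sub ρs Γ :=
  fun ρ i => appL (appL (const (.recur ρs ρ i) ⊙ n) y) z

/-- The substitution used in the axiom of choice for tuples `xs`, `ys`: every variable `y` of the
tuple `ys` becomes `Y xs`, where `Y` is the corresponding choice functional. -/
def choiceSub (Γ xs ys : Ctx) : Sub (ys ++ (xs ++ Γ)) (xs ++ (ys.map (arrows xs) ++ Γ)) :=
  Sub.append
    (fun _ y => appL (var (.inr xs (.inl (y.map (arrows xs))))) (fun _ x => var (.inl x)))
    (Sub.append (fun _ x => var (.inl x)) (fun _ v => var (.inr xs (.inr _ v))))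

/-- The substitution used in the axiom of dependent choice for a tuple `ρs`: with `n` the number
variable and `f` the sequences, the variables of the first copy of `ρs` become `f (n + 1)`, those
of the second copy become `f n`. -/
def depSub (Γ ρs : Ctx) : Sub (ρs ++ (ρs ++ nat :: Γ)) (nat :: (ρs.map (nat ⇒ₜ ·) ++ Γ)) :=
  Sub.append (fun _ i => var (.succ (.inl (i.map (nat ⇒ₜ ·)))) ⊙ suc v0)
    (Sub.append (fun _ i => var (.succ (.inl (i.map (nat ⇒ₜ ·)))) ⊙ v0)
      (Sub.cons v0 (fun _ v => var (.succ (.inr _ v)))))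

/-- The axioms (other than those of predicate logic) of the system of classical arithmetic in all
finite types for a probability content. -/
inductive Axm : {Γ : Ctx} → Fm Γ → Prop
  -- equality at type `0` and successor
  | eq_refl {Γ : Ctx} (s : Tm Γ nat) : Axm (s ≐ s)
  | eq_symm {Γ : Ctx} (s t : Tm Γ nat) : Axm (s ≐ t ⟹' t ≐ s)
  | eq_trans {Γ : Ctx} (s t u : Tm Γ nat) : Axm (s ≐ t ⋏' t ≐ u ⟹' s ≐ u)
  | succ_congr {Γ : Ctx} (s t : Tm Γ nat) : Axm (s ≐ t ⟹' suc s ≐ suc t)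
  | succ_ne {Γ : Ctx} (s : Tm Γ nat) : Axm (not (suc s ≐ zero))
  | succ_inj {Γ : Ctx} (s t : Tm Γ nat) : Axm (suc s ≐ suc t ⟹' s ≐ t)
  -- induction
  | induction {Γ : Ctx} (φ : Fm (nat :: Γ)) :
      Axm (φ.subst (Sub.one zero) ⋏'
        all nat (φ ⟹' φ.subst (Sub.cons (suc v0) (fun _ v => var (.succ v)))) ⟹' all nat φ)
  -- combinators and recursors
  | combK {Γ : Ctx} {ρ τ : Ty} (x : Tm Γ ρ) (y : Tm Γ τ) :
      Axm (eqF ρ (const (.combK ρ τ) ⊙ x ⊙ y) x)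
  | combS {Γ : Ctx} {δ ρ τ : Ty} (x : Tm Γ (δ ⇒ₜ ρ ⇒ₜ τ)) (y : Tm Γ (δ ⇒ₜ ρ)) (z : Tm Γ δ) :
      Axm (eqF τ (const (.combS δ ρ τ) ⊙ x ⊙ y ⊙ z) (x ⊙ z ⊙ (y ⊙ z)))
  | recur_zero {Γ : Ctx} {ρs : List Ty} {ρ : Ty} (i : Var ρs ρ)
      (y : Sub ρs Γ) (z : Sub (ρs.map (step ρs)) Γ) :
      Axm (eqF ρ (recL zero y z ρ i) (y ρ i))
  | recur_succ {Γ : Ctx} {ρs : List Ty} {ρ : Ty} (i : Var ρs ρ) (n : Tm Γ nat)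
      (y : Sub ρs Γ) (z : Sub (ρs.map (step ρs)) Γ) :
      Axm (eqF ρ (recL (suc n) y z ρ i) (appL (z _ (i.map (step ρs))) (recL n y z) ⊙ n))
  -- quantifier-free choice and dependent choice, for tuples of variables
  | qfac {Γ : Ctx} (xs ys : List Ty) (φ : Fm (ys ++ (xs ++ Γ))) (h : φ.QF) :
      Axm (allL xs (exL ys φ) ⟹'
        exL (ys.map (arrows xs)) (allL xs (φ.subst (choiceSub Γ xs ys))))
  | dc {Γ : Ctx} (ρs : List Ty) (φ : Fm (ρs ++ (ρs ++ nat :: Γ))) :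
      Axm (all nat (allL ρs (exL ρs φ)) ⟹'
        exL (ρs.map (nat ⇒ₜ ·)) (all nat (φ.subst (depSub Γ ρs))))
  -- equality on the sample space is an equivalence relation
  | eqΩ_refl {Γ : Ctx} (x : Tm Γ sample) : Axm (eqF sample x x)
  | eqΩ_symm {Γ : Ctx} (x y : Tm Γ sample) : Axm (eqF sample x y ⟹' eqF sample y x)
  | eqΩ_trans {Γ : Ctx} (x y z : Tm Γ sample) :
      Axm (eqF sample x y ⋏' eqF sample y z ⟹' eqF sample x z)
  -- the events form an algebra of sets
  | mem_empty {Γ : Ctx} (x : Tm Γ sample) : Axm (not (memF x (const .empty)))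
  | mem_compl {Γ : Ctx} (x : Tm Γ sample) (A : Tm Γ event) :
      Axm (iff (memF x (cpl A)) (not (memF x A)))
  | mem_union {Γ : Ctx} (x : Tm Γ sample) (A B : Tm Γ event) :
      Axm (iff (memF x (cup A B)) (memF x A ⋎' memF x B))
  -- a probability content on this algebra
  | prob_range {Γ : Ctx} (A : Tm Γ event) : Axm (leR (cl rzeroC) (pr A) ⋏' leR (pr A) (cl roneC))
  | prob_empty {Γ : Ctx} : Axm (Γ := Γ) (eqR (pr (const .empty)) (cl rzeroC))
  | prob_sure {Γ : Ctx} : Axm (Γ := Γ) (eqR (pr sure) (cl roneC))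
  | prob_mono {Γ : Ctx} (A B : Tm Γ event) : Axm (subS A B ⟹' leR (pr A) (pr B))
  | prob_union {Γ : Ctx} (A B : Tm Γ event) :
      Axm (eqR (pr (cup A B)) (rsub (radd (pr A) (pr B)) (pr (cap A B))))

/-- Additional axioms: a set of formulas in every context. -/
abbrev Schema : Type := (Γ : Ctx) → Set (Fm Γ)

/-- Derivability of a formula from a list of hypotheses in the system extended by the axioms `T`:
natural deduction for classical many-sorted predicate logic, the axioms, and the quantifier-free
rule of extensionality. The latter has no open hypotheses in its premise. -/
inductive Prf (T : Schema) : {Γ : Ctx} → List (Fm Γ) → Fm Γ → Prop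
  | hyp {Γ : Ctx} {H : List (Fm Γ)} {φ : Fm Γ} (h : φ ∈ H) : Prf T H φ
  | ax {Γ : Ctx} {H : List (Fm Γ)} {φ : Fm Γ} (h : Axm φ) : Prf T H φ
  | extra {Γ : Ctx} {H : List (Fm Γ)} {φ : Fm Γ} (h : φ ∈ T Γ) : Prf T H φ
  | imp_intro {Γ : Ctx} {H : List (Fm Γ)} {φ ψ : Fm Γ} (h : Prf T (φ :: H) ψ) : Prf T H (φ ⟹' ψ)
  | imp_elim {Γ : Ctx} {H : List (Fm Γ)} {φ ψ : Fm Γ} (h : Prf T H (φ ⟹' ψ)) (h' : Prf T H φ) :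
      Prf T H ψ
  | and_intro {Γ : Ctx} {H : List (Fm Γ)} {φ ψ : Fm Γ} (h : Prf T H φ) (h' : Prf T H ψ) :
      Prf T H (φ ⋏' ψ)
  | and_left {Γ : Ctx} {H : List (Fm Γ)} {φ ψ : Fm Γ} (h : Prf T H (φ ⋏' ψ)) : Prf T H φ
  | and_right {Γ : Ctx} {H : List (Fm Γ)} {φ ψ : Fm Γ} (h : Prf T H (φ ⋏' ψ)) : Prf T H ψ
  | or_left {Γ : Ctx} {H : List (Fm Γ)} {φ ψ : Fm Γ} (h : Prf T H φ) : Prf T H (φ ⋎' ψ)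
  | or_right {Γ : Ctx} {H : List (Fm Γ)} {φ ψ : Fm Γ} (h : Prf T H ψ) : Prf T H (φ ⋎' ψ)
  | or_elim {Γ : Ctx} {H : List (Fm Γ)} {φ ψ χ : Fm Γ} (h : Prf T H (φ ⋎' ψ))
      (h₁ : Prf T (φ :: H) χ) (h₂ : Prf T (ψ :: H) χ) : Prf T H χ
  | by_contra {Γ : Ctx} {H : List (Fm Γ)} {φ : Fm Γ} (h : Prf T (not φ :: H) bot) : Prf T H φ
  | all_intro {Γ : Ctx} {H : List (Fm Γ)} {τ : Ty} {φ : Fm (τ :: Γ)}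
      (h : Prf T (H.map Fm.wk) φ) : Prf T H (all τ φ)
  | all_elim {Γ : Ctx} {H : List (Fm Γ)} {τ : Ty} {φ : Fm (τ :: Γ)} (h : Prf T H (all τ φ))
      (t : Tm Γ τ) : Prf T H (φ.subst (Sub.one t))
  | ex_intro {Γ : Ctx} {H : List (Fm Γ)} {τ : Ty} {φ : Fm (τ :: Γ)} (t : Tm Γ τ)
      (h : Prf T H (φ.subst (Sub.one t))) : Prf T H (ex τ φ)
  | ex_elim {Γ : Ctx} {H : List (Fm Γ)} {τ : Ty} {φ : Fm (τ :: Γ)} {χ : Fm Γ}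
      (h : Prf T H (ex τ φ)) (h' : Prf T (φ :: H.map Fm.wk) χ.wk) : Prf T H χ
  | qfer {Γ : Ctx} {H : List (Fm Γ)} {ρ τ : Ty} {φ : Fm Γ} (hφ : φ.QF) {s t : Tm Γ ρ}
      (r : Tm (ρ :: Γ) τ) (h : Prf T [] (φ ⟹' eqF ρ s t)) :
      Prf T H (φ ⟹' eqF τ (r.subst (Sub.one s)) (r.subst (Sub.one t)))

/-- The system extended by the axioms `T` proves the sentence `φ`. -/
def Proves (T : Schema) (φ : Fm []) : Prop := Prf T [] φ

/-! ### Uniform boundedness -/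

/-- The pointwise minimum `min_α`, for the type `α = 0(σₖ)…(σ₁)`. -/
def minC : (σs : List Ty) → Tm [] (arrows σs nat ⇒ₜ arrows σs nat ⇒ₜ arrows σs nat)
  | [] => lam (lam (sub (Γ := [nat, nat]) v1 (sub v1 v0)))
  | σ :: σs =>
      lam (lam (lam (Γ := [σ ⇒ₜ arrows σs nat, σ ⇒ₜ arrows σs nat])
        (cl (minC σs) ⊙ (v2 ⊙ v0) ⊙ (v1 ⊙ v0))))

/-- The substitution that replaces `x` by `min_α (x, y k)` and leaves the other variables; the
variables `x`, `k`, `y` are the first three ones. -/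
def minSub (Γ : Ctx) (σs : List Ty) :
    Sub (arrows σs nat :: nat :: (nat ⇒ₜ arrows σs nat) :: Γ)
      (arrows σs nat :: nat :: (nat ⇒ₜ arrows σs nat) :: Γ) :=
  Sub.cons (cl (minC σs) ⊙ v0 ⊙ (v2 ⊙ v1)) (fun _ v => var (.succ v))

/-- The instance of uniform boundedness for `α = 0(σₖ)…(σ₁)`, the types `βs` and the formula
`φ(y, k, x, z, w)`, which may have further parameters `Γ`:
`∀ y (∀ k, x, z ∃ w φ(y, k, min_α(x, y k), z, w) →
  ∃ χ ∀ k, x, z ∃ w ≤ χ k φ(y, k, min_α(x, y k), z, w))`. -/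
def ubFormula (Γ : Ctx) (σs βs : List Ty)
    (φ : Fm (nat :: (βs ++ arrows σs nat :: nat :: (nat ⇒ₜ arrows σs nat) :: Γ))) : Fm Γ :=
  let ψ := φ.subst ((minSub Γ σs).upL βs).up
  all (nat ⇒ₜ arrows σs nat)
    (all nat (all (arrows σs nat) (allL βs (ex nat ψ))) ⟹'
      ex (nat ⇒ₜ nat) (all nat (all (arrows σs nat) (allL βs (ex nat
        (le0 v0
            (var (.succ (.inr βs (.succ (.succ .zero)))) ⊙ var (.succ (.inr βs (.succ .zero)))) ⋏'
          ψ.ren (Ren.upL Ren.wk.up.up βs).up))))))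

/-- The uniform boundedness principle for the sample space, with bounds of type `0`. -/
inductive UBOmegaZero (Γ : Ctx) : Fm Γ → Prop
  | inst (σs βs : List Ty) (hβ : ∀ β ∈ βs, β.EndsInSample)
      (φ : Fm (nat :: (βs ++ arrows σs nat :: nat :: (nat ⇒ₜ arrows σs nat) :: Γ)))
      (hφ : φ.ExAdmissible) : UBOmegaZero Γ (ubFormula Γ σs βs φ)

/-- The axioms of uniform boundedness, as an extension of the system. -/
def UBΩ₀ : Schema := fun Γ => {φ | UBOmegaZero Γ φ}

/-! ### Probabilities of formulas and sigma-additivity -/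

/-- `ℙ[φ] ≥ t`: for all events `A` with `ℙ(A) < t` some `ϖ ∈ Aᶜ` satisfies `φ`. -/
def probGE {Γ : Ctx} (φ : Fm (sample :: Γ)) (t : Tm Γ real) : Fm Γ :=
  all event (ltR (pr v0) t.wk ⟹' ex sample (memF v0 (cpl v1) ⋏' φ.ren Ren.wk.up))

/-- `ℙ[φ] ≤ t`: the De Morgan dual of `φ` has probability at least `1 - t`. -/
def probLE {Γ : Ctx} (φ : Fm (sample :: Γ)) (t : Tm Γ real) : Fm Γ :=
  probGE φ.dual (rsub (cl roneC) t)

/-- The formula `∃ n (ϖ ∈ A n)`, with free variable `ϖ` in addition to those of `A`. -/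
def inUnion {Γ : Ctx} (A : Tm Γ (nat ⇒ₜ event)) : Fm (sample :: Γ) :=
  ex nat (memF v1 (A.wk.wk ⊙ v0))

/-- The term `∑_{n ≤ l} ℙ((A↑)_n)`. -/
def partialSum {Γ : Ctx} (A : Tm Γ (nat ⇒ₜ event)) (l : Tm Γ nat) : Tm Γ real :=
  cl rsumC ⊙ lam (pr (cl disjC ⊙ A.wk ⊙ v0)) ⊙ l

/-- Sigma-additivity: `∀ A ∀ l (ℙ[∃ n A_n] ≥ ∑_{n ≤ l} ℙ((A↑)_n))` and
`∀ A ∀ k ∃ l (ℙ[∃ n A_n] ≤ ∑_{n ≤ l} ℙ((A↑)_n) + 2 ^ (-k))`. -/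
def sigmaAdditivity : Fm [] :=
  all (nat ⇒ₜ event) (all nat (probGE (inUnion v1) (partialSum v1 v0))) ⋏'
    all (nat ⇒ₜ event) (all nat (ex nat
      (probLE (inUnion v2) (radd (partialSum v2 v0) (cl rpowC ⊙ v1)))))

end ProbContent

/-!
By completeness it is enough to prove the sentence in an arbitrary, possibly nonstandard, model of
the system. Sequences of objects of a model, taken modulo null sequences, make its real numbers
elements of an ordered group, in which the axioms for `ℙ` become the laws of a finitely additive
content and `∑_{n ≤ l} ℙ((A↑)_n)` becomes the content of `A_0 ∪ … ∪ A_l`.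

If this is larger than `ℙ(B)`, then `B` does not contain `A_0 ∪ … ∪ A_l`, which gives the first
conjunct. For the second one, the contents of the finite unions increase and are bounded by `1`, so
some `l` has the property that all later unions exceed `ℙ(A_0 ∪ … ∪ A_l)` by at most `2^{-k}`. If
`B` and the `A_n` together cover the sample space, then uniform boundedness, applied to the sample
points, gives an `N` such that `B` and `A_0, …, A_N` already cover it, whence
`1 ≤ ℙ(B) + ℙ(A_0 ∪ … ∪ A_l) + 2^{-k}`.
-/

namespace ProbContent

open Ty Tm Fm

/-! ### Renaming and substitution -/

section Substitution

variable {Γ Δ Θ : Ctx} {σ τ : Ty}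

theorem Sub.up_ren (r : Ren Γ Δ) (s : Sub Δ Θ) :
    (fun τ v => s.up τ (r.up τ v)) = Sub.up (σ := σ) (fun τ v => s τ (r τ v)) := by
  funext τ v; cases v <;> rfl

theorem Sub.up_var : Sub.up (σ := σ) (fun _ (v : Var Γ _) => var v) = fun _ v => var v := by
  funext τ v; cases v <;> rfl

theorem Tm.ren_ren (r : Ren Γ Δ) (q : Ren Δ Θ) (t : Tm Γ τ) :
    (t.ren r).ren q = t.ren (fun τ v => q τ (r τ v)) := by
  induction t with
  | var v => rfl
  | const c => rfl
  | app f a hf ha => simp only [Tm.ren, hf, ha]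

theorem Tm.subst_ren (r : Ren Γ Δ) (s : Sub Δ Θ) (t : Tm Γ τ) :
    (t.ren r).subst s = t.subst (fun τ v => s τ (r τ v)) := by
  induction t with
  | var v => rfl
  | const c => rfl
  | app f a hf ha => simp only [Tm.ren, Tm.subst, hf, ha]

theorem Tm.ren_subst (s : Sub Γ Δ) (r : Ren Δ Θ) (t : Tm Γ τ) :
    (t.subst s).ren r = t.subst (fun τ v => (s τ v).ren r) := by
  induction t with
  | var v => rfl
  | const c => rfl
  | app f a hf ha => simp only [Tm.ren, Tm.subst, hf, ha]

theorem Tm.subst_subst (s : Sub Γ Δ) (q : Sub Δ Θ) (t : Tm Γ τ) :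
    (t.subst s).subst q = t.subst (fun τ v => (s τ v).subst q) := by
  induction t with
  | var v => rfl
  | const c => rfl
  | app f a hf ha => simp only [Tm.subst, hf, ha]

theorem Tm.subst_var (t : Tm Γ τ) : t.subst (fun _ v => var v) = t := by
  induction t with
  | var v => rfl
  | const c => rfl
  | app f a hf ha => simp only [Tm.subst, hf, ha]

theorem Tm.ren_eq_subst (r : Ren Γ Δ) (t : Tm Γ τ) :
    t.ren r = t.subst (fun τ v => var (r τ v)) := by
  induction t with
  | var v => rfl
  | const c => rfl
  | app f a hf ha => simp only [Tm.ren, Tm.subst, hf, ha]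

theorem Sub.one_zero (t : Tm Γ σ) : Sub.one t σ .zero = t := rfl

theorem Tm.subst_one_wk (t : Tm Γ τ) (a : Tm Γ σ) : t.wk.subst (Sub.one a) = t := by
  rw [Tm.wk, Tm.subst_ren]; exact t.subst_var

theorem Tm.wk_subst_up (s : Sub Γ Δ) (t : Tm Γ τ) :
    t.wk.subst (s.up (σ := σ)) = (t.subst s).wk := by
  rw [Tm.wk, Tm.wk, Tm.subst_ren, Tm.ren_subst]; rfl

theorem Tm.wk_ren_up (r : Ren Γ Δ) (t : Tm Γ τ) : t.wk.ren (r.up (σ := σ)) = (t.ren r).wk := by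
  rw [Tm.wk, Tm.wk, Tm.ren_ren, Tm.ren_ren]; rfl

theorem Tm.subst_cl (s : Sub Γ Δ) (t : Tm [] τ) : t.cl.subst s = t.cl := by
  rw [Tm.cl, Tm.cl, Tm.subst_ren, Tm.ren_eq_subst]; congr; funext τ v; cases v

theorem Sub.up_comp (s : Sub Γ Δ) (q : Sub Δ Θ) :
    (fun τ v => (s.up τ v).subst q.up) = Sub.up (σ := σ) (fun τ v => (s τ v).subst q) := by
  funext τ v
  cases v with
  | zero => rfl
  | succ v => exact Tm.wk_subst_up q (s _ v)

theorem Sub.up_comp_ren (s : Sub Γ Δ) (r : Ren Δ Θ) :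
    (fun τ v => (s.up τ v).ren r.up) = Sub.up (σ := σ) (fun τ v => (s τ v).ren r) := by
  funext τ v
  cases v with
  | zero => rfl
  | succ v => exact Tm.wk_ren_up r (s _ v)

theorem Fm.subst_ren (φ : Fm Γ) (r : Ren Γ Δ) (s : Sub Δ Θ) :
    (φ.ren r).subst s = φ.subst (fun τ v => s τ (r τ v)) := by
  induction φ generalizing Δ Θ with
  | eq0 => simp only [Fm.ren, Fm.subst, Tm.subst_ren]
  | bot => rfl
  | imp _ _ h h' | and _ _ h h' | or _ _ h h' => simp only [Fm.ren, Fm.subst, h, h']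
  | all _ _ h | ex _ _ h => simp only [Fm.ren, Fm.subst, Sub.up_ren, h]

theorem Fm.ren_subst (φ : Fm Γ) (s : Sub Γ Δ) (r : Ren Δ Θ) :
    (φ.subst s).ren r = φ.subst (fun τ v => (s τ v).ren r) := by
  induction φ generalizing Δ Θ with
  | eq0 => simp only [Fm.ren, Fm.subst, Tm.ren_subst]
  | bot => rfl
  | imp _ _ h h' | and _ _ h h' | or _ _ h h' => simp only [Fm.ren, Fm.subst, h, h']
  | all _ _ h | ex _ _ h => simp only [Fm.ren, Fm.subst, Sub.up_comp_ren, h]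

theorem Fm.subst_subst (φ : Fm Γ) (s : Sub Γ Δ) (q : Sub Δ Θ) :
    (φ.subst s).subst q = φ.subst (fun τ v => (s τ v).subst q) := by
  induction φ generalizing Δ Θ with
  | eq0 => simp only [Fm.subst, Tm.subst_subst]
  | bot => rfl
  | imp _ _ h h' | and _ _ h h' | or _ _ h h' => simp only [Fm.subst, h, h']
  | all _ _ h | ex _ _ h => simp only [Fm.subst, Sub.up_comp, h]

theorem Fm.subst_var (φ : Fm Γ) : φ.subst (fun _ v => var v) = φ := by
  induction φ with
  | eq0 => simp only [Fm.subst, Tm.subst_var]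
  | bot => rfl
  | imp _ _ h h' | and _ _ h h' | or _ _ h h' => simp only [Fm.subst, h, h']
  | all _ _ h | ex _ _ h => simp only [Fm.subst, Sub.up_var, h]

theorem Fm.subst_of_closed (φ : Fm []) (s : Sub [] []) : φ.subst s = φ := by
  have hs : s = fun _ v => var v := funext₂ fun _ v => nomatch v
  rw [hs, Fm.subst_var]

theorem Fm.subst_one_wk (φ : Fm Γ) (a : Tm Γ σ) : φ.wk.subst (Sub.one a) = φ := by
  rw [Fm.wk, Fm.subst_ren]; exact φ.subst_var

theorem Fm.wk_subst_up (s : Sub Γ Δ) (φ : Fm Γ) :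
    φ.wk.subst (s.up (σ := σ)) = (φ.subst s).wk := by
  rw [Fm.wk, Fm.wk, Fm.subst_ren, Fm.ren_subst]; rfl

theorem Fm.subst_up_one (φ : Fm (σ :: Γ)) (s : Sub Γ Δ) (t : Tm Δ σ) :
    (φ.subst s.up).subst (Sub.one t) = φ.subst (Sub.cons t s) := by
  rw [Fm.subst_subst]
  congr; funext τ v
  cases v with
  | zero => rfl
  | succ v => exact Tm.subst_one_wk _ _

theorem Fm.subst_one_subst (φ : Fm (σ :: Γ)) (s : Sub Γ Δ) (t : Tm Γ σ) :
    (φ.subst (Sub.one t)).subst s = (φ.subst s.up).subst (Sub.one (t.subst s)) := by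
  rw [Fm.subst_up_one, Fm.subst_subst]
  congr; funext τ v; cases v <;> rfl

theorem Fm.wk_up_subst_one_var (φ : Fm (σ :: Γ)) :
    (φ.ren (Ren.up Ren.wk)).subst (Sub.one (v0 : Tm (σ :: Γ) σ)) = φ := by
  rw [Fm.subst_ren]
  conv_rhs => rw [← φ.subst_var]
  congr; funext τ v; cases v <;> rfl

theorem Fm.QF.subst {φ : Fm Γ} (h : φ.QF) (s : Sub Γ Δ) : (φ.subst s).QF := by
  induction φ generalizing Δ with
  | eq0 | bot => trivial
  | imp φ ψ ih ih' | and φ ψ ih ih' | or φ ψ ih ih' => exact ⟨ih h.1 s, ih' h.2 s⟩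
  | all | ex => exact h.elim

/-- A term of each type, witnessing that no type is empty. -/
def Tm.default : (τ : Ty) → Tm Γ τ
  | .nat => .const .zero
  | .sample => .const .point
  | .event => .const .empty
  | .arr σ τ => .const (.combK τ σ) ⊙ Tm.default τ

/-- The conjunction of a list of formulas. -/
def Fm.conj : List (Fm Γ) → Fm Γ
  | [] => not bot
  | φ :: H => φ ⋏' Fm.conj H

theorem Fm.QF.conj {H : List (Fm Γ)} (h : ∀ φ ∈ H, φ.QF) : (Fm.conj H).QF := by
  induction H with
  | nil => exact ⟨trivial, trivial⟩
  | cons φ H ih => exact ⟨h φ List.mem_cons_self, ih fun χ hχ => h χ (List.mem_cons_of_mem _ hχ)⟩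

end Substitution

/-! ### Derivations -/

namespace Prf

variable {T : Schema} {Γ : Ctx} {H K : List (Fm Γ)} {φ ψ χ : Fm Γ} {σ τ : Ty}

theorem weaken (h : Prf T H φ) (hs : H ⊆ K) : Prf T K φ := by
  induction h with
  | hyp h => exact .hyp (hs h)
  | ax h => exact .ax h
  | extra h => exact .extra h
  | imp_intro _ ih => exact .imp_intro (ih (List.cons_subset_cons _ hs))
  | imp_elim _ _ ih ih' => exact .imp_elim (ih hs) (ih' hs)
  | and_intro _ _ ih ih' => exact .and_intro (ih hs) (ih' hs)
  | and_left _ ih => exact .and_left (ih hs)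
  | and_right _ ih => exact .and_right (ih hs)
  | or_left _ ih => exact .or_left (ih hs)
  | or_right _ ih => exact .or_right (ih hs)
  | or_elim _ _ _ ih ih₁ ih₂ =>
    exact .or_elim (ih hs) (ih₁ (List.cons_subset_cons _ hs)) (ih₂ (List.cons_subset_cons _ hs))
  | by_contra _ ih => exact .by_contra (ih (List.cons_subset_cons _ hs))
  | all_intro _ ih => exact .all_intro (ih (List.map_subset _ hs))
  | all_elim _ t ih => exact .all_elim (ih hs) t
  | ex_intro t _ ih => exact .ex_intro t (ih hs)
  | ex_elim _ _ ih ih' =>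
    exact .ex_elim (ih hs) (ih' (List.cons_subset_cons _ (List.map_subset _ hs)))
  | qfer hφ r _ ih => exact .qfer hφ r (ih (List.nil_subset _))

theorem weaken_cons (h : Prf T H φ) : Prf T (ψ :: H) φ := h.weaken (List.subset_cons_self _ _)

theorem weaken_singleton (h : Prf T [ψ] φ) : Prf T (ψ :: H) φ :=
  h.weaken (List.cons_subset_cons _ (List.nil_subset _))

theorem hyp_zero : Prf T (φ :: H) φ := .hyp List.mem_cons_self

theorem hyp_one : Prf T (ψ :: φ :: H) φ := hyp_zero.weaken_cons

theorem hyp_two : Prf T (χ :: ψ :: φ :: H) φ := hyp_one.weaken_cons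

theorem cut (h : Prf T H φ) (h' : Prf T (φ :: H) ψ) : Prf T H ψ := (imp_intro h').imp_elim h

theorem cut_list (hH : ∀ φ ∈ H, Prf T K φ) (h : Prf T H ψ) : Prf T K ψ := by
  induction H generalizing ψ with
  | nil => exact h.weaken (List.nil_subset _)
  | cons φ H ih =>
    exact (ih (fun χ hχ => hH χ (List.mem_cons_of_mem _ hχ)) (.imp_intro h)).imp_elim
      (hH φ List.mem_cons_self)

theorem cut_two (h : Prf T K φ) (h' : Prf T K ψ) (hχ : Prf T [φ, ψ] χ) : Prf T K χ :=
  cut_list (List.forall_mem_cons.2 ⟨h, List.forall_mem_singleton.2 h'⟩) hχ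

theorem exfalso (h : Prf T H bot) : Prf T H φ := .by_contra h.weaken_cons

theorem of_all_wk {H : List (Fm (τ :: Γ))} {φ : Fm (τ :: Γ)} (h : Prf T H (all τ φ).wk) :
    Prf T H φ := by
  simpa only [Fm.wk_up_subst_one_var] using all_elim h v0

theorem ex_wk_intro {H : List (Fm (τ :: Γ))} {φ : Fm (τ :: Γ)} (h : Prf T H φ) :
    Prf T H (ex τ φ).wk := by
  refine ex_intro v0 ?_
  rwa [Fm.wk_up_subst_one_var]

theorem not_all_elim {φ : Fm (τ :: Γ)} (h : Prf T H (not (all τ φ))) :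
    Prf T H (ex τ (not φ)) := by
  refine .by_contra (.imp_elim h.weaken_cons (.all_intro (.by_contra ?_)))
  exact .imp_elim (φ := (ex τ (not φ)).wk) hyp_one (ex_wk_intro hyp_zero)

theorem exists_imp_of_ex (φ : Fm (τ :: Γ)) : Prf T H (ex τ ((ex τ φ).wk ⟹' φ)) := by
  refine .by_contra ?_
  have not_ex : Prf T (not (ex τ ((ex τ φ).wk ⟹' φ)) :: H) (not (ex τ φ)) := by
    refine .imp_intro (.ex_elim hyp_zero (χ := bot) ?_)
    exact .imp_elim (φ := (ex τ ((ex τ φ).wk ⟹' φ)).wk) hyp_two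
      (ex_wk_intro (.imp_intro hyp_one))
  refine .imp_elim hyp_zero (.ex_intro (Tm.default τ) (.imp_intro ?_))
  rw [Fm.subst_one_wk]
  exact .exfalso (.imp_elim not_ex.weaken_cons hyp_zero)

theorem eqF_refl (t : Tm Γ τ) : Prf T H (eqF τ t t) := by
  induction τ generalizing Γ with
  | nat => exact .ax (.eq_refl t)
  | sample => exact .ax (.eqΩ_refl t)
  | event => exact .all_intro (.and_intro (.imp_intro hyp_zero) (.imp_intro hyp_zero))
  | arr a b _ ih => exact .all_intro (ih _)

theorem eqF_symm {s t : Tm Γ τ} : Prf T [eqF τ s t] (eqF τ t s) := by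
  induction τ generalizing Γ with
  | nat => exact .imp_elim (.ax (.eq_symm s t)) hyp_zero
  | sample => exact .imp_elim (.ax (.eqΩ_symm s t)) hyp_zero
  | event =>
    have k := of_all_wk (T := T) (φ := iff (memF v0 s.wk) (memF v0 t.wk))
      (H := [eqF event s t].map Fm.wk) hyp_zero
    exact .all_intro (.and_intro k.and_right k.and_left)
  | arr a b _ ih =>
    have k := of_all_wk (T := T) (φ := eqF b (s.wk ⊙ v0) (t.wk ⊙ v0))
      (H := [eqF (a ⇒ₜ b) s t].map Fm.wk) hyp_zero
    exact .all_intro (k.cut ih.weaken_singleton)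

theorem eqF_trans {s t u : Tm Γ τ} : Prf T [eqF τ s t, eqF τ t u] (eqF τ s u) := by
  induction τ generalizing Γ with
  | nat => exact .imp_elim (.ax (.eq_trans s t u)) (.and_intro hyp_zero hyp_one)
  | sample => exact .imp_elim (.ax (.eqΩ_trans s t u)) (.and_intro hyp_zero hyp_one)
  | event =>
    have k := of_all_wk (T := T) (φ := iff (memF v0 s.wk) (memF v0 t.wk))
      (H := [eqF event s t, eqF event t u].map Fm.wk) hyp_zero
    have k' := of_all_wk (T := T) (φ := iff (memF v0 t.wk) (memF v0 u.wk))
      (H := [eqF event s t, eqF event t u].map Fm.wk) hyp_one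
    exact .all_intro (.and_intro
      (.imp_intro (.imp_elim k'.and_left.weaken_cons (.imp_elim k.and_left.weaken_cons hyp_zero)))
      (.imp_intro
        (.imp_elim k.and_right.weaken_cons (.imp_elim k'.and_right.weaken_cons hyp_zero))))
  | arr a b _ ih =>
    have k := of_all_wk (T := T) (φ := eqF b (s.wk ⊙ v0) (t.wk ⊙ v0))
      (H := [eqF (a ⇒ₜ b) s t, eqF (a ⇒ₜ b) t u].map Fm.wk) hyp_zero
    have k' := of_all_wk (T := T) (φ := eqF b (t.wk ⊙ v0) (u.wk ⊙ v0))
      (H := [eqF (a ⇒ₜ b) s t, eqF (a ⇒ₜ b) t u].map Fm.wk) hyp_one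
    exact .all_intro (cut_two k k' ih)

theorem trans {s t u : Tm Γ τ} (h : Prf T H (eqF τ s t)) (h' : Prf T H (eqF τ t u)) :
    Prf T H (eqF τ s u) :=
  cut_two h h' eqF_trans

theorem conj_intro (h : ∀ φ ∈ H, Prf T K φ) : Prf T K (Fm.conj H) := by
  induction H with
  | nil => exact .imp_intro hyp_zero
  | cons φ H ih =>
    exact .and_intro (h φ List.mem_cons_self) (ih fun χ hχ => h χ (List.mem_cons_of_mem _ hχ))

theorem conj_elim (h : Prf T K (Fm.conj H)) (hφ : φ ∈ H) : Prf T K φ := by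
  induction H with
  | nil => exact absurd hφ List.not_mem_nil
  | cons χ H ih =>
    rcases List.mem_cons.1 hφ with rfl | hφ
    · exact h.and_left
    · exact ih h.and_right hφ

theorem ext_rule {ρ : Ty} (hH : ∀ φ ∈ H, φ.QF) {s t : Tm Γ ρ} (r : Tm (ρ :: Γ) τ)
    (h : Prf T H (eqF ρ s t)) :
    Prf T H (eqF τ (r.subst (Sub.one s)) (r.subst (Sub.one t))) := by
  have k : Prf T [] (Fm.conj H ⟹' eqF ρ s t) :=
    .imp_intro (cut_list (fun _ hφ => conj_elim hyp_zero hφ) h)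
  exact .imp_elim (.qfer (Fm.QF.conj hH) r k) (conj_intro fun φ hφ => .hyp hφ)

theorem eqF_app (hH : ∀ φ ∈ H, φ.QF) {f g : Tm Γ (σ ⇒ₜ τ)} {a b : Tm Γ σ}
    (h : Prf T H (eqF _ f g)) (h' : Prf T H (eqF _ a b)) : Prf T H (eqF τ (f ⊙ a) (g ⊙ b)) := by
  have left : Prf T H (eqF τ (f ⊙ a) (g ⊙ a)) := by
    simpa only [Tm.subst, Tm.subst_one_wk, Sub.one_zero] using ext_rule hH (v0 ⊙ a.wk) h
  have right : Prf T H (eqF τ (g ⊙ a) (g ⊙ b)) := by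
    simpa only [Tm.subst, Tm.subst_one_wk, Sub.one_zero] using ext_rule hH (g.wk ⊙ v0) h'
  exact left.trans right

end Prf

/-! ### Closed terms with Henkin witnesses -/

/-- Closed terms built from the constants and from Henkin witnesses: `wit φ e` names an object that
satisfies `φ`, with parameters `e`, if there is one. -/
inductive ClosedTm : Ty → Type
  | wit {Γ : Ctx} {τ : Ty} (φ : Fm (τ :: Γ)) (e : (σ : Ty) → Var Γ σ → ClosedTm σ) : ClosedTm τ
  | const {τ : Ty} (c : Const τ) : ClosedTm τ
  | app {σ τ : Ty} (f : ClosedTm (σ ⇒ₜ τ)) (a : ClosedTm σ) : ClosedTm τ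

/-- Assignments of closed terms to the variables of a context. -/
abbrev ClosedEnv (Γ : Ctx) : Type := (τ : Ty) → Var Γ τ → ClosedTm τ

/-- Extend an assignment by a value for the most recent variable. -/
def ClosedEnv.cons {Γ : Ctx} {σ : Ty} (a : ClosedTm σ) (e : ClosedEnv Γ) : ClosedEnv (σ :: Γ)
  | _, .zero => a
  | _, .succ v => e _ v

/-- Interpretations of the Henkin witnesses as terms in a context; the values at other closed terms
are irrelevant. -/
abbrev Naming (Δ : Ctx) : Type := (w : Σ τ, ClosedTm τ) → Tm Δ w.1

/-- The term obtained by interpreting the Henkin witnesses. -/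
def ClosedTm.inst {Δ : Ctx} (g : Naming Δ) {τ : Ty} : ClosedTm τ → Tm Δ τ
  | wit φ e => g ⟨_, wit φ e⟩
  | const c => .const c
  | app f a => .app (f.inst g) (a.inst g)

/-- The closed term obtained by assigning closed terms to the variables. -/
def Tm.close {Γ : Ctx} (e : ClosedEnv Γ) {τ : Ty} : Tm Γ τ → ClosedTm τ
  | .var v => e _ v
  | .const c => .const c
  | .app f a => .app (f.close e) (a.close e)

theorem Tm.inst_close {Γ Δ : Ctx} (g : Naming Δ) (e : ClosedEnv Γ) {τ : Ty} (t : Tm Γ τ) :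
    (t.close e).inst g = t.subst (fun τ v => (e τ v).inst g) := by
  induction t with
  | var v => rfl
  | const c => rfl
  | app f a hf ha => simp only [Tm.close, ClosedTm.inst, Tm.subst, hf, ha]

/-- The nesting depth of the Henkin witnesses in a closed term. -/
noncomputable def ClosedTm.rank {τ : Ty} : ClosedTm τ → Ordinal.{0}
  | @wit Γ _ _ e => Order.succ (⨆ p : Σ σ, Var Γ σ, (e p.1 p.2).rank)
  | const _ => 0
  | app f a => max f.rank a.rank

theorem ClosedTm.rank_lt_rank_wit {Γ : Ctx} {σ τ : Ty} (φ : Fm (τ :: Γ)) (e : ClosedEnv Γ)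
    (v : Var Γ σ) : (e σ v).rank < (wit φ e).rank :=
  Order.lt_succ_of_le (Ordinal.le_iSup (fun p : Σ σ, Var Γ σ => (e p.1 p.2).rank) ⟨σ, v⟩)

open Classical in
/-- Interpret the witness `w` by a new variable. -/
noncomputable def Naming.bind {Δ : Ctx} (g : Naming Δ) (w : Σ τ, ClosedTm τ) :
    Naming (w.1 :: Δ) :=
  Function.update (fun w' => (g w').wk) w v0

open Classical in
theorem Naming.bind_self {Δ : Ctx} (g : Naming Δ) (w : Σ τ, ClosedTm τ) : g.bind w w = v0 :=
  Function.update_self ..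

open Classical in
theorem Naming.bind_of_ne {Δ : Ctx} (g : Naming Δ) {w w' : Σ τ, ClosedTm τ} (h : w' ≠ w) :
    g.bind w w' = (g w').wk :=
  Function.update_of_ne h ..

theorem ClosedTm.inst_bind {Δ : Ctx} (g : Naming Δ) {w : Σ τ, ClosedTm τ} {τ : Ty}
    (t : ClosedTm τ) (ht : t.rank < w.2.rank) : t.inst (g.bind w) = (t.inst g).wk := by
  induction t with
  | wit φ e => exact g.bind_of_ne (by rintro rfl; exact ht.false)
  | const c => rfl
  | app f a ihf iha =>
    have h := max_lt_iff.1 ht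
    rw [inst, ihf h.1, iha h.2]; rfl

/-! ### Entailment between sentences -/

/-- Sentences over the Henkin witnesses: formulas with an assignment for their free variables. -/
structure Sen : Type where
  {Γ : Ctx}
  φ : Fm Γ
  e : ClosedEnv Γ

/-- The formula obtained by interpreting the Henkin witnesses. -/
def Sen.inst {Δ : Ctx} (g : Naming Δ) (S : Sen) : Fm Δ :=
  S.φ.subst fun τ v => (S.e τ v).inst g

/-- The negation of a sentence. -/
def Sen.not (S : Sen) : Sen := ⟨Fm.not S.φ, S.e⟩

/-- A formula without variables, as a sentence. -/
def Sen.ofClosed (φ : Fm []) : Sen := ⟨φ, fun _ v => nomatch v⟩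

theorem Sen.inst_cons {Γ Δ : Ctx} {τ : Ty} (g : Naming Δ) (φ : Fm (τ :: Γ)) (a : ClosedTm τ)
    (e : ClosedEnv Γ) : Sen.inst g ⟨φ, .cons a e⟩ =
      (φ.subst (Sub.up fun τ v => (e τ v).inst g)).subst (Sub.one (a.inst g)) := by
  rw [Fm.subst_up_one, Sen.inst]
  congr; funext τ v; cases v <;> rfl

theorem Sen.inst_wk {Γ Δ : Ctx} {τ : Ty} (g : Naming Δ) (φ : Fm Γ) (a : ClosedTm τ)
    (e : ClosedEnv Γ) : Sen.inst g ⟨φ.wk, .cons a e⟩ = Sen.inst g ⟨φ, e⟩ :=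
  φ.subst_ren _ _

theorem Sen.inst_bind {Δ : Ctx} (g : Naming Δ) {w : Σ τ, ClosedTm τ} (S : Sen)
    (h : ∀ τ v, (S.e τ v).inst (g.bind w) = ((S.e τ v).inst g).wk) :
    S.inst (g.bind w) = (S.inst g).wk := by
  simp only [inst, h, Fm.wk, Fm.ren_subst]

/-- The sentence `S` follows from finitely many sentences of `X`, uniformly in the interpretation
of the Henkin witnesses. -/
def Entails (T : Schema) (X : Set Sen) (S : Sen) : Prop :=
  ∃ L : List Sen, (∀ S' ∈ L, S' ∈ X) ∧
    ∀ (Δ : Ctx) (g : Naming Δ), Prf T (L.map (Sen.inst g)) (S.inst g)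

/-- Sets of sentences that do not entail falsity. -/
def Consistent (T : Schema) (X : Set Sen) : Prop := ¬ Entails T X (.ofClosed bot)

section Entails

variable {T : Schema} {X Y : Set Sen} {S S₁ S₂ : Sen}

theorem Entails.of_mem (h : S ∈ X) : Entails T X S :=
  ⟨[S], List.forall_mem_singleton.2 h, fun _ _ => .hyp_zero⟩

theorem Entails.mono (h : Entails T X S) (hXY : X ⊆ Y) : Entails T Y S :=
  let ⟨L, hL, hS⟩ := h
  ⟨L, fun S' hS' => hXY (hL S' hS'), hS⟩

theorem Entails.of_prf (h : ∀ Δ (g : Naming Δ), Prf T [] (S.inst g)) : Entails T X S :=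
  ⟨[], List.forall_mem_nil _, h⟩

theorem Entails.map₂ (h₁ : Entails T X S₁) (h₂ : Entails T X S₂)
    (h : ∀ Δ (g : Naming Δ), Prf T [S₁.inst g, S₂.inst g] (S.inst g)) : Entails T X S := by
  obtain ⟨L, hL, h₁⟩ := h₁
  obtain ⟨K, hK, h₂⟩ := h₂
  refine ⟨L ++ K, List.forall_mem_append.2 ⟨hL, hK⟩, fun Δ g => ?_⟩
  rw [List.map_append]
  exact .cut_two ((h₁ Δ g).weaken (List.subset_append_left _ _))
    ((h₂ Δ g).weaken (List.subset_append_right _ _)) (h Δ g)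

theorem Entails.map (h₁ : Entails T X S₁)
    (h : ∀ Δ (g : Naming Δ), Prf T [S₁.inst g] (S.inst g)) : Entails T X S :=
  h₁.map₂ h₁ fun Δ g => (h Δ g).weaken_singleton

open Classical in
theorem Entails.not_of_insert (h : Entails T (insert S X) (.ofClosed bot)) :
    Entails T X S.not := by
  obtain ⟨L, hL, h⟩ := h
  refine ⟨L.filter (· ≠ S), fun S' hS' => ?_, fun Δ g => .imp_intro ((h Δ g).weaken ?_)⟩
  · obtain ⟨hS', hne⟩ := List.mem_filter.1 hS'
    exact (hL S' hS').resolve_left (of_decide_eq_true hne)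
  · intro φ hφ
    obtain ⟨S', hS', rfl⟩ := List.mem_map.1 hφ
    by_cases hne : S' = S
    · exact hne ▸ List.mem_cons_self
    · exact List.mem_cons_of_mem _
        (List.mem_map_of_mem (List.mem_filter.2 ⟨hS', decide_eq_true hne⟩))

theorem Entails.false_of_not (h : Entails T X S) (h' : Entails T X S.not) :
    Entails T X (.ofClosed bot) :=
  h'.map₂ h fun _ _ => .imp_elim .hyp_zero .hyp_one

theorem Consistent.insert_of_entails (hX : Consistent T X) (h : Entails T X S) :
    Consistent T (insert S X) :=
  fun hS => hX (h.false_of_not hS.not_of_insert)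

theorem consistent_isOfFiniteCharacter : Order.IsOfFiniteCharacter {X | Consistent T X} := by
  refine fun X => ⟨fun hX Y hYX _ hY => hX (hY.mono hYX), fun h ⟨L, hL, hbot⟩ => ?_⟩
  exact h {S | S ∈ L} hL (List.finite_toSet L) ⟨L, fun _ hS => hS, hbot⟩

end Entails

/-! ### Consistency of the Henkin axioms -/

/-- Existential sentences, given by their matrix and the values of its other variables. -/
structure ExSen : Type where
  {Γ : Ctx}
  {τ : Ty}
  φ : Fm (τ :: Γ)
  e : ClosedEnv Γ

namespace ExSen

/-- The Henkin witness of an existential sentence. -/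
abbrev witness (E : ExSen) : Σ τ, ClosedTm τ := ⟨E.τ, .wit E.φ E.e⟩

theorem witness_injective : Function.Injective witness := by
  rintro ⟨φ, e⟩ ⟨φ', e'⟩ h
  cases h
  rfl

/-- The Henkin axiom: if there is an object satisfying the matrix, the witness is one. -/
def henkin (E : ExSen) : Sen := ⟨(ex E.τ E.φ).wk ⟹' E.φ, .cons (.wit E.φ E.e) E.e⟩

theorem inst_bind_henkin {Δ : Ctx} (g : Naming Δ) (E : ExSen) :
    let φ := E.φ.subst (Sub.up fun τ v => (E.e τ v).inst g)
    E.henkin.inst (g.bind E.witness) = ((ex E.τ φ).wk ⟹' φ) := by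
  have hsub : (fun τ v => (E.henkin.e τ v).inst (g.bind E.witness)) =
      Sub.up fun τ v => (E.e τ v).inst g := by
    funext τ v
    cases v with
    | zero => exact g.bind_self E.witness
    | succ v => exact ClosedTm.inst_bind g _ (ClosedTm.rank_lt_rank_wit E.φ E.e v)
  rw [Sen.inst, hsub]
  exact congrArg (· ⟹' _) (Fm.wk_subst_up _ (ex E.τ E.φ))

theorem inst_bind_henkin_of_ne {Δ : Ctx} (g : Naming Δ) {E E' : ExSen} (hne : E' ≠ E)
    (hle : E'.witness.2.rank ≤ E.witness.2.rank) :
    E'.henkin.inst (g.bind E.witness) = (E'.henkin.inst g).wk := by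
  refine Sen.inst_bind g _ fun τ v => ?_
  cases v with
  | zero => exact g.bind_of_ne (witness_injective.ne hne)
  | succ v => exact ClosedTm.inst_bind g _ ((ClosedTm.rank_lt_rank_wit E'.φ E'.e v).trans_le hle)

end ExSen

section Henkin

variable {T : Schema} {X : Set Sen}

theorem Consistent.insert_henkin (hX : Consistent T X) (E : ExSen)
    (fresh : ∀ S ∈ X, ∀ Δ (g : Naming Δ), S.inst (g.bind E.witness) = (S.inst g).wk) :
    Consistent T (insert E.henkin X) := by
  intro h
  obtain ⟨L, hL, h⟩ := h.not_of_insert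
  refine hX ⟨L, hL, fun Δ g => ?_⟩
  refine .ex_elim (χ := bot)
    (Prf.exists_imp_of_ex (E.φ.subst (Sub.up fun τ v => (E.e τ v).inst g))) ?_
  have hL' : L.map (Sen.inst (g.bind E.witness)) = (L.map (Sen.inst g)).map Fm.wk := by
    rw [List.map_map]
    exact List.map_congr_left fun S hS => fresh S (hL S hS) Δ g
  have hnot := h _ (g.bind E.witness)
  rw [hL'] at hnot
  exact .imp_elim hnot.weaken_cons (E.inst_bind_henkin g ▸ .hyp_zero)

theorem Consistent.insert_range_henkin {S : Sen} (hS : Consistent T {S})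
    (fresh : ∀ (w : Σ τ, ClosedTm τ) Δ (g : Naming Δ), S.inst (g.bind w) = (S.inst g).wk) :
    Consistent T (insert S (Set.range ExSen.henkin)) := by
  classical
  have finite (F : Finset ExSen) : Consistent T (insert S (ExSen.henkin '' F)) := by
    refine F.induction_on_max_value (fun E => E.witness.2.rank) ?_ fun E F hE hmax ih => ?_
    · simpa only [Finset.coe_empty, Set.image_empty, insert_empty_eq] using hS
    · rw [Finset.coe_insert, Set.image_insert_eq, Set.insert_comm]
      refine ih.insert_henkin E (Set.forall_mem_insert.2 ⟨fresh _, ?_⟩)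
      rintro _ ⟨E', hE', rfl⟩ Δ g
      exact ExSen.inst_bind_henkin_of_ne g (ne_of_mem_of_not_mem hE' hE) (hmax E' hE')
  rintro ⟨L, hL, h⟩
  have hsub : (L.toFinset.erase S : Set Sen) ⊆ ExSen.henkin '' Set.univ := by
    intro S' hS'
    obtain ⟨hne, hmem⟩ := Finset.mem_erase.1 (Finset.mem_coe.1 hS')
    exact Set.image_univ ▸ (hL S' (List.mem_toFinset.1 hmem)).resolve_left hne
  obtain ⟨F, -, hF⟩ := Finset.subset_set_image_iff.1 hsub
  refine finite F ⟨L, fun S' hS' => ?_, h⟩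
  by_cases hne : S' = S
  · exact .inl hne
  · rw [← Finset.coe_image, hF]
    exact .inr (Finset.mem_erase.2 ⟨hne, List.mem_toFinset.2 hS'⟩)

/-- Maximal consistent sets of sentences that contain the Henkin axioms. -/
structure IsHenkin (T : Schema) (Th : Set Sen) : Prop where
  maximal : Maximal (Consistent T) Th
  henkin_mem (E : ExSen) : E.henkin ∈ Th

theorem Consistent.exists_isHenkin {S : Sen} (hS : Consistent T {S})
    (fresh : ∀ (w : Σ τ, ClosedTm τ) Δ (g : Naming Δ), S.inst (g.bind w) = (S.inst g).wk) :
    ∃ Th, IsHenkin T Th ∧ S ∈ Th := by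
  obtain ⟨Th, hsub, hmax⟩ :=
    consistent_isOfFiniteCharacter.exists_maximal (hS.insert_range_henkin fresh)
  exact ⟨Th, ⟨hmax, fun E => hsub (.inr ⟨E, rfl⟩)⟩, hsub (.inl rfl)⟩

namespace IsHenkin

variable {Th : Set Sen} {S : Sen} {Γ : Ctx} {φ ψ : Fm Γ} {e : ClosedEnv Γ}

theorem mem_of_entails (hT : IsHenkin T Th) (h : Entails T Th S) : S ∈ Th :=
  hT.maximal.2 (hT.maximal.1.insert_of_entails h) (Set.subset_insert S Th) (Set.mem_insert S Th)

theorem not_mem_iff (hT : IsHenkin T Th) : S.not ∈ Th ↔ S ∉ Th := by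
  refine ⟨fun h h' => hT.maximal.1 ((Entails.of_mem h').false_of_not (.of_mem h)), fun h => ?_⟩
  refine hT.mem_of_entails (Entails.not_of_insert ?_)
  by_contra hc
  exact h (hT.maximal.2 hc (Set.subset_insert S Th) (Set.mem_insert S Th))

theorem bot_notMem (hT : IsHenkin T Th) : (⟨bot, e⟩ : Sen) ∉ Th := fun h =>
  hT.maximal.1 ((Entails.of_mem h).map fun _ _ => .hyp_zero)

theorem and_mem_iff (hT : IsHenkin T Th) :
    (⟨φ ⋏' ψ, e⟩ : Sen) ∈ Th ↔ ⟨φ, e⟩ ∈ Th ∧ ⟨ψ, e⟩ ∈ Th :=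
  ⟨fun h => ⟨hT.mem_of_entails ((Entails.of_mem h).map fun _ _ => .and_left .hyp_zero),
    hT.mem_of_entails ((Entails.of_mem h).map fun _ _ => .and_right .hyp_zero)⟩,
    fun h => hT.mem_of_entails ((Entails.of_mem h.1).map₂ (.of_mem h.2) fun _ _ =>
      .and_intro .hyp_zero .hyp_one)⟩

theorem imp_mem_iff (hT : IsHenkin T Th) :
    (⟨φ ⟹' ψ, e⟩ : Sen) ∈ Th ↔ (⟨φ, e⟩ ∈ Th → ⟨ψ, e⟩ ∈ Th) := by
  refine ⟨fun h h' => hT.mem_of_entails ((Entails.of_mem h).map₂ (.of_mem h') fun _ _ =>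
    .imp_elim .hyp_zero .hyp_one), fun h => ?_⟩
  by_cases hφ : (⟨φ, e⟩ : Sen) ∈ Th
  · exact hT.mem_of_entails ((Entails.of_mem (h hφ)).map fun _ _ => .imp_intro .hyp_one)
  · exact hT.mem_of_entails ((Entails.of_mem (hT.not_mem_iff.2 hφ)).map fun _ _ =>
      .imp_intro (.exfalso (.imp_elim .hyp_one .hyp_zero)))

theorem or_mem_iff (hT : IsHenkin T Th) :
    (⟨φ ⋎' ψ, e⟩ : Sen) ∈ Th ↔ ⟨φ, e⟩ ∈ Th ∨ ⟨ψ, e⟩ ∈ Th := by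
  constructor
  · refine fun h => or_iff_not_imp_left.2 fun hφ => hT.mem_of_entails ?_
    exact (Entails.of_mem h).map₂ (.of_mem (hT.not_mem_iff.2 hφ)) fun _ _ =>
      .or_elim .hyp_zero (.exfalso (.imp_elim .hyp_two .hyp_zero)) .hyp_zero
  · rintro (h | h)
    · exact hT.mem_of_entails ((Entails.of_mem h).map fun _ _ => .or_left .hyp_zero)
    · exact hT.mem_of_entails ((Entails.of_mem h).map fun _ _ => .or_right .hyp_zero)

theorem ex_mem_iff (hT : IsHenkin T Th) {τ : Ty} {φ : Fm (τ :: Γ)} :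
    (⟨ex τ φ, e⟩ : Sen) ∈ Th ↔ ∃ a : ClosedTm τ, ⟨φ, .cons a e⟩ ∈ Th := by
  constructor
  · refine fun h => ⟨.wit φ e, hT.imp_mem_iff.1 (hT.henkin_mem ⟨φ, e⟩) ?_⟩
    exact hT.mem_of_entails ((Entails.of_mem h).map fun _ _ => Sen.inst_wk .. ▸ .hyp_zero)
  · rintro ⟨a, h⟩
    refine hT.mem_of_entails ((Entails.of_mem h).map fun _ g => .ex_intro (a.inst g) ?_)
    rw [Sen.inst_cons]
    exact .hyp_zero

theorem all_mem_iff (hT : IsHenkin T Th) {τ : Ty} {φ : Fm (τ :: Γ)} :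
    (⟨all τ φ, e⟩ : Sen) ∈ Th ↔ ∀ a : ClosedTm τ, ⟨φ, .cons a e⟩ ∈ Th := by
  constructor
  · refine fun h a => hT.mem_of_entails ((Entails.of_mem h).map fun _ g => ?_)
    rw [Sen.inst_cons]
    exact .all_elim .hyp_zero _
  · refine fun h => by_contra fun hall => ?_
    have hex : (⟨ex τ (not φ), e⟩ : Sen) ∈ Th := hT.mem_of_entails
      ((Entails.of_mem (hT.not_mem_iff.2 hall)).map fun _ _ => .not_all_elim .hyp_zero)
    obtain ⟨a, ha⟩ := hT.ex_mem_iff.1 hex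
    exact hT.not_mem_iff (S := ⟨φ, .cons a e⟩) |>.1 ha (h a)

end IsHenkin

end Henkin

/-! ### Structures -/

/-- Applicative structures for the language. -/
structure Str : Type 1 where
  C : Ty → Type
  app : {σ τ : Ty} → C (σ ⇒ₜ τ) → C σ → C τ
  cst : {τ : Ty} → Const τ → C τ

/-- Assignments of objects to the variables of a context. -/
abbrev Env (M : Str) (Γ : Ctx) : Type := (τ : Ty) → Var Γ τ → M.C τ

/-- The empty assignment. -/
def Env.nil {M : Str} : Env M [] := fun _ v => nomatch v

/-- Extend an assignment by a value for the most recent variable. -/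
def Env.cons {M : Str} {Γ : Ctx} {σ : Ty} (a : M.C σ) (e : Env M Γ) : Env M (σ :: Γ)
  | _, .zero => a
  | _, .succ v => e _ v

infixr:67 " ∷ " => Env.cons

/-- The value of a term. -/
def Tm.eval {M : Str} {Γ : Ctx} {τ : Ty} (e : Env M Γ) : Tm Γ τ → M.C τ
  | .var v => e _ v
  | .const c => M.cst c
  | .app f a => M.app (f.eval e) (a.eval e)

/-- Satisfaction of a formula; equality at type `0` is interpreted by equality. -/
@[simp] def Fm.sat {M : Str} {Γ : Ctx} (e : Env M Γ) : Fm Γ → Prop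
  | eq0 s t => s.eval e = t.eval e
  | bot => False
  | imp φ ψ => φ.sat e → ψ.sat e
  | and φ ψ => φ.sat e ∧ ψ.sat e
  | or φ ψ => φ.sat e ∨ ψ.sat e
  | all τ φ => ∀ a : M.C τ, φ.sat (a ∷ e)
  | ex τ φ => ∃ a : M.C τ, φ.sat (a ∷ e)

section Eval

variable {M : Str} {Γ Δ : Ctx} {σ τ : Ty} (e : Env M Γ)

@[simp] theorem Tm.eval_var (v : Var Γ τ) : (var v).eval e = e τ v := rfl

@[simp] theorem Tm.eval_const (c : Const τ) : (const c : Tm Γ τ).eval e = M.cst c := rfl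

@[simp] theorem Tm.eval_app (f : Tm Γ (σ ⇒ₜ τ)) (a : Tm Γ σ) :
    (f ⊙ a).eval e = M.app (f.eval e) (a.eval e) := rfl

@[simp] theorem Env.cons_zero (a : M.C σ) : (a ∷ e) σ .zero = a := rfl

@[simp] theorem Env.cons_succ (a : M.C σ) (v : Var Γ τ) : (a ∷ e) τ (.succ v) = e τ v := rfl

theorem Tm.eval_ren (t : Tm Γ τ) (r : Ren Γ Δ) (e : Env M Δ) :
    (t.ren r).eval e = t.eval fun τ v => e τ (r τ v) := by
  induction t with
  | var v => rfl
  | const c => rfl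
  | app f a hf ha => simp only [Tm.ren, Tm.eval, hf, ha]

theorem Tm.eval_subst (t : Tm Γ τ) (s : Sub Γ Δ) (e : Env M Δ) :
    (t.subst s).eval e = t.eval fun τ v => (s τ v).eval e := by
  induction t with
  | var v => rfl
  | const c => rfl
  | app f a hf ha => simp only [Tm.subst, Tm.eval, hf, ha]

@[simp] theorem Tm.eval_wk (t : Tm Γ τ) (a : M.C σ) : (t.ren Ren.wk).eval (a ∷ e) = t.eval e :=
  t.eval_ren _ _

@[simp] theorem Tm.eval_cl (t : Tm [] τ) : t.cl.eval e = t.eval Env.nil := by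
  rw [Tm.cl, Tm.eval_ren]
  exact congrArg (t.eval ·) (funext₂ fun _ v => nomatch v)

theorem Sub.eval_up (s : Sub Γ Δ) (e : Env M Δ) (a : M.C σ) :
    (fun τ v => (s.up τ v).eval (a ∷ e)) = a ∷ fun τ v => (s τ v).eval e := by
  funext τ v
  cases v with
  | zero => rfl
  | succ v => exact Tm.eval_wk ..

theorem Env.cons_up (r : Ren Γ Δ) (e : Env M Δ) (a : M.C σ) :
    (fun τ v => (a ∷ e) τ (r.up τ v)) = a ∷ fun τ v => e τ (r τ v) := by
  funext τ v; cases v <;> rfl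

theorem Fm.sat_subst (φ : Fm Γ) (s : Sub Γ Δ) (e : Env M Δ) :
    (φ.subst s).sat e ↔ φ.sat fun τ v => (s τ v).eval e := by
  induction φ generalizing Δ with
  | eq0 => simp only [Fm.subst, Fm.sat, Tm.eval_subst]
  | bot => rfl
  | imp _ _ h h' | and _ _ h h' | or _ _ h h' => simp only [Fm.subst, Fm.sat, h, h']
  | all _ _ h | ex _ _ h => simp only [Fm.subst, Fm.sat, h, Sub.eval_up]

theorem Fm.sat_ren (φ : Fm Γ) (r : Ren Γ Δ) (e : Env M Δ) :
    (φ.ren r).sat e ↔ φ.sat fun τ v => e τ (r τ v) := by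
  induction φ generalizing Δ with
  | eq0 => simp only [Fm.ren, Fm.sat, Tm.eval_ren]
  | bot => rfl
  | imp _ _ h h' | and _ _ h h' | or _ _ h h' => simp only [Fm.ren, Fm.sat, h, h']
  | all _ _ h | ex _ _ h => simp only [Fm.ren, Fm.sat, h, Env.cons_up]

end Eval

/-! ### Models and completeness -/

/-- Models of arithmetic in all finite types for a probability content: the equations for the
combinators and for the recursors of single types hold as equations between objects, and so do all
formulas whose substitution instances are axioms. -/
class Model (M : Str) : Prop where
  combK {ρ τ : Ty} (x : M.C ρ) (y : M.C τ) : M.app (M.app (M.cst (.combK ρ τ)) x) y = x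
  combS {δ ρ τ : Ty} (x : M.C (δ ⇒ₜ ρ ⇒ₜ τ)) (y : M.C (δ ⇒ₜ ρ)) (z : M.C δ) :
    M.app (M.app (M.app (M.cst (.combS δ ρ τ)) x) y) z = M.app (M.app x z) (M.app y z)
  recur_zero {ρ : Ty} (b : M.C ρ) (f : M.C (ρ ⇒ₜ nat ⇒ₜ ρ)) :
    M.app (M.app (M.app (M.cst (.recur [ρ] ρ .zero)) (M.cst .zero)) b) f = b
  recur_succ {ρ : Ty} (n : M.C nat) (b : M.C ρ) (f : M.C (ρ ⇒ₜ nat ⇒ₜ ρ)) :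
    M.app (M.app (M.app (M.cst (.recur [ρ] ρ .zero)) (M.app (M.cst .succ) n)) b) f =
      M.app (M.app f (M.app (M.app (M.app (M.cst (.recur [ρ] ρ .zero)) n) b) f)) n
  sat_of_axm {Γ : Ctx} {φ : Fm Γ} (h : ∀ Δ (s : Sub Γ Δ), Axm (φ.subst s)) (e : Env M Γ) : φ.sat e

/-- Models of the system extended by the axioms `T`: all formulas whose substitution instances are
derivable hold. -/
class ModelOf (T : Schema) (M : Str) : Prop extends Model M where
  sat_of_prf {Γ : Ctx} {φ : Fm Γ} (h : ∀ Δ (s : Sub Γ Δ), Prf T [] (φ.subst s)) (e : Env M Γ) :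
    φ.sat e

theorem eqF_subst {Γ Δ : Ctx} {τ : Ty} (t u : Tm Γ τ) (s : Sub Γ Δ) :
    (eqF τ t u).subst s = eqF τ (t.subst s) (u.subst s) := by
  induction τ generalizing Γ Δ with
  | nat | sample => rfl
  | event => simp only [eqF, iff, memF, Fm.subst, Tm.subst, Tm.wk_subst_up]; rfl
  | arr σ τ _ ih => simp only [eqF, Fm.subst, ih, Tm.subst, Tm.wk_subst_up]; rfl

/-- Equality of two closed terms, as a sentence. -/
def Sen.eq {τ : Ty} (a b : ClosedTm τ) : Sen :=
  ⟨(eqF τ v0 v1 : Fm [τ, τ]), .cons a (.cons b fun _ v => nomatch v)⟩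

theorem Sen.inst_eq {Δ : Ctx} (g : Naming Δ) {τ : Ty} (a b : ClosedTm τ) :
    (Sen.eq a b).inst g = eqF τ (a.inst g) (b.inst g) := by
  rw [Sen.inst, Sen.eq, eqF_subst]; rfl

/-- Equality of objects of the term model: derivability from quantifier-free sentences in `Th`. As
the rule of extensionality needs quantifier-free premises, only this restricted notion is a
congruence. -/
def TermEq (T : Schema) (Th : Set Sen) {τ : Ty} (a b : ClosedTm τ) : Prop :=
  Entails T {S ∈ Th | S.φ.QF} (.eq a b)

section TermModel

variable {T : Schema} {Th : Set Sen} {Γ : Ctx} {σ τ : Ty}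

theorem TermEq.of_prf {a b : ClosedTm τ}
    (h : ∀ Δ (g : Naming Δ), Prf T [] (eqF τ (a.inst g) (b.inst g))) : TermEq T Th a b :=
  Entails.of_prf fun Δ g => Sen.inst_eq g a b ▸ h Δ g

theorem TermEq.equivalence (τ : Ty) : Equivalence (TermEq T Th (τ := τ)) where
  refl _ := .of_prf fun _ _ => Prf.eqF_refl _
  symm h := h.map fun Δ g => by simpa only [Sen.inst_eq] using Prf.eqF_symm
  trans h h' := h.map₂ h' fun Δ g => by simpa only [Sen.inst_eq] using Prf.eqF_trans

theorem TermEq.app {f f' : ClosedTm (σ ⇒ₜ τ)} {a a' : ClosedTm σ} (hf : TermEq T Th f f')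
    (ha : TermEq T Th a a') : TermEq T Th (.app f a) (.app f' a') := by
  obtain ⟨L, hL, h⟩ := hf
  obtain ⟨K, hK, k⟩ := ha
  have hLK := List.forall_mem_append.2 ⟨hL, hK⟩
  refine ⟨L ++ K, hLK, fun Δ g => ?_⟩
  have hQF : ∀ φ ∈ (L ++ K).map (Sen.inst g), φ.QF := by
    intro φ hφ
    obtain ⟨S, hS, rfl⟩ := List.mem_map.1 hφ
    exact (hLK S hS).2.subst _
  simp only [Sen.inst_eq] at h k ⊢
  exact Prf.eqF_app hQF ((h Δ g).weaken (List.map_subset _ (List.subset_append_left ..)))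
    ((k Δ g).weaken (List.map_subset _ (List.subset_append_right ..)))

/-- Closed terms up to equality. -/
def termSetoid (T : Schema) (Th : Set Sen) (τ : Ty) : Setoid (ClosedTm τ) :=
  ⟨TermEq T Th, TermEq.equivalence τ⟩

/-- The term model of a set of sentences. -/
def termStr (T : Schema) (Th : Set Sen) : Str where
  C τ := Quotient (termSetoid T Th τ)
  app := Quotient.map₂ ClosedTm.app fun _ _ h _ _ h' => h.app h'
  cst c := Quotient.mk _ (.const c)

/-- The object of the term model denoted by a closed term. -/
def denote (T : Schema) (Th : Set Sen) {τ : Ty} (a : ClosedTm τ) : (termStr T Th).C τ :=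
  Quotient.mk (termSetoid T Th τ) a

theorem denote_surjective : Function.Surjective (denote T Th (τ := τ)) := Quotient.exists_rep

theorem denote_eq_iff {a b : ClosedTm τ} : denote T Th a = denote T Th b ↔ TermEq T Th a b :=
  Quotient.eq

theorem denote_cons (a : ClosedTm σ) (e : ClosedEnv Γ) :
    (fun τ v => denote T Th (ClosedEnv.cons a e τ v)) =
      denote T Th a ∷ fun τ v => denote T Th (e τ v) := by
  funext τ v; cases v <;> rfl

theorem eval_denote (t : Tm Γ τ) (e : ClosedEnv Γ) :
    t.eval (fun τ v => denote T Th (e τ v)) = denote T Th (t.close e) := by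
  induction t with
  | var v => rfl
  | const c => rfl
  | app f a ihf iha => rw [Tm.eval, ihf, iha]; rfl

namespace IsHenkin

theorem eq_mem_iff (hT : IsHenkin T Th) {s t : Tm Γ nat} {e : ClosedEnv Γ} :
    (⟨s ≐ t, e⟩ : Sen) ∈ Th ↔ TermEq T Th (s.close e) (t.close e) := by
  have inst : ∀ Δ (g : Naming Δ),
      Sen.inst g ⟨s ≐ t, e⟩ = Sen.inst g (.eq (s.close e) (t.close e)) := fun Δ g => by
    rw [Sen.inst_eq, Tm.inst_close, Tm.inst_close]; rfl
  constructor
  · exact fun h => Entails.map (Entails.of_mem ⟨h, trivial⟩) fun Δ g => by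
      rw [← inst]; exact .hyp_zero
  · exact fun h => hT.mem_of_entails <| (h.mono (Set.sep_subset ..)).map fun Δ g => by
      rw [inst]; exact .hyp_zero

theorem sat_iff (hT : IsHenkin T Th) (φ : Fm Γ) (e : ClosedEnv Γ) :
    φ.sat (fun τ v => denote T Th (e τ v)) ↔ (⟨φ, e⟩ : Sen) ∈ Th := by
  induction φ with
  | eq0 s t => rw [Fm.sat, eval_denote, eval_denote, denote_eq_iff, hT.eq_mem_iff]
  | bot => exact ⟨False.elim, hT.bot_notMem⟩
  | imp φ ψ ih ih' => rw [Fm.sat, ih, ih', hT.imp_mem_iff]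
  | and φ ψ ih ih' => rw [Fm.sat, ih, ih', hT.and_mem_iff]
  | or φ ψ ih ih' => rw [Fm.sat, ih, ih', hT.or_mem_iff]
  | all τ φ ih => simp only [Fm.sat, denote_surjective.forall, ← denote_cons, ih, hT.all_mem_iff]
  | ex τ φ ih => simp only [Fm.sat, denote_surjective.exists, ← denote_cons, ih, hT.ex_mem_iff]

theorem sat_of_prf (hT : IsHenkin T Th) {φ : Fm Γ} (h : ∀ Δ (s : Sub Γ Δ), Prf T [] (φ.subst s))
    (e : Env (termStr T Th) Γ) : φ.sat e := by
  choose e' he' using fun τ v => denote_surjective (T := T) (Th := Th) (e τ v)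
  obtain rfl : (fun τ v => denote T Th (e' τ v)) = e := funext₂ he'
  exact (hT.sat_iff φ e').2 (hT.mem_of_entails (Entails.of_prf fun Δ _ => h Δ _))

theorem modelOf (hT : IsHenkin T Th) : ModelOf T (termStr T Th) where
  combK x y := by
    obtain ⟨x, rfl⟩ := denote_surjective x
    obtain ⟨y, rfl⟩ := denote_surjective y
    exact denote_eq_iff.2 (.of_prf fun _ _ => .ax (.combK _ _))
  combS x y z := by
    obtain ⟨x, rfl⟩ := denote_surjective x
    obtain ⟨y, rfl⟩ := denote_surjective y
    obtain ⟨z, rfl⟩ := denote_surjective z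
    exact denote_eq_iff.2 (.of_prf fun _ _ => .ax (.combS _ _ _))
  recur_zero {ρ} b f := by
    obtain ⟨b, rfl⟩ := denote_surjective b
    obtain ⟨f, rfl⟩ := denote_surjective f
    refine denote_eq_iff.2 (.of_prf fun Δ g => .ax ?_)
    exact Axm.recur_zero (ρs := [ρ]) .zero (fun | _, .zero => b.inst g) (fun | _, .zero => f.inst g)
  recur_succ {ρ} n b f := by
    obtain ⟨n, rfl⟩ := denote_surjective n
    obtain ⟨b, rfl⟩ := denote_surjective b
    obtain ⟨f, rfl⟩ := denote_surjective f
    refine denote_eq_iff.2 (.of_prf fun Δ g => .ax ?_)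
    exact Axm.recur_succ (ρs := [ρ]) .zero (n.inst g) (fun | _, .zero => b.inst g)
      (fun | _, .zero => f.inst g)
  sat_of_axm h := hT.sat_of_prf fun Δ s => .ax (h Δ s)
  sat_of_prf := hT.sat_of_prf

end IsHenkin

end TermModel

theorem proves_of_forall_sat {T : Schema} {φ : Fm []}
    (h : ∀ M [ModelOf T M], φ.sat (Env.nil (M := M))) : Proves T φ := by
  by_contra hφ
  have consistent : Consistent T {.ofClosed (not φ)} := by
    intro hbot
    obtain ⟨L, hL, h⟩ := Entails.not_of_insert (X := ∅) (by rwa [insert_empty_eq])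
    obtain rfl := List.eq_nil_iff_forall_not_mem.2 hL
    have hnn := h [] fun w => Tm.default w.1
    rw [Sen.not, Sen.ofClosed, Sen.inst, Fm.subst_of_closed] at hnn
    exact hφ (.by_contra (.imp_elim (hnn.weaken (List.nil_subset _)) .hyp_zero))
  obtain ⟨Th, hT, hmem⟩ := consistent.exists_isHenkin fun w Δ g =>
    Sen.inst_bind g _ fun _ v => nomatch v
  have := hT.modelOf
  refine (hT.sat_iff (not φ) fun _ v => nomatch v).2 hmem ?_
  convert h (termStr T Th) using 1
  funext τ v; cases v

/-! ### Natural numbers of a model -/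

/-- The natural numbers of a structure. -/
abbrev Num (M : Str) : Type := M.C nat

/-- The value of the recursor for a single type. -/
def recN {M : Str} {ρ : Ty} (n : Num M) (b : M.C ρ) (f : M.C (ρ ⇒ₜ nat ⇒ₜ ρ)) : M.C ρ :=
  M.app (M.app (M.app (M.cst (.recur [ρ] ρ .zero)) n) b) f

/-- Sets of natural numbers defined in a structure by a formula with parameters; induction holds
for these only. -/
def Definable {M : Str} (p : Num M → Prop) : Prop :=
  ∃ (Γ : Ctx) (φ : Fm (nat :: Γ)) (e : Env M Γ), ∀ n, φ.sat (n ∷ e) ↔ p n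

namespace Num

variable {M : Str}

instance : Zero (Num M) := ⟨M.cst .zero⟩
instance : One (Num M) := ⟨M.app (M.cst .succ) (M.cst .zero)⟩
instance : Add (Num M) := ⟨fun x y => M.app (M.app (addC.eval .nil) x) y⟩
instance : Mul (Num M) := ⟨fun x y => M.app (M.app (mulC.eval .nil) x) y⟩
instance : _root_.Sub (Num M) := ⟨fun x y => M.app (M.app (subC.eval .nil) x) y⟩

@[simp] theorem cst_zero : M.cst .zero = (0 : Num M) := rfl

@[simp] theorem app_addC (x y : Num M) : M.app (M.app (addC.eval .nil) x) y = x + y := rfl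

@[simp] theorem app_mulC (x y : Num M) : M.app (M.app (mulC.eval .nil) x) y = x * y := rfl

@[simp] theorem app_subC (x y : Num M) : M.app (M.app (subC.eval .nil) x) y = x - y := rfl

end Num

section Recursion

variable {M : Str} {Γ Δ : Ctx} {ρ σ τ : Ty}

theorem Tm.ren_lam (t : Tm (σ :: Γ) τ) (r : Ren Γ Δ) : (lam t).ren r = lam (t.ren r.up) := by
  induction t with
  | var v => cases v <;> rfl
  | const c => rfl
  | app f a hf ha => simp only [lam, Tm.ren, hf, ha]

theorem Tm.ren_cl (t : Tm [] τ) (r : Ren Γ Δ) : t.cl.ren r = t.cl := by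
  rw [Tm.cl, Tm.cl, Tm.ren_ren]
  exact congrArg (t.ren ·) (funext₂ fun _ v => nomatch v)

@[simp] theorem eval_recT (n : Tm Γ nat) (b : Tm Γ ρ) (f : Tm Γ (ρ ⇒ₜ nat ⇒ₜ ρ)) (e : Env M Γ) :
    (recT n b f).eval e = recN (n.eval e) (b.eval e) (f.eval e) := rfl

variable [Model M]

@[simp] theorem app_lam (t : Tm (σ :: Γ) τ) (e : Env M Γ) (a : M.C σ) :
    M.app ((lam t).eval e) a = t.eval (a ∷ e) := by
  induction t with
  | var v =>
    cases v with
    | zero => simp only [lam, Tm.eval, Model.combS, Model.combK, Env.cons_zero]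
    | succ v => simp only [lam, Tm.eval, Model.combK, Env.cons_succ]
  | const c => simp only [lam, Tm.eval, Model.combK]
  | app f b ihf ihb => simp only [lam, Tm.eval, Model.combS, ihf, ihb]

@[simp] theorem recN_zero (b : M.C ρ) (f : M.C (ρ ⇒ₜ nat ⇒ₜ ρ)) : recN 0 b f = b :=
  Model.recur_zero b f

theorem recN_succ (n : Num M) (b : M.C ρ) (f : M.C (ρ ⇒ₜ nat ⇒ₜ ρ)) :
    recN (M.app (M.cst .succ) n) b f = M.app (M.app f (recN n b f)) n :=
  Model.recur_succ n b f

namespace Num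

@[simp] protected theorem add_zero (x : Num M) : x + 0 = x := by
  rw [← app_addC, addC, app_lam, app_lam, eval_recT]
  exact recN_zero _ _

theorem add_succ (x y : Num M) : x + M.app (M.cst .succ) y = M.app (M.cst .succ) (x + y) := by
  rw [← app_addC, ← app_addC, addC, app_lam, app_lam, app_lam, eval_recT, eval_recT]
  refine (recN_succ ..).trans ?_
  simp only [app_lam]
  rfl

@[simp] theorem app_succ (x : Num M) : M.app (M.cst .succ) x = x + 1 := by
  rw [show (1 : Num M) = M.app (M.cst .succ) 0 from rfl, add_succ, Num.add_zero]

end Num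

@[simp] theorem recN_add_one (n : Num M) (b : M.C ρ) (f : M.C (ρ ⇒ₜ nat ⇒ₜ ρ)) :
    recN (n + 1) b f = M.app (M.app f (recN n b f)) n := by
  rw [← Num.app_succ, recN_succ]

theorem app_lam_recT_add_one {b : Tm (nat :: Γ) ρ} {t : Tm (nat :: ρ :: nat :: Γ) ρ} {e : Env M Γ}
    (n : Num M) (t' : Tm (nat :: ρ :: Γ) ρ)
    (hb : b.eval ((n + 1) ∷ e) = b.eval (n ∷ e) := by rfl)
    (ht : t'.ren Ren.wk.up.up = t := by simp only [Tm.ren, Tm.ren_cl]; rfl) :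
    M.app ((lam (recT v0 b (lam (lam t)))).eval e) (n + 1) =
      t.eval (n ∷ M.app ((lam (recT v0 b (lam (lam t)))).eval e) n ∷ n ∷ e) := by
  have hf (m : Num M) : (lam (lam t)).eval (m ∷ e) = (lam (lam t')).eval e := by
    rw [← ht, ← Tm.ren_lam, ← Tm.ren_lam, Tm.eval_wk]
  rw [app_lam, app_lam, eval_recT, eval_recT, hb, hf, ← hf n]
  exact (recN_add_one ..).trans (by rw [app_lam, app_lam]; rfl)

end Recursion

/-! ### The ordered semiring of natural numbers -/

section Arithmetic

variable {M : Str} [Model M] {p : Num M → Prop}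

@[elab_as_elim]
theorem Num.induction (definable : Definable p) (zero : p 0) (succ : ∀ n, p n → p (n + 1))
    (n : Num M) : p n := by
  obtain ⟨Γ, φ, e, hφ⟩ := definable
  have sat := Model.sat_of_axm (M := M) (φ := φ.subst (Sub.one ProbContent.zero) ⋏'
    all nat (φ ⟹' φ.subst (Sub.cons (suc v0) fun _ v => var (.succ v))) ⟹' all nat φ)
    (fun Δ s => ?_) e
  · refine (hφ n).1 (sat ⟨?_, fun n hn => ?_⟩ n)
    · rw [Fm.sat_subst]
      convert (hφ 0).2 zero using 1
      funext τ v; cases v <;> rfl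
    · rw [Fm.sat_subst]
      convert (hφ (n + 1)).2 (succ n ((hφ n).1 hn)) using 1
      funext τ v; cases v
      exacts [Num.app_succ n, rfl]
  · convert Axm.induction (φ.subst s.up) using 1
    simp only [Fm.subst, Fm.subst_one_subst, Tm.subst]
    congr 4
    simp only [Fm.subst_subst]
    congr; funext τ v
    cases v with
    | zero => rfl
    | succ v =>
      simp only [Sub.up, Tm.subst_ren]
      exact Tm.ren_eq_subst _ _

namespace Num

theorem add_one_ne_zero (x : Num M) : x + 1 ≠ 0 := by
  rw [← app_succ]
  exact Model.sat_of_axm (Γ := [nat]) (φ := not (suc v0 ≐ ProbContent.zero))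
    (fun _ _ => .succ_ne _) (x ∷ .nil)

theorem add_one_inj {x y : Num M} (h : x + 1 = y + 1) : x = y := by
  rw [← app_succ, ← app_succ] at h
  exact Model.sat_of_axm (Γ := [nat, nat]) (φ := suc v0 ≐ suc v1 ⟹' v0 ≐ v1)
    (fun _ _ => .succ_inj _ _) (x ∷ y ∷ .nil) h

theorem add_add_one (x y : Num M) : x + (y + 1) = x + y + 1 := by
  rw [← app_succ, ← app_succ, add_succ]

protected theorem mul_zero (x : Num M) : x * 0 = 0 := by
  rw [← app_mulC, mulC, app_lam, app_lam, eval_recT]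
  exact recN_zero _ _

theorem mul_add_one (x y : Num M) : x * (y + 1) = x * y + x := by
  rw [← app_mulC, ← app_mulC, mulC, app_lam, app_lam_recT_add_one y (add v1 v2)]
  simp only [Tm.eval_app, Tm.eval_cl, app_addC]
  rfl

protected theorem zero_add (x : Num M) : 0 + x = x := by
  induction x using Num.induction with
  | definable => exact ⟨_, add zero v0 ≐ v0, .nil, fun _ => by simp⟩
  | zero => exact Num.add_zero 0
  | succ x ih => rw [add_add_one, ih]

theorem add_one_add (x y : Num M) : x + 1 + y = x + y + 1 := by
  induction y using Num.induction with
  | definable => exact ⟨_, add (suc v1) v0 ≐ suc (add v1 v0), x ∷ .nil, fun _ => by simp⟩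
  | zero => rw [Num.add_zero, Num.add_zero]
  | succ y ih => rw [add_add_one, ih, add_add_one]

protected theorem add_comm (x y : Num M) : x + y = y + x := by
  induction y using Num.induction with
  | definable => exact ⟨_, add v1 v0 ≐ add v0 v1, x ∷ .nil, fun _ => by simp⟩
  | zero => rw [Num.add_zero, Num.zero_add]
  | succ y ih => rw [add_add_one, ih, add_one_add]

protected theorem add_assoc (x y z : Num M) : x + y + z = x + (y + z) := by
  induction z using Num.induction with
  | definable =>
    exact ⟨_, add (add v1 v2) v0 ≐ add v1 (add v2 v0), x ∷ y ∷ .nil, fun _ => by simp⟩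
  | zero => rw [Num.add_zero, Num.add_zero]
  | succ z ih => rw [add_add_one, ih, add_add_one, add_add_one]

instance : AddCommMonoid (Num M) where
  add_assoc := Num.add_assoc
  zero_add := Num.zero_add
  add_zero := Num.add_zero
  add_comm := Num.add_comm
  nsmul := nsmulRec

protected theorem zero_mul (x : Num M) : 0 * x = 0 := by
  induction x using Num.induction with
  | definable => exact ⟨_, mul zero v0 ≐ zero, .nil, fun _ => by simp⟩
  | zero => exact Num.mul_zero 0
  | succ x ih => rw [mul_add_one, ih, add_zero]

theorem add_one_mul (x y : Num M) : (x + 1) * y = x * y + y := by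
  induction y using Num.induction with
  | definable =>
    exact ⟨_, mul (suc v1) v0 ≐ add (mul v1 v0) v0, x ∷ .nil, fun _ => by simp⟩
  | zero => rw [Num.mul_zero, Num.mul_zero, add_zero]
  | succ y ih => rw [mul_add_one, mul_add_one, ih]; abel

protected theorem mul_comm (x y : Num M) : x * y = y * x := by
  induction y using Num.induction with
  | definable => exact ⟨_, mul v1 v0 ≐ mul v0 v1, x ∷ .nil, fun _ => by simp⟩
  | zero => rw [Num.mul_zero, Num.zero_mul]
  | succ y ih => rw [mul_add_one, ih, add_one_mul]

protected theorem mul_add (x y z : Num M) : x * (y + z) = x * y + x * z := by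
  induction z using Num.induction with
  | definable =>
    exact ⟨_, mul v1 (add v2 v0) ≐ add (mul v1 v2) (mul v1 v0), x ∷ y ∷ .nil, fun _ => by simp⟩
  | zero => rw [add_zero, Num.mul_zero, add_zero]
  | succ z ih => rw [add_add_one, mul_add_one, ih, mul_add_one, add_assoc]

protected theorem mul_assoc (x y z : Num M) : x * y * z = x * (y * z) := by
  induction z using Num.induction with
  | definable =>
    exact ⟨_, mul (mul v1 v2) v0 ≐ mul v1 (mul v2 v0), x ∷ y ∷ .nil, fun _ => by simp⟩
  | zero => rw [Num.mul_zero, Num.mul_zero, Num.mul_zero]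
  | succ z ih => rw [mul_add_one, ih, mul_add_one, Num.mul_add]

protected theorem one_mul (x : Num M) : 1 * x = x := by
  rw [← zero_add (1 : Num M), add_one_mul, Num.zero_mul, zero_add]

instance : CommSemiring (Num M) where
  left_distrib := Num.mul_add
  right_distrib x y z := by simp only [Num.mul_comm _ z, Num.mul_add]
  zero_mul := Num.zero_mul
  mul_zero := Num.mul_zero
  mul_assoc := Num.mul_assoc
  one_mul := Num.one_mul
  mul_one x := by rw [Num.mul_comm, Num.one_mul]
  mul_comm := Num.mul_comm

theorem eq_zero_or_exists_eq_add_one (x : Num M) : x = 0 ∨ ∃ y, x = y + 1 := by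
  induction x using Num.induction with
  | definable =>
    refine ⟨_, v0 ≐ zero ⋎' ex nat (v1 ≐ suc v0), .nil, fun _ => ?_⟩
    simp only [Fm.sat, Tm.eval_app, Tm.eval_const, Tm.eval_var, app_succ]
    rfl
  | zero => exact .inl rfl
  | succ x => exact .inr ⟨x, rfl⟩

theorem exists_eq_add_one {x : Num M} (hx : x ≠ 0) : ∃ y, x = y + 1 :=
  (eq_zero_or_exists_eq_add_one x).resolve_left hx

instance : IsRightCancelAdd (Num M) where
  add_right_cancel z x y h := by
    induction z using Num.induction with
    | definable =>
      exact ⟨_, add v1 v0 ≐ add v2 v0 ⟹' v1 ≐ v2, x ∷ y ∷ .nil, fun _ => by simp⟩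
    | zero => simpa only [add_zero] using h
    | succ z ih => exact ih (add_one_inj (by simpa only [add_assoc] using h))

instance : IsCancelAdd (Num M) := AddCommMagma.IsRightCancelAdd.toIsCancelAdd _

theorem eq_zero_of_add_eq_zero {x y : Num M} (h : x + y = 0) : x = 0 := by
  by_contra hx
  obtain ⟨z, rfl⟩ := exists_eq_add_one hx
  exact add_one_ne_zero (z + y) (by rw [← h, add_right_comm])

theorem exists_add_eq_or_add_eq (x y : Num M) : ∃ z, x + z = y ∨ y + z = x := by
  induction y using Num.induction with
  | definable =>
    exact ⟨_, ex nat (add v2 v0 ≐ v1 ⋎' add v1 v0 ≐ v2), x ∷ .nil, fun _ => by simp⟩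
  | zero => exact ⟨x, .inr (zero_add x)⟩
  | succ y ih =>
    obtain ⟨z, rfl | rfl⟩ := ih
    · exact ⟨z + 1, .inl (by ring)⟩
    · by_cases hz : z = 0
      · exact ⟨1, .inl (by rw [hz, add_zero])⟩
      · obtain ⟨w, rfl⟩ := exists_eq_add_one hz
        exact ⟨w, .inr (by ring)⟩

open Classical in
noncomputable instance : LinearOrder (Num M) where
  le x y := ∃ z, y = x + z
  le_refl x := ⟨0, (add_zero x).symm⟩
  le_trans := by
    rintro x y z ⟨u, rfl⟩ ⟨v, rfl⟩
    exact ⟨u + v, add_assoc x u v⟩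
  le_antisymm := by
    rintro x y ⟨u, rfl⟩ ⟨v, hv⟩
    have huv : u + v = 0 := by rwa [add_assoc, left_eq_add] at hv
    rw [eq_zero_of_add_eq_zero huv, add_zero]
  le_total x y := by
    obtain ⟨z, h | h⟩ := exists_add_eq_or_add_eq x y
    exacts [.inl ⟨z, h.symm⟩, .inr ⟨z, h.symm⟩]
  toDecidableLE := Classical.decRel _

instance : IsOrderedCancelAddMonoid (Num M) where
  add_le_add_left x y h z := by
    obtain ⟨u, rfl⟩ := h
    exact ⟨u, add_right_comm x u z⟩
  le_of_add_le_add_left x y z h := by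
    obtain ⟨u, hu⟩ := h
    exact ⟨u, add_left_cancel (hu.trans (add_assoc x y u))⟩

instance : CanonicallyOrderedAdd (Num M) where
  exists_add_of_le h := h
  le_self_add _ y := ⟨y, rfl⟩
  le_add_self x y := ⟨y, add_comm y x⟩

protected theorem add_one_le_iff {x y : Num M} : x + 1 ≤ y ↔ x < y := by
  constructor
  · refine fun h => lt_of_lt_of_le (lt_of_le_of_ne ⟨1, rfl⟩ fun hx => ?_) h
    exact add_one_ne_zero 0 ((zero_add 1).trans (left_eq_add.1 hx))
  · intro h
    obtain ⟨z, hz⟩ := h.le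
    obtain ⟨w, rfl⟩ : ∃ w, z = w + 1 := exists_eq_add_one fun h0 => by simp [hz, h0] at h
    exact ⟨w, by rw [hz]; ring⟩

noncomputable instance : SuccOrder (Num M) := .ofSuccLeIff (· + 1) Num.add_one_le_iff

noncomputable instance : SuccAddOrder (Num M) := ⟨fun _ => rfl⟩

theorem exists_add_one_of_lt {x y : Num M} (h : x < y) : ∃ z, y = x + z + 1 := by
  obtain ⟨z, hz⟩ := Num.add_one_le_iff.2 h
  exact ⟨z, by rw [hz, add_right_comm]⟩

protected theorem mul_lt_mul_left {x y z : Num M} (hz : 0 < z) (h : x < y) : z * x < z * y := by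
  obtain ⟨u, rfl⟩ := exists_add_one_of_lt h
  obtain ⟨v, rfl⟩ := exists_add_one_of_lt hz
  exact Num.add_one_le_iff.1 ⟨v * u + v + u, by ring⟩

instance : Nontrivial (Num M) := ⟨1, 0, zero_add (1 : Num M) ▸ add_one_ne_zero 0⟩

instance : IsStrictOrderedRing (Num M) where
  zero_le_one := zero_le
  mul_lt_mul_of_pos_left _ hz _ _ h := Num.mul_lt_mul_left hz h
  mul_lt_mul_of_pos_right z hz x y h := by
    simpa only [mul_comm _ z] using Num.mul_lt_mul_left hz h

end Num

end Arithmetic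

/-! ### Subtraction, parity, powers of two and pairing -/

section Functions

variable {M : Str}

/-- Predecessor. -/
def predN (x : Num M) : Num M := M.app (predC.eval .nil) x

/-- Remainder modulo `2`. -/
def parityN (x : Num M) : Num M := M.app (parC.eval .nil) x

/-- Half, rounded down. -/
def halfN (x : Num M) : Num M := M.app (halfC.eval .nil) x

/-- Power of two. -/
def twoPow (x : Num M) : Num M := M.app (powC.eval .nil) x

/-- Triangular number. -/
def triangle (x : Num M) : Num M := M.app (triC.eval .nil) x

/-- Index of the largest triangular number that is at most `x`. -/
def triangleRoot (x : Num M) : Num M := M.app (rootC.eval .nil) x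

/-- Cantor pairing. -/
def cantorPair (x y : Num M) : Num M := M.app (M.app (pairC.eval .nil) x) y

/-- First projection of the Cantor pairing. -/
def cantorFst (x : Num M) : Num M := M.app (fstC.eval .nil) x

/-- Second projection of the Cantor pairing. -/
def cantorSnd (x : Num M) : Num M := M.app (sndC.eval .nil) x

@[simp] theorem app_predC (x : Num M) : M.app (predC.eval .nil) x = predN x := rfl

@[simp] theorem app_parC (x : Num M) : M.app (parC.eval .nil) x = parityN x := rfl

@[simp] theorem app_halfC (x : Num M) : M.app (halfC.eval .nil) x = halfN x := rfl

@[simp] theorem app_powC (x : Num M) : M.app (powC.eval .nil) x = twoPow x := rfl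

@[simp] theorem app_triC (x : Num M) : M.app (triC.eval .nil) x = triangle x := rfl

@[simp] theorem app_rootC (x : Num M) : M.app (rootC.eval .nil) x = triangleRoot x := rfl

@[simp] theorem app_pairC (x y : Num M) :
    M.app (M.app (pairC.eval .nil) x) y = cantorPair x y := rfl

@[simp] theorem app_fstC (x : Num M) : M.app (fstC.eval .nil) x = cantorFst x := rfl

@[simp] theorem app_sndC (x : Num M) : M.app (sndC.eval .nil) x = cantorSnd x := rfl

variable [Model M]

@[simp] theorem predN_zero : predN (0 : Num M) = 0 := by
  rw [← app_predC, predC, app_lam, eval_recT]; exact recN_zero _ _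

@[simp] theorem predN_add_one (x : Num M) : predN (x + 1) = x :=
  app_lam_recT_add_one x v0

namespace Num

protected theorem sub_zero (x : Num M) : x - 0 = x := by
  rw [← app_subC, subC, app_lam, app_lam, eval_recT]; exact recN_zero _ _

theorem sub_add_one (x y : Num M) : x - (y + 1) = predN (x - y) := by
  rw [← app_subC, ← app_subC, subC, app_lam, app_lam_recT_add_one y (cl predC ⊙ v1)]
  simp only [Tm.eval_app, Tm.eval_cl, app_predC]
  rfl

theorem add_one_sub_add_one (x y : Num M) : x + 1 - (y + 1) = x - y := by
  induction y using Num.induction with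
  | definable => exact ⟨_, sub (suc v1) (suc v0) ≐ sub v1 v0, x ∷ .nil, fun _ => by simp⟩
  | zero => rw [sub_add_one, Num.sub_zero, Num.sub_zero, predN_add_one]
  | succ y ih => rw [sub_add_one, ih, sub_add_one]

protected theorem add_sub_cancel_right (x y : Num M) : x + y - y = x := by
  induction y using Num.induction with
  | definable => exact ⟨_, sub (add v1 v0) v0 ≐ v1, x ∷ .nil, fun _ => by simp⟩
  | zero => rw [add_zero, Num.sub_zero]
  | succ y ih => rw [← add_assoc, add_one_sub_add_one, ih]

protected theorem zero_sub (x : Num M) : 0 - x = 0 := by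
  induction x using Num.induction with
  | definable => exact ⟨_, sub zero v0 ≐ zero, .nil, fun _ => by simp⟩
  | zero => exact Num.sub_zero 0
  | succ x ih => rw [sub_add_one, ih, predN_zero]

theorem sub_add_self (x y : Num M) : x - (x + y) = 0 := by
  induction x using Num.induction with
  | definable => exact ⟨_, sub v0 (add v0 v1) ≐ zero, y ∷ .nil, fun _ => by simp⟩
  | zero => exact Num.zero_sub _
  | succ x ih => rw [add_right_comm, add_one_sub_add_one, ih]

instance : OrderedSub (Num M) where
  tsub_le_iff_right a b c := by
    rcases le_total a b with h | h <;> obtain ⟨z, rfl⟩ := h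
    · rw [sub_add_self]
      exact iff_of_true zero_le ⟨c + z, by ring⟩
    · rw [add_comm b z, Num.add_sub_cancel_right]
      exact (add_le_add_iff_right b).symm

theorem one_sub_eq_zero_iff {x : Num M} : 1 - x = 0 ↔ x ≠ 0 := by
  rw [tsub_eq_zero_iff_le, Order.one_le_iff_pos, pos_iff_ne_zero]

end Num

open Classical in
@[simp] theorem recN_cond {Γ : Ctx} (c a : Num M) (b : Tm Γ nat) (e : Env M Γ) :
    recN c a ((lam (lam b.wk.wk)).eval e) = if c = 0 then a else b.eval e := by
  split_ifs with hc
  · rw [hc, recN_zero]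
  · obtain ⟨m, rfl⟩ := Num.exists_eq_add_one hc
    rw [recN_add_one, app_lam, app_lam, Tm.eval_wk, Tm.eval_wk]

theorem parityN_zero : parityN (0 : Num M) = 0 := by
  rw [← app_parC, parC, app_lam, eval_recT]; exact recN_zero _ _

theorem parityN_add_one (x : Num M) : parityN (x + 1) = 1 - parityN x := by
  rw [← app_parC, ← app_parC, parC, app_lam_recT_add_one x (sub (suc zero) v1)]
  simp only [Tm.eval_app, Tm.eval_cl, Num.app_subC]
  rfl

theorem halfN_zero : halfN (0 : Num M) = 0 := by
  rw [← app_halfC, halfC, app_lam, eval_recT]; exact recN_zero _ _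

theorem halfN_add_one (x : Num M) : halfN (x + 1) = halfN x + parityN x := by
  rw [← app_halfC, ← app_halfC, halfC, app_lam_recT_add_one x (add v1 (cl parC ⊙ v0))]
  simp only [Tm.eval_app, Tm.eval_cl, app_parC, Num.app_addC]
  rfl

theorem twoPow_zero : twoPow (0 : Num M) = 1 := by
  rw [← app_powC, powC, app_lam, eval_recT]; exact recN_zero _ _

theorem twoPow_add_one (x : Num M) : twoPow (x + 1) = 2 * twoPow x := by
  rw [← app_powC, ← app_powC, powC, app_lam_recT_add_one x (add v1 v1), two_mul]
  simp only [Tm.eval_app, Tm.eval_cl, Num.app_addC]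
  rfl

theorem triangle_zero : triangle (0 : Num M) = 0 := by
  rw [← app_triC, triC, app_lam, eval_recT]; exact recN_zero _ _

theorem triangle_add_one (x : Num M) : triangle (x + 1) = triangle x + (x + 1) := by
  rw [← app_triC, ← app_triC, triC, app_lam_recT_add_one x (add v1 (suc v0))]
  simp only [Tm.eval_app, Tm.eval_cl, Num.app_addC, Tm.eval_const, Num.app_succ]
  rfl

theorem triangleRoot_zero : triangleRoot (0 : Num M) = 0 := by
  rw [← app_rootC, rootC, app_lam, eval_recT]; exact recN_zero _ _

open Classical in
theorem triangleRoot_add_one (x : Num M) : triangleRoot (x + 1) =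
    if triangle (triangleRoot x + 1) ≤ x + 1 then triangleRoot x + 1 else triangleRoot x := by
  rw [← app_rootC, ← app_rootC, rootC,
    app_lam_recT_add_one x (cond (sub (cl triC ⊙ suc v1) (suc v0)) (suc v1) v1)]
  generalize M.app _ x = r
  simp [tsub_eq_zero_iff_le]

theorem parityN_double_and_halfN_double (x : Num M) : parityN (2 * x) = 0 ∧ halfN (2 * x) = x := by
  induction x using Num.induction with
  | definable =>
    exact ⟨_, cl parC ⊙ mul (suc (suc zero)) v0 ≐ zero ⋏'
      cl halfC ⊙ mul (suc (suc zero)) v0 ≐ v0, .nil, fun _ => by simp [one_add_one_eq_two]⟩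
  | zero => rw [mul_zero]; exact ⟨parityN_zero, halfN_zero⟩
  | succ x ih =>
    rw [show (2 : Num M) * (x + 1) = 2 * x + 1 + 1 by ring, parityN_add_one, parityN_add_one,
      halfN_add_one, halfN_add_one, parityN_add_one, ih.1, ih.2, tsub_zero, tsub_self, add_zero]
    exact ⟨rfl, rfl⟩

@[simp] theorem parityN_double (x : Num M) : parityN (2 * x) = 0 :=
  (parityN_double_and_halfN_double x).1

@[simp] theorem halfN_double (x : Num M) : halfN (2 * x) = x :=
  (parityN_double_and_halfN_double x).2

@[simp] theorem parityN_double_add_one (x : Num M) : parityN (2 * x + 1) = 1 := by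
  rw [parityN_add_one, parityN_double, tsub_zero]

theorem twoPow_pos (x : Num M) : 0 < twoPow x := by
  induction x using Num.induction with
  | definable =>
    exact ⟨_, not (cl powC ⊙ v0 ≐ zero), .nil, fun _ => by simp [pos_iff_ne_zero]⟩
  | zero => rw [twoPow_zero]; exact one_pos
  | succ x ih => rw [twoPow_add_one]; positivity

theorem cantorPair_eq (x y : Num M) : cantorPair x y = triangle (x + y) + x := by
  rw [← app_pairC, pairC]; simp

theorem cantorFst_eq (x : Num M) : cantorFst x = x - triangle (triangleRoot x) := by
  rw [← app_fstC, fstC]; simp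

theorem cantorSnd_eq (x : Num M) : cantorSnd x = triangleRoot x - cantorFst x := by
  rw [← app_sndC, sndC]; simp

theorem triangle_mono : Monotone (triangle (M := M)) := by
  intro x y h
  obtain ⟨z, rfl⟩ := h
  induction z using Num.induction with
  | definable =>
    exact ⟨_, le0 (cl triC ⊙ v1) (cl triC ⊙ add v1 v0), x ∷ .nil,
      fun _ => by simp [tsub_eq_zero_iff_le]⟩
  | zero => rw [add_zero]
  | succ z ih => rw [← add_assoc, triangle_add_one]; exact ih.trans ⟨_, rfl⟩

theorem triangleRoot_spec (x : Num M) :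
    triangle (triangleRoot x) ≤ x ∧ x < triangle (triangleRoot x + 1) := by
  induction x using Num.induction with
  | definable =>
    exact ⟨_, le0 (cl triC ⊙ (cl rootC ⊙ v0)) v0 ⋏' le0 (suc v0) (cl triC ⊙ suc (cl rootC ⊙ v0)),
      .nil, fun _ => by simp [tsub_eq_zero_iff_le, Order.add_one_le_iff]⟩
  | zero =>
    rw [triangleRoot_zero, triangle_add_one, triangle_zero, zero_add, zero_add]
    exact ⟨le_rfl, one_pos⟩
  | succ x ih =>
    rw [triangleRoot_add_one]
    split_ifs with hc
    · refine ⟨hc, ?_⟩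
      rw [triangle_add_one]
      exact add_lt_add_of_lt_of_le ih.2 ⟨triangleRoot x + 1, by ring⟩
    · exact ⟨ih.1.trans ⟨1, rfl⟩, not_le.1 hc⟩

theorem triangleRoot_eq {x r : Num M} (h : triangle r ≤ x) (h' : x < triangle (r + 1)) :
    triangleRoot x = r := by
  obtain ⟨k, k'⟩ := triangleRoot_spec x
  refine le_antisymm ?_ ?_ <;> rw [← Order.lt_add_one_iff]
  · exact triangle_mono.reflect_lt (k.trans_lt h')
  · exact triangle_mono.reflect_lt (h.trans_lt k')

theorem triangleRoot_cantorPair (x y : Num M) : triangleRoot (cantorPair x y) = x + y := by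
  rw [cantorPair_eq]
  refine triangleRoot_eq ⟨_, rfl⟩ ?_
  rw [triangle_add_one, add_lt_add_iff_left, Order.lt_add_one_iff]
  exact ⟨y, rfl⟩

@[simp] theorem cantorFst_cantorPair (x y : Num M) : cantorFst (cantorPair x y) = x := by
  rw [cantorFst_eq, triangleRoot_cantorPair, cantorPair_eq, add_tsub_cancel_left]

@[simp] theorem cantorSnd_cantorPair (x y : Num M) : cantorSnd (cantorPair x y) = y := by
  rw [cantorSnd_eq, cantorFst_cantorPair, triangleRoot_cantorPair, add_tsub_cancel_left]

end Functions

/-! ### The ordered field of fractions of an ordered semiring -/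

section OrderedField

open TensorProduct

section Differences

variable {R : Type*} [CommSemiring R]

theorem one_tmul_injective [IsCancelAdd R] :
    Function.Injective fun a : R => (1 : ℤ) ⊗ₜ[ℕ] a := by
  let f : ℤ ⊗[ℕ] R →ₗ[ℕ] Algebra.GrothendieckAddGroup R :=
    TensorProduct.lift <| LinearMap.mk₂ ℕ (fun n a => n • Algebra.GrothendieckAddGroup.of a)
      (fun _ _ _ => add_smul ..) (fun _ _ _ => smul_assoc ..)
      (fun _ _ _ => by rw [map_add, smul_add])
      (fun _ _ _ => by rw [map_nsmul, smul_comm])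
  intro a b h
  apply Algebra.GrothendieckAddGroup.of_injective
  have f_one_tmul (a : R) : f (1 ⊗ₜ a) = Algebra.GrothendieckAddGroup.of a :=
    (TensorProduct.lift.tmul ..).trans (one_smul ..)
  rw [← f_one_tmul, ← f_one_tmul]
  exact congrArg f h

variable [LinearOrder R] [CanonicallyOrderedAdd R]

theorem eq_one_tmul_or_eq_neg_one_tmul (x : ℤ ⊗[ℕ] R) :
    ∃ a : R, x = (1 : ℤ) ⊗ₜ a ∨ x = -((1 : ℤ) ⊗ₜ a) := by
  have sub_tmul (a b : R) : ∃ c : R,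
      (1 : ℤ) ⊗ₜ[ℕ] a - (1 : ℤ) ⊗ₜ b = (1 : ℤ) ⊗ₜ c ∨
        (1 : ℤ) ⊗ₜ[ℕ] a - (1 : ℤ) ⊗ₜ b = -((1 : ℤ) ⊗ₜ c) := by
    rcases le_total a b with h | h <;> obtain ⟨c, rfl⟩ := exists_add_of_le h
    · exact ⟨c, .inr (by rw [tmul_add]; abel)⟩
    · exact ⟨c, .inl (by rw [tmul_add]; abel)⟩
  induction x with
  | zero => exact ⟨0, .inl (tmul_zero ..).symm⟩
  | tmul n a =>
    obtain ⟨k, rfl | rfl⟩ := n.eq_nat_or_neg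
    · exact ⟨k • a, .inl (by rw [← smul_tmul, nsmul_one])⟩
    · exact ⟨k • a, .inr (by rw [← smul_tmul, nsmul_one, neg_tmul])⟩
  | add x y hx hy =>
    obtain ⟨a, rfl | rfl⟩ := hx <;> obtain ⟨b, rfl | rfl⟩ := hy
    · exact ⟨a + b, .inl (tmul_add ..).symm⟩
    · rw [← sub_eq_add_neg]; exact sub_tmul a b
    · rw [neg_add_eq_sub]; exact sub_tmul b a
    · exact ⟨a + b, .inr (by rw [tmul_add, neg_add])⟩

end Differences

variable (R : Type*) [CommSemiring R] [LinearOrder R] [IsStrictOrderedRing R]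
  [CanonicallyOrderedAdd R]

instance : IsDomain (ℤ ⊗[ℕ] R) := by
  have : Nontrivial (ℤ ⊗[ℕ] R) := (one_tmul_injective (R := R)).nontrivial
  have one_tmul_eq_zero {a : R} : (1 : ℤ) ⊗ₜ[ℕ] a = 0 ↔ a = 0 := by
    rw [← tmul_zero R (1 : ℤ), one_tmul_injective.eq_iff]
  have : NoZeroDivisors (ℤ ⊗[ℕ] R) := ⟨fun {x y} h => by
    obtain ⟨a, ha⟩ := eq_one_tmul_or_eq_neg_one_tmul x
    obtain ⟨b, hb⟩ := eq_one_tmul_or_eq_neg_one_tmul y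
    have hab : a * b = 0 := by
      rw [← one_tmul_eq_zero]
      rcases ha with rfl | rfl <;> rcases hb with rfl | rfl <;>
        simp only [← neg_tmul, Algebra.TensorProduct.tmul_mul_tmul, neg_mul_neg, one_mul,
          mul_one] at h <;>
        simpa only [neg_tmul, neg_eq_zero] using h
    rcases mul_eq_zero.1 hab with rfl | rfl
    · left; simpa using ha
    · right; simpa using hb⟩
  exact NoZeroDivisors.to_isDomain _

/-- The field of fractions of the ring of differences `ℤ ⊗[ℕ] R` of an ordered semiring. -/
def FracField : Type _ := FractionRing (ℤ ⊗[ℕ] R)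

noncomputable instance : Field (FracField R) := inferInstanceAs (Field (FractionRing (ℤ ⊗[ℕ] R)))

noncomputable instance : Algebra (ℤ ⊗[ℕ] R) (FracField R) :=
  inferInstanceAs (Algebra (ℤ ⊗[ℕ] R) (FractionRing (ℤ ⊗[ℕ] R)))

instance : IsFractionRing (ℤ ⊗[ℕ] R) (FracField R) :=
  inferInstanceAs (IsFractionRing (ℤ ⊗[ℕ] R) (FractionRing (ℤ ⊗[ℕ] R)))

namespace FracField

variable {R}

/-- The embedding of the semiring. -/
noncomputable def of : R →+* FracField R :=
  (algebraMap (ℤ ⊗[ℕ] R) (FracField R)).comp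
    (Algebra.TensorProduct.includeRight (R := ℕ) (A := ℤ)).toRingHom

theorem algebraMap_one_tmul (a : R) : algebraMap (ℤ ⊗[ℕ] R) (FracField R) (1 ⊗ₜ a) = of a := rfl

theorem of_injective : Function.Injective (of (R := R)) :=
  (IsFractionRing.injective (ℤ ⊗[ℕ] R) (FracField R)).comp one_tmul_injective

theorem of_eq_zero {a : R} : of a = 0 ↔ a = 0 := map_eq_zero_iff of of_injective

theorem exists_mul_of (x : FracField R) :
    ∃ a b : R, b ≠ 0 ∧ (x * of b = of a ∨ -x * of b = of a) := by
  obtain ⟨p, q, hq, rfl⟩ := IsFractionRing.div_surjective (A := ℤ ⊗[ℕ] R) x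
  obtain ⟨a, ha⟩ := eq_one_tmul_or_eq_neg_one_tmul p
  obtain ⟨b, hb⟩ := eq_one_tmul_or_eq_neg_one_tmul q
  have hb0 : b ≠ 0 := by
    rintro rfl
    exact nonZeroDivisors.ne_zero hq (by simpa using hb)
  have hb' : of b ≠ 0 := of_eq_zero.not.2 hb0
  have div_mul : of a / of b * of b = of a := div_mul_cancel₀ _ hb'
  refine ⟨a, b, hb0, ?_⟩
  rcases ha with rfl | rfl <;> rcases hb with rfl | rfl <;>
    simp only [map_neg, algebraMap_one_tmul, div_neg, neg_div, neg_neg, div_mul,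
      true_or, or_true]

variable (R) in
/-- The nonnegative elements. -/
def cone : RingCone (FracField R) where
  carrier := {x | ∃ a b : R, b ≠ 0 ∧ x * of b = of a}
  zero_mem' := ⟨0, 1, one_ne_zero, by rw [zero_mul, map_zero]⟩
  one_mem' := ⟨1, 1, one_ne_zero, one_mul _⟩
  add_mem' := by
    rintro x y ⟨a, b, hb, h⟩ ⟨c, d, hd, k⟩
    refine ⟨a * d + c * b, b * d, mul_ne_zero hb hd, ?_⟩
    simp only [map_add, map_mul, ← h, ← k]; ring
  mul_mem' := by
    rintro x y ⟨a, b, hb, h⟩ ⟨c, d, hd, k⟩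
    refine ⟨a * c, b * d, mul_ne_zero hb hd, ?_⟩
    simp only [map_mul, ← h, ← k]; ring
  eq_zero_of_mem_of_neg_mem' := by
    rintro x ⟨a, b, hb, h⟩ ⟨c, d, hd, k⟩
    have e : of (a * d + c * b) = 0 := by
      simp only [map_add, map_mul, ← h, ← k]; ring
    rw [of_eq_zero, add_eq_zero, mul_eq_zero_iff_right hd] at e
    rw [e.1, map_zero, mul_eq_zero, of_eq_zero] at h
    exact h.resolve_right hb

instance : HasMemOrNegMem (cone R) where
  mem_or_neg_mem x := by
    obtain ⟨a, b, hb, h | h⟩ := exists_mul_of x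
    · exact .inl ⟨a, b, hb, h⟩
    · exact .inr ⟨a, b, hb, h⟩

open Classical in
noncomputable instance : LinearOrder (FracField R) := .mkOfAddGroupCone (cone R)

instance : IsStrictOrderedRing (FracField R) :=
  have : IsOrderedRing (FracField R) := .mkOfCone (cone R)
  IsOrderedRing.toIsStrictOrderedRing _

theorem of_strictMono : StrictMono (of (R := R)) := by
  refine Monotone.strictMono_of_injective (fun a b h => ?_) of_injective
  obtain ⟨c, rfl⟩ := exists_add_of_le h
  rw [map_add, le_add_iff_nonneg_right]
  change of c - 0 ∈ cone R
  exact ⟨c, 1, one_ne_zero, by rw [sub_zero, map_one, mul_one]⟩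

end FracField

end OrderedField

open Filter

/-! ### Coded rationals -/

section CodedRationals

open FracField (of)

variable {M : Str}

/-- Positive part of the numerator of a coded rational. -/
def posN (x : Num M) : Num M := M.app (posC.eval .nil) x

/-- Negative part of the numerator of a coded rational. -/
def negN (x : Num M) : Num M := M.app (negC.eval .nil) x

/-- Denominator of a coded rational. -/
def denN (x : Num M) : Num M := M.app (denC.eval .nil) x

/-- The code of `(p - m) / d`. -/
def mkQN (p m d : Num M) : Num M := M.app (M.app (M.app (mkQC.eval .nil) p) m) d

@[simp] theorem app_posC (x : Num M) : M.app (posC.eval .nil) x = posN x := rfl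

@[simp] theorem app_negC (x : Num M) : M.app (negC.eval .nil) x = negN x := rfl

@[simp] theorem app_denC (x : Num M) : M.app (denC.eval .nil) x = denN x := rfl

@[simp] theorem app_mkQC (p m d : Num M) :
    M.app (M.app (M.app (mkQC.eval .nil) p) m) d = mkQN p m d := rfl

variable [Model M]

theorem posN_eq (x : Num M) : posN x = halfN (cantorFst x) * (1 - parityN (cantorFst x)) := by
  rw [← app_posC, posC]; simp

theorem negN_eq (x : Num M) : negN x = halfN (cantorFst x + 1) * parityN (cantorFst x) := by
  rw [← app_negC, negC]; simp

theorem denN_eq (x : Num M) : denN x = cantorSnd x + 1 := by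
  rw [← app_denC, denC]; simp

theorem denN_ne_zero (x : Num M) : denN x ≠ 0 := by
  rw [denN_eq]; exact Num.add_one_ne_zero _

theorem posN_eq_zero_or_negN_eq_zero (x : Num M) : posN x = 0 ∨ negN x = 0 := by
  rw [posN_eq, negN_eq]
  by_cases h : parityN (cantorFst x) = 0
  · right; rw [h, mul_zero]
  · left; rw [Num.one_sub_eq_zero_iff.2 h, mul_zero]

theorem mkQN_eq (p m d : Num M) :
    mkQN p m d = cantorPair (2 * (p - m) + predN (2 * (m - p))) (predN d) := by
  rw [← app_mkQC, mkQC]; simp [one_add_one_eq_two]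

theorem denN_mkQN (p m : Num M) {d : Num M} (hd : d ≠ 0) : denN (mkQN p m d) = d := by
  obtain ⟨d, rfl⟩ := Num.exists_eq_add_one hd
  rw [denN_eq, mkQN_eq, cantorSnd_cantorPair, predN_add_one]

theorem posN_mkQN_and_negN_mkQN (p m d : Num M) :
    posN (mkQN p m d) = p - m ∧ negN (mkQN p m d) = m - p := by
  rw [posN_eq, negN_eq, mkQN_eq, cantorFst_cantorPair]
  rcases le_or_gt m p with h | h
  · rw [tsub_eq_zero_of_le h, mul_zero, predN_zero, add_zero, parityN_double, halfN_double,
      tsub_zero, mul_one, mul_zero]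
    exact ⟨rfl, rfl⟩
  · obtain ⟨z, rfl⟩ := Num.exists_add_one_of_lt h
    have double_add_one : (2 : Num M) * (z + 1) = 2 * z + 1 + 1 := by ring
    rw [tsub_eq_zero_of_le h.le, add_assoc, add_tsub_cancel_left, double_add_one, predN_add_one,
      mul_zero, zero_add, parityN_double_add_one, ← double_add_one, halfN_double, tsub_self,
      mul_zero, mul_one]
    exact ⟨rfl, rfl⟩

/-- The ordered field of rational numbers of a model. -/
abbrev Rational (M : Str) [Model M] : Type := FracField (Num M)

theorem FracField.of_pos {x : Num M} (hx : x ≠ 0) : 0 < of x := by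
  rw [← map_zero of]; exact of_strictMono (pos_iff_ne_zero.2 hx)

theorem FracField.of_nonneg (x : Num M) : 0 ≤ of x := by
  rw [← map_zero of]; exact of_strictMono.monotone zero_le

theorem FracField.of_tsub_sub_of_tsub (x y : Num M) : of (x - y) - of (y - x) = of x - of y := by
  rcases le_total x y with h | h <;> obtain ⟨z, rfl⟩ := h <;>
    rw [add_tsub_cancel_left, tsub_eq_zero_of_le (self_le_add_right _ _), map_add, map_zero] <;>
    ring

/-- The rational number with a given code. -/
noncomputable def ratVal (x : Num M) : Rational M := (of (posN x) - of (negN x)) / of (denN x)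

theorem ratVal_mkQN (p m : Num M) {d : Num M} (hd : d ≠ 0) :
    ratVal (mkQN p m d) = (of p - of m) / of d := by
  rw [ratVal, denN_mkQN p m hd, (posN_mkQN_and_negN_mkQN p m d).1,
    (posN_mkQN_and_negN_mkQN p m d).2, FracField.of_tsub_sub_of_tsub]

@[simp] theorem ratVal_app_qaddC (x y : Num M) :
    ratVal (M.app (M.app (qaddC.eval .nil) x) y) = ratVal x + ratVal y := by
  have hx := (FracField.of_pos (denN_ne_zero x)).ne'
  have hy := (FracField.of_pos (denN_ne_zero y)).ne'
  simp only [qaddC, app_lam, eval_app, eval_cl, eval_var, Env.cons_zero, Env.cons_succ, app_mkQC,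
    Num.app_addC, Num.app_mulC, app_posC, app_negC, app_denC]
  rw [ratVal_mkQN _ _ (mul_ne_zero (denN_ne_zero x) (denN_ne_zero y)), ratVal, ratVal]
  simp only [map_add, map_mul]
  field_simp
  ring

@[simp] theorem ratVal_app_qsubC (x y : Num M) :
    ratVal (M.app (M.app (qsubC.eval .nil) x) y) = ratVal x - ratVal y := by
  simp only [qsubC, app_lam, eval_app, eval_cl, eval_var, Env.cons_zero, Env.cons_succ, app_mkQC,
    app_posC, app_negC, app_denC]
  rw [ratVal_app_qaddC, ratVal_mkQN _ _ (denN_ne_zero y), ratVal, ratVal]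
  ring

@[simp] theorem ratVal_app_qabsC (x : Num M) :
    ratVal (M.app (qabsC.eval .nil) x) = |ratVal x| := by
  simp only [qabsC, app_lam, eval_app, eval_cl, eval_var, Env.cons_zero, app_mkQC,
    Num.app_addC, app_posC, app_negC, app_denC, eval_const, Num.cst_zero]
  rw [ratVal_mkQN _ _ (denN_ne_zero x), ratVal, map_add, map_zero, sub_zero, abs_div,
    abs_of_pos (FracField.of_pos (denN_ne_zero x))]
  congr 1
  rcases posN_eq_zero_or_negN_eq_zero x with h | h <;> rw [h, map_zero]
  · rw [zero_sub, zero_add, abs_neg, abs_of_nonneg (FracField.of_nonneg _)]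
  · rw [sub_zero, add_zero, abs_of_nonneg (FracField.of_nonneg _)]

@[simp] theorem app_qleC_eq_zero_iff {x y : Num M} :
    M.app (M.app (qleC.eval .nil) x) y = 0 ↔ ratVal x ≤ ratVal y := by
  simp only [qleC, app_lam, eval_app, eval_cl, eval_var, Env.cons_zero, Env.cons_succ,
    Num.app_subC, Num.app_addC, Num.app_mulC, app_posC, app_negC, app_denC]
  rw [tsub_eq_zero_iff_le, ← FracField.of_strictMono.le_iff_le, ratVal, ratVal,
    div_le_div_iff₀ (FracField.of_pos (denN_ne_zero x)) (FracField.of_pos (denN_ne_zero y))]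
  simp only [map_add, map_mul]
  constructor <;> intro h <;> linarith

@[simp] theorem app_qltC_eq_zero_iff {x y : Num M} :
    M.app (M.app (qltC.eval .nil) x) y = 0 ↔ ratVal x < ratVal y := by
  simp only [qltC, app_lam, eval_app, eval_cl, eval_var, Env.cons_zero, Env.cons_succ,
    Num.app_subC, eval_const, Num.cst_zero, Num.app_succ, zero_add]
  rw [Num.one_sub_eq_zero_iff, Ne, app_qleC_eq_zero_iff, not_le]

/-- The rational number `2 ^ (-n)`. -/
noncomputable def eps (n : Num M) : Rational M := 1 / of (twoPow n)

theorem eps_pos (n : Num M) : 0 < eps n := one_div_pos.2 (FracField.of_pos (twoPow_pos n).ne')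

theorem of_twoPow_mul_eps (n : Num M) : of (twoPow n) * eps n = 1 :=
  mul_one_div_cancel (FracField.of_pos (twoPow_pos n).ne').ne'

theorem eps_add_one (n : Num M) : eps (n + 1) = eps n / 2 := by
  rw [eps, eps, twoPow_add_one, map_mul, map_ofNat, one_div, one_div, mul_inv]; ring

@[simp] theorem ratVal_app_qpowC (n : Num M) : ratVal (M.app (qpowC.eval .nil) n) = eps n := by
  simp only [qpowC, app_lam, eval_app, eval_cl, eval_var, Env.cons_zero, app_mkQC, app_powC,
    eval_const, Num.cst_zero, Num.app_succ, zero_add]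
  rw [ratVal_mkQN _ _ (twoPow_pos n).ne', map_one, map_zero, sub_zero, eps]

theorem eps_antitone : Antitone (eps (M := M)) := by
  intro m n h
  obtain ⟨z, rfl⟩ := h
  induction z using Num.induction with
  | definable => exact ⟨_, leQ (qpow (add v1 v0)) (qpow v1), m ∷ .nil, fun _ => by simp⟩
  | zero => rw [add_zero]
  | succ z ih => rw [← add_assoc, eps_add_one]; linarith [eps_pos (m + z)]

theorem lt_twoPow (n : Num M) : n < twoPow n := by
  rw [← Order.add_one_le_iff]
  induction n using Num.induction with
  | definable =>
    exact ⟨_, le0 (suc v0) (cl powC ⊙ v0), .nil, fun _ => by simp [tsub_eq_zero_iff_le]⟩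
  | zero => rw [twoPow_zero, zero_add]
  | succ n ih =>
    rw [twoPow_add_one, two_mul]
    exact add_le_add ih (Order.one_le_iff_pos.2 (twoPow_pos n))

theorem exists_eps_lt {x : Rational M} (hx : 0 < x) : ∃ n, eps n < x := by
  obtain ⟨a, b, hb, h⟩ := FracField.exists_mul_of x
  have of_b_pos := FracField.of_pos hb
  have x_mul_b : x * of b = of a := h.resolve_right fun h => by
    nlinarith [mul_pos hx of_b_pos, FracField.of_nonneg a]
  have one_le_of_a : 1 ≤ of a := by
    rw [← map_one of, FracField.of_strictMono.le_iff_le, Order.one_le_iff_pos, pos_iff_ne_zero,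
      Ne, ← FracField.of_eq_zero, ← x_mul_b]
    exact (mul_pos hx of_b_pos).ne'
  refine ⟨b, ?_⟩
  rw [eps, div_lt_iff₀ (FracField.of_pos (twoPow_pos b).ne')]
  calc 1 ≤ x * of b := x_mul_b ▸ one_le_of_a
    _ < x * of (twoPow b) := mul_lt_mul_of_pos_left (FracField.of_strictMono (lt_twoPow b)) hx

theorem eventually_eps_lt {x : Rational M} (hx : 0 < x) : ∀ᶠ n in atTop, eps n < x := by
  obtain ⟨n, hn⟩ := exists_eps_lt hx
  filter_upwards [eventually_ge_atTop n] with m hm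
  exact (eps_antitone hm).trans_lt hn

end CodedRationals

/-! ### Real numbers -/

section LimitValue

variable {ι : Type*} (l : Filter ι) (K : Type*) [Field K] [LinearOrder K] [IsStrictOrderedRing K]

/-- The functions that are nonnegative along `l` up to arbitrarily small errors. -/
def asympNonneg : AddSubmonoid (ι → K) where
  carrier := {u | ∀ ε > 0, ∀ᶠ i in l, -ε ≤ u i}
  zero_mem' _ hε := .of_forall fun _ => neg_nonpos.2 (le_of_lt hε)
  add_mem' := by
    intro u v hu hv ε hε
    filter_upwards [hu (ε / 2) (half_pos hε), hv (ε / 2) (half_pos hε)] with i hui hvi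
    rw [Pi.add_apply]
    linarith

variable {l K} in
theorem mem_asympNonneg {u : ι → K} : u ∈ asympNonneg l K ↔ ∀ ε > 0, ∀ᶠ i in l, -ε ≤ u i :=
  Iff.rfl

/-- The ordered group of functions to `K` modulo those that tend to `0` along `l`: the class of a
function stands for its limit, which need not exist in `K`. -/
def LimitValue : Type _ := (ι → K) ⧸ (asympNonneg l K).support

namespace LimitValue

instance : AddCommGroup (LimitValue l K) :=
  inferInstanceAs (AddCommGroup ((ι → K) ⧸ (asympNonneg l K).support))

variable {K} in
/-- The limit of a function. -/
def lim : (ι → K) →+ LimitValue l K := QuotientAddGroup.mk' (asympNonneg l K).support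

variable {l K}

theorem lim_eq_zero_iff {u : ι → K} :
    lim l u = 0 ↔ u ∈ asympNonneg l K ∧ -u ∈ asympNonneg l K :=
  (QuotientAddGroup.eq_zero_iff u).trans AddSubmonoid.mem_support

variable (l K) in
/-- The nonnegative limits. -/
def cone : AddGroupCone (LimitValue l K) where
  __ := (asympNonneg l K).map (lim l)
  eq_zero_of_mem_of_neg_mem' := by
    rintro _ ⟨u, hu, rfl⟩ ⟨v, hv, hvu⟩
    have huv : lim l (u + v) = 0 := by rw [map_add, hvu, add_neg_cancel]
    refine lim_eq_zero_iff.2 ⟨hu, ?_⟩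
    have := add_mem hv (lim_eq_zero_iff.1 huv).2
    rwa [neg_add, ← sub_eq_add_neg, add_sub_cancel] at this

instance : PartialOrder (LimitValue l K) := .mkOfAddGroupCone (cone l K)

instance : IsOrderedAddMonoid (LimitValue l K) := .mkOfCone (cone l K)

theorem lim_le_lim_iff {u v : ι → K} :
    lim l u ≤ lim l v ↔ ∀ ε > 0, ∀ᶠ i in l, u i ≤ v i + ε := by
  have mem_iff : lim l u ≤ lim l v ↔ v - u ∈ asympNonneg l K := by
    change lim l v - lim l u ∈ (asympNonneg l K).map (lim l) ↔ _
    rw [← map_sub]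
    refine ⟨?_, AddSubmonoid.mem_map_of_mem _⟩
    rintro ⟨w, hw, hwuv⟩
    have := lim_eq_zero_iff.1 (show lim l (v - u - w) = 0 by rw [map_sub, hwuv, sub_self])
    simpa only [sub_add_cancel] using add_mem this.1 hw
  simp only [mem_iff, mem_asympNonneg, Pi.sub_apply, neg_le_sub_iff_le_add]

theorem lim_eq_lim {u v : ι → K} (h : ∀ ε > 0, ∀ᶠ i in l, |u i - v i| ≤ ε) :
    lim l u = lim l v := by
  apply le_antisymm <;> rw [lim_le_lim_iff] <;> intro ε hε <;>
    filter_upwards [h ε hε] with i hi <;> linarith [abs_le.1 hi]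

variable (l) in
/-- The embedding of the field. -/
def ofField : K →+ LimitValue l K := (lim l).comp (Pi.constAddMonoidHom ι K)

theorem ofField_apply (x : K) : ofField l x = lim l fun _ => x := rfl

instance : One (LimitValue l K) := ⟨ofField l 1⟩

theorem ofField_one : ofField l (1 : K) = 1 := rfl

theorem ofField_strictMono [l.NeBot] : StrictMono (ofField (K := K) l) := by
  intro x y h
  rw [lt_iff_le_not_ge, ofField_apply, ofField_apply, lim_le_lim_iff, lim_le_lim_iff]
  refine ⟨fun ε hε => .of_forall fun _ => by linarith, fun hyx => ?_⟩
  obtain ⟨_, hi⟩ := (hyx ((y - x) / 2) (by linarith)).exists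
  linarith

end LimitValue

end LimitValue

section Reals

open LimitValue

variable {M : Str}

/-- The index up to which a sequence of coded rationals is unchanged by its regularization. -/
def hatIdxN (f : M.C real) (n : Num M) : Num M := M.app (M.app (hatIdxC.eval .nil) f) n

@[simp] theorem app_hatIdxC (f : M.C real) (n : Num M) :
    M.app (M.app (hatIdxC.eval .nil) f) n = hatIdxN f n := rfl

variable [Model M]

theorem hatIdxN_zero (f : M.C real) : hatIdxN f 0 = 0 := by
  rw [← app_hatIdxC, hatIdxC]; simp

open Classical in
theorem hatIdxN_add_one (f : M.C real) (n : Num M) : hatIdxN f (n + 1) =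
    if n ≤ hatIdxN f n ∧ |ratVal (M.app f n) - ratVal (M.app f (n + 1))| < eps (n + 1)
      then n + 1 else hatIdxN f n := by
  rw [← app_hatIdxC, ← app_hatIdxC, hatIdxC, app_lam, app_lam_recT_add_one n
    (cond (add (sub v0 v1) (cl qltC ⊙ qabs (qsub (v2 ⊙ v0) (v2 ⊙ suc v0)) ⊙ qpow (suc v0)))
      (suc v0) v1)]
  simp [tsub_eq_zero_iff_le]

theorem hatIdxN_le (f : M.C real) (n : Num M) : hatIdxN f n ≤ n := by
  induction n using Num.induction with
  | definable =>
    exact ⟨_, le0 (cl hatIdxC ⊙ v1 ⊙ v0) v0, f ∷ .nil, fun _ => by simp [tsub_eq_zero_iff_le]⟩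
  | zero => rw [hatIdxN_zero]
  | succ n ih =>
    rw [hatIdxN_add_one]
    split_ifs
    · exact le_rfl
    · exact ih.trans le_self_add

/-- The rational approximations of the real number represented by a sequence. -/
noncomputable def approx (f : M.C real) (n : Num M) : Rational M :=
  ratVal (M.app (M.app (hatC.eval .nil) f) n)

@[simp] theorem ratVal_app_hatC (f : M.C real) (n : Num M) :
    ratVal (M.app (M.app (hatC.eval .nil) f) n) = approx f n := rfl

theorem approx_eq (f : M.C real) (n : Num M) : approx f n = ratVal (M.app f (hatIdxN f n)) := by
  rw [approx, hatC]; simp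

theorem abs_approx_sub_approx_add_one_lt (f : M.C real) (n : Num M) :
    |approx f n - approx f (n + 1)| < eps (n + 1) := by
  rw [approx_eq, approx_eq, hatIdxN_add_one]
  split_ifs with h
  · rw [(hatIdxN_le f n).antisymm h.1]
    exact h.2
  · rw [sub_self, abs_zero]
    exact eps_pos _

theorem approx_eq_of_forall_lt {f : M.C real}
    (hf : ∀ n, |ratVal (M.app f n) - ratVal (M.app f (n + 1))| < eps (n + 1)) (n : Num M) :
    approx f n = ratVal (M.app f n) := by
  have hatIdx_eq : hatIdxN f n = n := by
    induction n using Num.induction with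
    | definable => exact ⟨_, cl hatIdxC ⊙ v1 ⊙ v0 ≐ v0, f ∷ .nil, fun _ => by simp⟩
    | zero => exact hatIdxN_zero f
    | succ n ih => rw [hatIdxN_add_one, if_pos ⟨ih.ge, hf n⟩]
  rw [approx_eq, hatIdx_eq]

theorem abs_approx_sub_approx_le (f : M.C real) {n m : Num M} (h : n ≤ m) :
    |approx f n - approx f m| ≤ eps n - eps m := by
  obtain ⟨z, rfl⟩ := h
  induction z using Num.induction with
  | definable =>
    exact ⟨_, leQ (qabs (qsub (hat v2 v1) (hat v2 (add v1 v0))))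
      (qsub (qpow v1) (qpow (add v1 v0))), n ∷ f ∷ .nil, fun _ => by simp⟩
  | zero => rw [add_zero, sub_self, sub_self, abs_zero]
  | succ z ih =>
    have step := abs_approx_sub_approx_add_one_lt f (n + z)
    rw [← add_assoc]
    rw [eps_add_one] at step ⊢
    linarith [abs_sub_le (approx f n) (approx f (n + z)) (approx f (n + z + 1))]

variable (M) in
/-- The ordered group in which the real numbers of a model take their values. -/
abbrev RealValue : Type := LimitValue (atTop : Filter (Num M)) (Rational M)

/-- The value of the real number represented by a sequence. -/
noncomputable def realVal (f : M.C real) : RealValue M := lim atTop (approx f)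

theorem realVal_le_iff {f g : M.C real} :
    realVal f ≤ realVal g ↔ ∀ n, approx f (n + 1) - approx g (n + 1) < eps n := by
  rw [realVal, realVal, lim_le_lim_iff]
  constructor
  · intro h n
    have hf := abs_approx_sub_approx_add_one_lt f (n + 1)
    obtain ⟨m, hm, hnm⟩ := ((h _ (sub_pos.2 hf)).and (eventually_ge_atTop (n + 1 + 1))).exists
    have hfm := abs_le.1 (abs_approx_sub_approx_le f hnm)
    have hgm := abs_le.1 (abs_approx_sub_approx_le g (le_self_add.trans hnm))
    have hf_le := le_abs_self (approx f (n + 1) - approx f (n + 1 + 1))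
    simp only [eps_add_one] at *
    linarith [eps_pos m]
  · intro h ε hε
    obtain ⟨k, hk⟩ := exists_eps_lt hε
    filter_upwards [eventually_ge_atTop (k + 1)] with n hn
    obtain ⟨n, rfl⟩ := Num.exists_eq_add_one (Order.one_le_iff_pos.1 (le_add_self.trans hn)).ne'
    linarith [h n, eps_antitone ((add_le_add_iff_right 1).1 hn)]

theorem realVal_le_total (f g : M.C real) : realVal f ≤ realVal g ∨ realVal g ≤ realVal f := by
  rw [or_iff_not_imp_left, realVal_le_iff]
  intro h
  push Not at h
  obtain ⟨n, hn⟩ := h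
  refine lim_le_lim_iff.2 fun ε hε => ?_
  filter_upwards [eventually_ge_atTop (n + 1)] with m hm
  have hfm := abs_le.1 (abs_approx_sub_approx_le f hm)
  have hgm := abs_le.1 (abs_approx_sub_approx_le g hm)
  rw [eps_add_one] at hfm hgm
  linarith [eps_pos m]

theorem realVal_lt_iff_not_le {f g : M.C real} :
    realVal f < realVal g ↔ ¬ realVal g ≤ realVal f := by
  rw [lt_iff_le_not_ge, and_iff_right_of_imp (realVal_le_total _ _).resolve_right]

@[simp] theorem sat_ltR {Γ : Ctx} {s t : Tm Γ real} {e : Env M Γ} :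
    (ltR s t).sat e ↔ realVal (s.eval e) < realVal (t.eval e) := by
  rw [realVal_lt_iff_not_le, realVal_le_iff]
  simp [ltR]

@[simp] theorem sat_leR {Γ : Ctx} {s t : Tm Γ real} {e : Env M Γ} :
    (leR s t).sat e ↔ realVal (s.eval e) ≤ realVal (t.eval e) := by
  change ¬ (ltR t s).sat e ↔ _
  rw [sat_ltR, realVal_lt_iff_not_le, not_not]

theorem realVal_eq_of_sat_eqR {Γ : Ctx} {s t : Tm Γ real} {e : Env M Γ} (h : (eqR s t).sat e) :
    realVal (s.eval e) = realVal (t.eval e) := by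
  have approx_sub_lt (n : Num M) :
      |approx (s.eval e) (n + 1) - approx (t.eval e) (n + 1)| < eps n := by
    simpa [eqR] using h n
  apply le_antisymm <;> rw [realVal_le_iff] <;> intro n <;> linarith [abs_lt.1 (approx_sub_lt n)]

theorem realVal_eq_lim {f : M.C real} {u : Num M → Rational M}
    (hf : ∀ n, ratVal (M.app f n) = u (n + 1)) (hu : ∀ n, |u n - u (n + 1)| < eps n) :
    realVal f = lim atTop u := by
  have approx_f : approx f = fun n => u (n + 1) := funext fun n => by
    rw [approx_eq_of_forall_lt (fun n => by rw [hf, hf]; exact hu (n + 1)), hf]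
  rw [realVal, approx_f]
  refine lim_eq_lim fun ε hε => ?_
  filter_upwards [eventually_eps_lt hε] with n hn
  rw [abs_sub_comm]
  exact ((hu n).trans hn).le

theorem realVal_eq_ofField {f : M.C real} {x : Rational M} (hf : ∀ n, ratVal (M.app f n) = x) :
    realVal f = ofField atTop x :=
  realVal_eq_lim (u := fun _ => x) hf fun n => by rw [sub_self, abs_zero]; exact eps_pos n

@[simp] theorem realVal_app_raddC (f g : M.C real) :
    realVal (M.app (M.app (raddC.eval .nil) f) g) = realVal f + realVal g := by
  refine (realVal_eq_lim (u := approx f + approx g) (fun n => by simp [raddC])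
    fun n => ?_).trans (map_add ..)
  have hf := abs_lt.1 (abs_approx_sub_approx_add_one_lt f n)
  have hg := abs_lt.1 (abs_approx_sub_approx_add_one_lt g n)
  rw [eps_add_one] at hf hg
  rw [Pi.add_apply, Pi.add_apply, abs_lt]
  constructor <;> linarith

@[simp] theorem realVal_app_rsubC (f g : M.C real) :
    realVal (M.app (M.app (rsubC.eval .nil) f) g) = realVal f - realVal g := by
  refine (realVal_eq_lim (u := approx f - approx g) (fun n => by simp [rsubC])
    fun n => ?_).trans (map_sub ..)
  have hf := abs_lt.1 (abs_approx_sub_approx_add_one_lt f n)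
  have hg := abs_lt.1 (abs_approx_sub_approx_add_one_lt g n)
  rw [eps_add_one] at hf hg
  rw [Pi.sub_apply, Pi.sub_apply, abs_lt]
  constructor <;> linarith

@[simp] theorem realVal_rzeroC : realVal (rzeroC.eval (.nil : Env M [])) = 0 :=
  (realVal_eq_ofField fun n => by simp [rzeroC, ratVal_mkQN]).trans (map_zero _)

@[simp] theorem realVal_roneC : realVal (roneC.eval (.nil : Env M [])) = 1 :=
  (realVal_eq_ofField fun n => by simp [roneC, ratVal_mkQN]).trans ofField_one

@[simp] theorem realVal_app_rpowC (k : Num M) :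
    realVal (M.app (rpowC.eval .nil) k) = ofField atTop (eps k) :=
  realVal_eq_ofField fun n => by simp [rpowC]

theorem app_rsumC_zero (F : M.C (nat ⇒ₜ real)) :
    M.app (M.app (rsumC.eval .nil) F) 0 = M.app F 0 := by
  rw [rsumC]; simp

theorem realVal_app_rsumC_add_one (F : M.C (nat ⇒ₜ real)) (l : Num M) :
    realVal (M.app (M.app (rsumC.eval .nil) F) (l + 1)) =
      realVal (M.app (M.app (rsumC.eval .nil) F) l) + realVal (M.app F (l + 1)) := by
  rw [rsumC, app_lam, app_lam_recT_add_one l (radd v1 (v2 ⊙ suc v0))]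
  simp

end Reals

open FracField LimitValue

/-! ### Events -/

section Substitution

variable {Γ Δ : Ctx}

theorem ltR_subst (s t : Tm Γ real) (σ : Sub Γ Δ) :
    (ltR s t).subst σ = ltR (s.subst σ) (t.subst σ) := by
  simp [ltR, Fm.subst, Tm.subst, Tm.subst_cl, Tm.wk_subst_up, Sub.up]

theorem leR_subst (s t : Tm Γ real) (σ : Sub Γ Δ) :
    (leR s t).subst σ = leR (s.subst σ) (t.subst σ) := by
  simp [leR, Fm.subst, ltR_subst]

theorem eqR_subst (s t : Tm Γ real) (σ : Sub Γ Δ) :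
    (eqR s t).subst σ = eqR (s.subst σ) (t.subst σ) := by
  simp [eqR, Fm.subst, Tm.subst, Tm.subst_cl, Tm.wk_subst_up, Sub.up]

theorem subS_subst (A B : Tm Γ event) (σ : Sub Γ Δ) :
    (subS A B).subst σ = subS (A.subst σ) (B.subst σ) := by
  simp [subS, Fm.subst, Tm.subst, Tm.wk_subst_up, Sub.up]

end Substitution

section Events

variable {M : Str}

instance : Membership (M.C sample) (M.C event) := ⟨fun A x => M.app (M.app (M.cst .mem) x) A = 0⟩
instance : EmptyCollection (M.C event) := ⟨M.cst .empty⟩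
instance : Compl (M.C event) := ⟨M.app (M.cst .compl)⟩
instance : Union (M.C event) := ⟨fun A B => M.app (M.app (M.cst .union) A) B⟩
instance : Inter (M.C event) := ⟨fun A B => (Aᶜ ∪ Bᶜ)ᶜ⟩

/-- The finite union `A 0 ∪ … ∪ A n`. -/
def partialUnion (A : M.C (nat ⇒ₜ event)) (n : Num M) : M.C event :=
  M.app (M.app (cupLC.eval .nil) A) n

/-- The part of `A n` outside of the earlier members of the sequence: the paper's `(A↑)_n`. -/
def disjointPart (A : M.C (nat ⇒ₜ event)) (n : Num M) : M.C event :=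
  M.app (M.app (disjC.eval .nil) A) n

@[simp] theorem app_mem_eq_zero (x : M.C sample) (A : M.C event) :
    M.app (M.app (M.cst .mem) x) A = 0 ↔ x ∈ A := Iff.rfl

@[simp] theorem cst_empty : M.cst .empty = (∅ : M.C event) := rfl

@[simp] theorem app_compl (A : M.C event) : M.app (M.cst .compl) A = Aᶜ := rfl

@[simp] theorem app_union (A B : M.C event) : M.app (M.app (M.cst .union) A) B = A ∪ B := rfl

@[simp] theorem compl_union_compl (A B : M.C event) : (Aᶜ ∪ Bᶜ)ᶜ = A ∩ B := rfl

@[simp] theorem app_cupLC (A : M.C (nat ⇒ₜ event)) (n : Num M) :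
    M.app (M.app (cupLC.eval .nil) A) n = partialUnion A n := rfl

@[simp] theorem app_disjC (A : M.C (nat ⇒ₜ event)) (n : Num M) :
    M.app (M.app (disjC.eval .nil) A) n = disjointPart A n := rfl

theorem sat_ren_wk_up {Γ : Ctx} {σ τ : Ty} (φ : Fm (σ :: Γ)) (a : M.C σ) (b : M.C τ)
    (e : Env M Γ) : (φ.ren Ren.wk.up).sat (a ∷ b ∷ e) ↔ φ.sat (a ∷ e) := by
  rw [Fm.sat_ren]
  convert Iff.rfl using 2
  funext ρ v; cases v <;> rfl

theorem sat_inUnion {Γ : Ctx} {A : Tm Γ (nat ⇒ₜ event)} {x : M.C sample} {e : Env M Γ} :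
    (inUnion A).sat (x ∷ e) ↔ ∃ n, x ∈ M.app (A.eval e) n := by
  simp [inUnion]

theorem sat_dual_inUnion {Γ : Ctx} {A : Tm Γ (nat ⇒ₜ event)} {x : M.C sample} {e : Env M Γ} :
    (inUnion A).dual.sat (x ∷ e) ↔ ∀ n, x ∉ M.app (A.eval e) n := by
  simp [inUnion, Fm.dual]

variable [Model M]

/-- The content of an event, as the value of a real number of the model. -/
noncomputable def content (A : M.C event) : RealValue M := realVal (M.app (M.cst .prob) A)

@[simp] theorem realVal_app_prob (A : M.C event) : realVal (M.app (M.cst .prob) A) = content A :=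
  rfl

@[simp] theorem notMem_empty (x : M.C sample) : x ∉ (∅ : M.C event) :=
  Model.sat_of_axm (Γ := [sample]) (φ := not (memF v0 (const .empty))) (fun _ _ => .mem_empty _)
    (x ∷ .nil)

@[simp] theorem mem_compl {x : M.C sample} {A : M.C event} : x ∈ Aᶜ ↔ x ∉ A :=
  have h := Model.sat_of_axm (Γ := [sample, event])
    (φ := iff (memF v0 (cpl v1)) (not (memF v0 v1))) (fun _ _ => .mem_compl _ _) (x ∷ A ∷ .nil)
  ⟨h.1, h.2⟩

@[simp] theorem mem_union {x : M.C sample} {A B : M.C event} : x ∈ A ∪ B ↔ x ∈ A ∨ x ∈ B :=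
  have h := Model.sat_of_axm (Γ := [sample, event, event])
    (φ := iff (memF v0 (cup v1 v2)) (memF v0 v1 ⋎' memF v0 v2)) (fun _ _ => .mem_union _ _ _)
    (x ∷ A ∷ B ∷ .nil)
  ⟨h.1, h.2⟩

@[simp] theorem mem_inter {x : M.C sample} {A B : M.C event} : x ∈ A ∩ B ↔ x ∈ A ∧ x ∈ B := by
  rw [← compl_union_compl, mem_compl, mem_union, mem_compl, mem_compl, not_or, not_not, not_not]

theorem content_mem_Icc (A : M.C event) : content A ∈ Set.Icc 0 1 := by
  have h := Model.sat_of_axm (Γ := [event]) (φ := leR (cl rzeroC) (pr v0) ⋏' leR (pr v0) (cl roneC))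
    (fun _ s => by
      simpa [Fm.subst, leR_subst, Tm.subst, Tm.subst_cl] using Axm.prob_range (s _ .zero))
    (A ∷ .nil)
  simpa using h

theorem content_empty : content (∅ : M.C event) = 0 := by
  simpa using realVal_eq_of_sat_eqR (M := M) (Model.sat_of_axm (Γ := [])
    (φ := eqR (pr (const .empty)) (cl rzeroC))
    (fun _ _ => by simpa [eqR_subst, Tm.subst, Tm.subst_cl] using Axm.prob_empty) .nil)

theorem content_compl_empty : content (∅ᶜ : M.C event) = 1 := by
  simpa using realVal_eq_of_sat_eqR (M := M) (Model.sat_of_axm (Γ := [])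
    (φ := eqR (pr sure) (cl roneC))
    (fun _ _ => by simpa [eqR_subst, Tm.subst, Tm.subst_cl] using Axm.prob_sure) .nil)

theorem content_mono {A B : M.C event} (h : ∀ x ∈ A, x ∈ B) : content A ≤ content B := by
  have h_mono := Model.sat_of_axm (Γ := [event, event]) (φ := subS v0 v1 ⟹' leR (pr v0) (pr v1))
    (fun _ s => by
      simpa [Fm.subst, leR_subst, subS_subst, Tm.subst] using
        Axm.prob_mono (s _ .zero) (s _ (.succ .zero))) (A ∷ B ∷ .nil)
  simpa using h_mono (by simpa [subS] using h)

theorem content_congr {A B : M.C event} (h : ∀ x, x ∈ A ↔ x ∈ B) : content A = content B :=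
  (content_mono fun x => (h x).1).antisymm (content_mono fun x => (h x).2)

theorem content_union (A B : M.C event) :
    content (A ∪ B) = content A + content B - content (A ∩ B) := by
  simpa using realVal_eq_of_sat_eqR (M := M) (Model.sat_of_axm (Γ := [event, event])
    (φ := eqR (pr (cup v0 v1)) (rsub (radd (pr v0) (pr v1)) (pr (cap v0 v1))))
    (fun _ s => by
      simpa [eqR_subst, Tm.subst, Tm.subst_cl] using Axm.prob_union (s _ .zero) (s _ (.succ .zero)))
    (A ∷ B ∷ .nil))

theorem content_union_le (A B : M.C event) : content (A ∪ B) ≤ content A + content B :=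
  (content_union A B).trans_le (sub_le_self _ (content_mem_Icc _).1)

theorem content_union_of_disjoint {A B : M.C event} (h : ∀ x ∈ A, x ∉ B) :
    content (A ∪ B) = content A + content B := by
  have inter_eq : content (A ∩ B) = 0 :=
    (content_congr fun x => by simpa using h x).trans content_empty
  rw [content_union, inter_eq, sub_zero]

theorem partialUnion_zero (A : M.C (nat ⇒ₜ event)) : partialUnion A 0 = M.app A 0 := by
  rw [← app_cupLC, cupLC]; simp

theorem partialUnion_add_one (A : M.C (nat ⇒ₜ event)) (n : Num M) :
    partialUnion A (n + 1) = partialUnion A n ∪ M.app A (n + 1) := by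
  rw [← app_cupLC, ← app_cupLC, cupLC, app_lam,
    app_lam_recT_add_one n (cup v1 (v2 ⊙ suc v0))]
  simp

theorem disjointPart_zero (A : M.C (nat ⇒ₜ event)) : disjointPart A 0 = M.app A 0 := by
  rw [← app_disjC, disjC]; simp

theorem disjointPart_add_one (A : M.C (nat ⇒ₜ event)) (n : Num M) :
    disjointPart A (n + 1) = M.app A (n + 1) ∩ (partialUnion A n)ᶜ := by
  rw [← app_disjC, disjC, app_lam,
    app_lam_recT_add_one n (cap (v2 ⊙ suc v0) (cpl (cupLC.cl ⊙ v2 ⊙ v0)))]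
  simp

theorem mem_partialUnion {A : M.C (nat ⇒ₜ event)} {x : M.C sample} {n : Num M} :
    x ∈ partialUnion A n ↔ ∃ i ≤ n, x ∈ M.app A i := by
  induction n using Num.induction with
  | definable =>
    exact ⟨_, iff (memF v1 (cupLC.cl ⊙ v2 ⊙ v0)) (ex nat (le0 v0 v1 ⋏' memF v2 (v3 ⊙ v0))),
      x ∷ A ∷ .nil, fun _ => by simp [tsub_eq_zero_iff_le, iff_def]⟩
  | zero => simp [partialUnion_zero]
  | succ n ih =>
    rw [partialUnion_add_one, mem_union, ih]
    constructor
    · rintro (⟨i, hi, hx⟩ | hx)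
      · exact ⟨i, hi.trans le_self_add, hx⟩
      · exact ⟨_, le_rfl, hx⟩
    · rintro ⟨i, hi, hx⟩
      rcases hi.lt_or_eq with hlt | rfl
      · exact .inl ⟨i, Order.lt_add_one_iff.1 hlt, hx⟩
      · exact .inr hx

theorem content_partialUnion_add_one (A : M.C (nat ⇒ₜ event)) (n : Num M) :
    content (partialUnion A (n + 1)) =
      content (partialUnion A n) + content (disjointPart A (n + 1)) := by
  rw [← content_union_of_disjoint fun x hx => ?_]
  · refine content_congr fun x => ?_
    rw [partialUnion_add_one, disjointPart_add_one, mem_union, mem_union, mem_inter, mem_compl]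
    tauto
  · rw [disjointPart_add_one, mem_inter, mem_compl]
    exact fun h => h.2 hx

theorem realVal_rsumC_disjointPart (A : M.C (nat ⇒ₜ event)) {F : M.C (nat ⇒ₜ real)}
    (hF : ∀ n, M.app F n = M.app (M.cst .prob) (disjointPart A n)) (n : Num M) :
    realVal (M.app (M.app (rsumC.eval .nil) F) n) = content (partialUnion A n) := by
  induction n using Num.induction with
  | definable =>
    exact ⟨_, leR (cl rsumC ⊙ v1 ⊙ v0) (pr (cupLC.cl ⊙ v2 ⊙ v0)) ⋏'
      leR (pr (cupLC.cl ⊙ v2 ⊙ v0)) (cl rsumC ⊙ v1 ⊙ v0), F ∷ A ∷ .nil,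
      fun _ => by simp [le_antisymm_iff]⟩
  | zero => rw [app_rsumC_zero, hF, realVal_app_prob, partialUnion_zero, disjointPart_zero]
  | succ n ih =>
    rw [realVal_app_rsumC_add_one, ih, hF, realVal_app_prob, content_partialUnion_add_one]

@[simp] theorem realVal_eval_partialSum {Γ : Ctx} (A : Tm Γ (nat ⇒ₜ event)) (l : Tm Γ nat)
    (e : Env M Γ) :
    realVal ((partialSum A l).eval e) = content (partialUnion (A.eval e) (l.eval e)) := by
  have h := realVal_rsumC_disjointPart (A.eval e)
    (F := (lam (pr (cl disjC ⊙ A.wk ⊙ v0))).eval e) (fun n => by simp) (l.eval e)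
  simpa [partialSum] using h

/-- The contents of the finite unions increase and are at most `1`, so they cannot jump by
`2 ^ (-k)` more than `2 ^ k` times. -/
theorem exists_content_partialUnion_le (A : M.C (nat ⇒ₜ event)) (k : Num M) :
    ∃ n, ∀ m ≥ n,
      content (partialUnion A m) ≤ content (partialUnion A n) + ofField atTop (eps k) := by
  by_contra! h
  have h_jump (n : Num M) : ∃ m,
      content (partialUnion A n) + ofField atTop (eps k) ≤ content (partialUnion A m) := by
    obtain ⟨m, -, hm⟩ := h n
    rw [content, content, ← realVal_app_rpowC, ← realVal_app_raddC] at hm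
    refine ⟨m, ?_⟩
    simpa using (realVal_le_total _ _).resolve_left hm
  have realVal_mkQ (n j : Num M) : realVal ((lam (mkQ v2 zero (cl powC ⊙ v3))).eval
      (n ∷ j ∷ k ∷ A ∷ .nil)) = ofField atTop (of j * eps k) :=
    realVal_eq_ofField fun i => by simp [ratVal_mkQN _ _ (twoPow_pos k).ne', eps, div_eq_mul_inv]
  have exists_ge (j : Num M) :
      ∃ n, ofField atTop (of j * eps k) ≤ content (partialUnion A n) := by
    induction j using Num.induction with
    | definable =>
      exact ⟨_, ex nat (leR (lam (mkQ v2 zero (cl powC ⊙ v3))) (pr (cupLC.cl ⊙ v3 ⊙ v0))),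
        k ∷ A ∷ .nil, fun j => by simp [realVal_mkQ]⟩
    | zero => exact ⟨0, by simpa using (content_mem_Icc _).1⟩
    | succ j ih =>
      obtain ⟨n, hn⟩ := ih
      obtain ⟨m, hm⟩ := h_jump n
      refine ⟨m, ?_⟩
      rw [map_add, map_one, add_mul, one_mul, map_add]
      exact (add_le_add_left hn _).trans hm
  obtain ⟨n, hn⟩ := exists_ge (twoPow k + 1)
  refine (hn.trans (content_mem_Icc _).2).not_gt ?_
  rw [← ofField_one]
  refine ofField_strictMono ?_
  rw [map_add, map_one, add_mul, one_mul, of_twoPow_mul_eps]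
  exact lt_add_of_pos_right _ (eps_pos k)

theorem sat_probGE {Γ : Ctx} {φ : Fm (sample :: Γ)} {t : Tm Γ real} {e : Env M Γ} :
    (probGE φ t).sat e ↔
      ∀ B : M.C event, content B < realVal (t.eval e) → ∃ x ∉ B, φ.sat (x ∷ e) := by
  simp [probGE, sat_ren_wk_up]

theorem exists_notMem_of_content_lt_partialUnion {A : M.C (nat ⇒ₜ event)} {n : Num M}
    {B : M.C event} (h : content B < content (partialUnion A n)) :
    ∃ x ∉ B, ∃ i, x ∈ M.app A i := by
  by_contra! hB
  refine h.not_ge (content_mono fun x hx => ?_)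
  obtain ⟨i, -, hi⟩ := mem_partialUnion.1 hx
  exact by_contra fun hxB => hB x hxB i hi

end Events

/-! ### Uniform boundedness and sigma-additivity -/

section UniformBoundedness

theorem minSub_subst {Γ Δ : Ctx} {σs : List Ty} (s : Sub Γ Δ) :
    (fun τ v => (minSub Γ σs τ v).subst s.up.up.up) =
      fun τ v => (s.up.up.up τ v).subst (minSub Δ σs) := by
  funext τ v
  rcases v with _ | _ | _ | v
  · simp only [minSub, Sub.cons, Tm.subst, Tm.subst_cl]; rfl
  · rfl
  · rfl
  · simp only [minSub, Sub.cons, Sub.up, Tm.subst, Tm.wk, Tm.ren_ren, Tm.subst_ren]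
    exact Tm.ren_eq_subst ..

theorem ubFormula_singleton {Γ : Ctx} {σs : List Ty} {β : Ty}
    (φ : Fm (nat :: β :: arrows σs nat :: nat :: (nat ⇒ₜ arrows σs nat) :: Γ)) :
    ubFormula Γ σs [β] φ = all (nat ⇒ₜ arrows σs nat)
      (all nat (all (arrows σs nat) (all β (ex nat (φ.subst (minSub Γ σs).up.up)))) ⟹'
        ex (nat ⇒ₜ nat) (all nat (all (arrows σs nat) (all β (ex nat
          (le0 v0 (var (.succ (.succ (.succ (.succ .zero)))) ⊙ v3) ⋏'
            (φ.subst (minSub Γ σs).up.up).ren Ren.wk.up.up.up.up)))))) :=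
  rfl

theorem ubFormula_singleton_subst {Γ Δ : Ctx} {σs : List Ty} {β : Ty}
    (φ : Fm (nat :: β :: arrows σs nat :: nat :: (nat ⇒ₜ arrows σs nat) :: Γ)) (s : Sub Γ Δ) :
    (ubFormula Γ σs [β] φ).subst s = ubFormula Δ σs [β] (φ.subst s.up.up.up.up.up) := by
  have comm (ψ : Fm (nat :: β :: arrows σs nat :: nat :: (nat ⇒ₜ arrows σs nat) :: Γ)) :
      (ψ.ren (Ren.wk (σ := nat ⇒ₜ nat)).up.up.up.up).subst s.up.up.up.up.up.up =
        (ψ.subst s.up.up.up.up.up).ren Ren.wk.up.up.up.up := by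
    simp only [Fm.subst_ren, Fm.ren_subst, Sub.up_ren, Sub.up_comp_ren]
    rfl
  simp only [ubFormula_singleton, Fm.subst, comm, Fm.subst_subst, Sub.up_comp, minSub_subst,
    Tm.subst, Tm.subst_cl]
  rfl

theorem Env.cons_wk {M : Str} {Γ : Ctx} {σ : Ty} (a : M.C σ) (e : Env M Γ) :
    (fun τ v => (a ∷ e) τ (Ren.wk τ v)) = e := rfl

/-- The pointwise minimum of two functionals with values of type `0`. -/
def minObj {M : Str} {σs : List Ty} (x y : M.C (arrows σs nat)) : M.C (arrows σs nat) :=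
  M.app (M.app ((minC σs).eval .nil) x) y

theorem minSub_eval {M : Str} {Γ : Ctx} {σs : List Ty} (x : M.C (arrows σs nat)) (k : M.C nat)
    (y : M.C (nat ⇒ₜ arrows σs nat)) (e : Env M Γ) :
    (fun τ v => (minSub Γ σs τ v).eval (x ∷ k ∷ y ∷ e)) =
      minObj x (M.app y k) ∷ k ∷ y ∷ e := by
  funext τ v
  cases v with
  | zero => simp [minSub, Sub.cons, minObj]
  | succ v => rfl

theorem sat_ubFormula_singleton {M : Str} [Model M] {Γ : Ctx} {σs : List Ty} {β : Ty}
    {φ : Fm (nat :: β :: arrows σs nat :: nat :: (nat ⇒ₜ arrows σs nat) :: Γ)} {e : Env M Γ} :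
    (ubFormula Γ σs [β] φ).sat e ↔ ∀ y : M.C (nat ⇒ₜ arrows σs nat),
      (∀ k x z, ∃ w, φ.sat (w ∷ z ∷ minObj x (M.app y k) ∷ k ∷ y ∷ e)) →
        ∃ χ : M.C (nat ⇒ₜ nat), ∀ k x z, ∃ w : Num M, w ≤ M.app χ k ∧
          φ.sat (w ∷ z ∷ minObj x (M.app y k) ∷ k ∷ y ∷ e) := by
  simp only [ubFormula_singleton, Fm.sat, Fm.sat_subst, Fm.sat_ren, Env.cons_up, Env.cons_wk,
    Sub.eval_up, minSub_eval]
  simp [← tsub_eq_zero_iff_le]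

variable {M : Str} [ModelOf UBΩ₀ M]

theorem uniform_boundedness {Γ : Ctx} {σs : List Ty} {β : Ty} (hβ : β.EndsInSample)
    {φ : Fm (nat :: β :: arrows σs nat :: nat :: (nat ⇒ₜ arrows σs nat) :: Γ)} (hφ : φ.QF)
    {e : Env M Γ} {y : M.C (nat ⇒ₜ arrows σs nat)}
    (h : ∀ k x z, ∃ w, φ.sat (w ∷ z ∷ minObj x (M.app y k) ∷ k ∷ y ∷ e)) :
    ∃ χ : M.C (nat ⇒ₜ nat), ∀ k x z, ∃ w : Num M, w ≤ M.app χ k ∧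
      φ.sat (w ∷ z ∷ minObj x (M.app y k) ∷ k ∷ y ∷ e) := by
  refine sat_ubFormula_singleton.1 (ModelOf.sat_of_prf (T := UBΩ₀) (fun Δ s => ?_) e) y h
  rw [ubFormula_singleton_subst]
  exact .extra (.inst σs [β] (List.forall_mem_singleton.2 hβ) _ (.qf (hφ.subst _)))

theorem exists_bound_of_forall_mem (A : M.C (nat ⇒ₜ event)) (B : M.C event)
    (h : ∀ x, ∃ n, x ∈ B ∨ x ∈ M.app A n) : ∃ N, ∀ x, ∃ n ≤ N, x ∈ B ∨ x ∈ M.app A n := by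
  let φ : Fm [nat, sample, nat, nat, nat ⇒ₜ nat, nat ⇒ₜ event, event] :=
    memF v1 (var (.succ (.succ (.succ (.succ (.succ (.succ .zero))))))) ⋎'
      memF v1 (var (.succ (.succ (.succ (.succ (.succ .zero))))) ⊙ v0)
  obtain ⟨χ, hχ⟩ := uniform_boundedness (σs := []) (β := sample) (φ := φ) (e := A ∷ B ∷ .nil)
    (y := M.cst .succ) trivial ⟨trivial, trivial⟩ fun _ _ x => h x
  exact ⟨M.app χ 0, hχ 0 (0 : Num M)⟩

theorem exists_forall_content_lt_exists_notMem (A : M.C (nat ⇒ₜ event)) (k : Num M) :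
    ∃ n, ∀ B : M.C event, content B < 1 - (content (partialUnion A n) + ofField atTop (eps k)) →
      ∃ x ∉ B, ∀ i, x ∉ M.app A i := by
  obtain ⟨n, hn⟩ := exists_content_partialUnion_le A k
  refine ⟨n, fun B hB => ?_⟩
  by_contra! h
  obtain ⟨N, hN⟩ := exists_bound_of_forall_mem A B fun x => by
    by_cases hx : x ∈ B
    · exact ⟨0, .inl hx⟩
    · exact (h x hx).imp fun _ => .inr
  have covers (x : M.C sample) : x ∈ B ∪ partialUnion A (max N n) := by
    obtain ⟨i, hi, hx⟩ := hN x
    exact mem_union.2 (hx.imp_right fun hx => mem_partialUnion.2 ⟨i, le_max_of_le_left hi, hx⟩)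
  have one_le : 1 ≤ content B + (content (partialUnion A n) + ofField atTop (eps k)) :=
    calc 1 = content (∅ᶜ : M.C event) := content_compl_empty.symm
      _ ≤ content (B ∪ partialUnion A (max N n)) := content_mono fun x _ => covers x
      _ ≤ content B + content (partialUnion A (max N n)) := content_union_le _ _
      _ ≤ _ := add_le_add_right (hn _ (le_max_right _ _)) _
  exact hB.not_ge (sub_le_iff_le_add.2 one_le)

theorem sat_sigmaAdditivity : sigmaAdditivity.sat (Env.nil (M := M)) := by
  constructor
  · intro A n
    refine sat_probGE.2 fun B hB => ?_
    simp only [sat_inUnion]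
    exact exists_notMem_of_content_lt_partialUnion (by simpa using hB)
  · intro A k
    obtain ⟨n, hn⟩ := exists_forall_content_lt_exists_notMem A k
    refine ⟨n, sat_probGE.2 fun B hB => ?_⟩
    simp only [sat_dual_inUnion]
    exact hn B (by simpa using hB)

end UniformBoundedness

end ProbContent

theorem mainTheorem10 : ProbContent.Proves ProbContent.UBΩ₀ ProbContent.sigmaAdditivity :=
  ProbContent.proves_of_forall_sat fun _ _ => ProbContent.sat_sigmaAdditivity
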